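/- **Theorem (Time for Construction).** Let $\Lambda\subseteq\mathbb R^d$ be a $d$-dimensional lattice with given basis $U=(u_1,\dots,u_d)$, let $K\subseteq\mathbb R^d$ be a locally finite $\Lambda$-periodic cell complex, and let $f\colon K\to\mathbb R$ be a $\Lambda$-periodic filter, i.e. $f(\sigma)\le f(\tau)$ whenever $\sigma$ is a face of $\tau$, and $f(\sigma+u)=f(\sigma)$ for all cells $\sigma$ and all $u\in\Lambda$. Let $n$ and $m$ be the numbers of vertices and edges of the quotient complex $K/\Lambda$. Represent every vertex of $K/\Lambda$ by its preimage in a fixed unit cell of $U$. If an edge of $K$ goes from $x+Uv$ to $y+Uw$, with $x,y$ such representatives and $v,w\in\mathbb Z^d$, then its *shift vector* is $w-v\in\mathbb Z^d$. Let $D$ be the largest absolute value of an entry of a shift vector, and assume $(\sqrt d\,D\,m)^d\ge 2$. The *periodic merge tree* of $f$ is the quotient of $\{(x,s)\in(\mathbb R^d/\Lambda)\times\mathbb R : x\in(K/\Lambda)_s\}$, where $(K/\Lambda)_s$ is the union of the cells of $K/\Lambda$ with value at most $s$, by the relation that identifies $(x,s)$ with $(y,s)$ if $x$ and $y$ lie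 in the same connected component of $(K/\Lambda)_s$. It carries the quotient topology, the height function $(x,s)\mapsto s$, and the frequency function that maps the point representing a component $C$ to the *shadow monomial* $$\frac{\mathrm{vol}_p(\Lambda_C)}{\mathrm{vol}_d(\Lambda)}\,\nu_{d-p}\,R^{d-p}.$$ Here $\Lambda_C$ is the lattice of all $u\in\Lambda$ that map every connected component of the preimage of $C$ in $\mathbb R^d$ to itself, $p$ is its dimension, $\mathrm{vol}_q$ is the $q$-dimensional volume of a unit cell of a $q$-dimensional lattice, and $\nu_q$ is the volume of the unit ball in $\mathbb R^q$. There are a single algorithm and an absolute constant $c$ such that the following holds for all such data, in every dimension. The input consists of $d,n,m$, the coordinates of $u_1,\dots,u_d$, and, in arbitrary order, the vertices and edges of $K/\Lambda$ with their filter values and, for each edge, its endpoints and its shift vector in one of its two directions. From it, the algorithm constructs the periodic merge tree of $f$, including all shadow monomials, in time at most $$c\,\bigl(n\log n+m\,2^d\,d^{\,d+3}\log(\sqrt d\,D\,m)\bigr).$$ The tree is output as a decomposition into beams (intervals of heights, one for each vertex of $K/\Lambda$, where a beam that ends is attached to a beam that starts no later), each divided into finitely many epochs labeled with the coefficient and the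 exponent of the shadow monomial. Time is measured on a random access machine with finitely many arrays of integers and of real numbers, initially zero outside the input. It spends one unit of time on each array access, each comparison of two integers or of two reals, each addition, subtraction, multiplication or division of two reals or of two integers (with rounding to an integer in the latter case), each square root of a real, each conversion of an integer to a real, and each use of an integer constant or of the constant $\pi$. -/

import Mathlib

noncomputable section

namespace PMT

open Set MeasureTheory

/-! ### Cell complexes and filters in Euclidean space -/

/-- Euclidean `d`-space. -/
abbrev E (d : ℕ) := EuclideanSpace ℝ (Fin d)

/-- The translate of a set by a vector. -/
def translate {d : ℕ} (u : E d) (σ : Set (E d)) : Set (E d) := (fun x => u + x) '' σ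

/-- Given a collection of cells with their dimensions, `ρ` is a (proper) face of `σ` if it is a cell
of lower dimension that is contained in `σ`. The axioms of a cell complex say that the union of the
faces is the boundary of `σ`. -/
def IsFace {d : ℕ} (cells : Set (Set (E d))) (dim : Set (E d) → ℕ) (ρ σ : Set (E d)) : Prop :=
  ρ ∈ cells ∧ dim ρ < dim σ ∧ ρ ⊆ σ

/-- A locally finite cell complex in `ℝ^d`: every cell is homeomorphic to a closed unit ball whose
boundary sphere corresponds to a union of lower-dimensional cells, and two different cells intersect
in a (possibly empty) union of common faces, where one of the two may be a face of the other. -/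
structure CellComplex (d : ℕ) where
  cells : Set (Set (E d))
  dim : Set (E d) → ℕ
  dim_le : ∀ σ ∈ cells, dim σ ≤ d
  ball : ∀ σ ∈ cells, ∃ h : Metric.closedBall (0 : E (dim σ)) 1 ≃ₜ σ,
    {x : E d | ∃ y : Metric.closedBall (0 : E (dim σ)) 1,
      ‖(y : E (dim σ))‖ = 1 ∧ (h y : E d) = x}
      = ⋃₀ {ρ | IsFace cells dim ρ σ}
  inter : ∀ σ ∈ cells, ∀ τ ∈ cells, σ ≠ τ →
    σ ∩ τ = ⋃₀ {ρ | ρ ∈ cells ∧ (ρ = σ ∨ IsFace cells dim ρ σ) ∧ (ρ = τ ∨ IsFace cells dim ρ τ)}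
  locallyFinite : LocallyFinite (fun σ : cells => (σ : Set (E d)))

namespace CellComplex

variable {d : ℕ} (K : CellComplex d)

/-- The vertices, as points. -/
def vertices : Set (E d) := {x | {x} ∈ K.cells ∧ K.dim {x} = 0}

/-- The edges, as closed `1`-cells. -/
def edges : Set (Set (E d)) := {σ | σ ∈ K.cells ∧ K.dim σ = 1}

/-- Values do not decrease from a face to a cell. Only the values on cells matter. -/
def IsFilter (f : Set (E d) → ℝ) : Prop :=
  ∀ σ ∈ K.cells, ∀ τ ∈ K.cells, IsFace K.cells K.dim σ τ → f σ ≤ f τ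

/-- Invariance under translations in `Λ`. (Dimensions of cells are topological invariants, so the
condition on `dim` just says that the dimension function is the right one.) -/
def IsPeriodic (Λ : Submodule ℤ (E d)) : Prop :=
  ∀ σ ∈ K.cells, ∀ u ∈ Λ, translate u σ ∈ K.cells ∧ K.dim (translate u σ) = K.dim σ

/-- A `Λ`-periodic filter. -/
def IsPeriodicFilter (Λ : Submodule ℤ (E d)) (f : Set (E d) → ℝ) : Prop :=
  K.IsFilter f ∧ ∀ σ ∈ K.cells, ∀ u ∈ Λ, f (translate u σ) = f σ

/-- The sublevel set of a filter, as a set of points. -/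
def sublevel (f : Set (E d) → ℝ) (t : ℝ) : Set (E d) := ⋃₀ {σ | σ ∈ K.cells ∧ f σ ≤ t}

end CellComplex

/-! ### Merge trees -/

section MergeTree

variable {X : Type*} [TopologicalSpace X]

/-- The sublevel space `{(x, s) | x ∈ S s}` of a family of sublevel sets. -/
abbrev SublevelSpace (S : ℝ → Set X) := {p : X × ℝ // p.1 ∈ S p.2}

/-- Two points of the sublevel space are equivalent if they have the same height `s` and lie in the
same connected component of `S s`. -/
def sublevelSetoid (S : ℝ → Set X) : Setoid (SublevelSpace S) where
  r p q := p.1.2 = q.1.2 ∧ connectedComponentIn (S p.1.2) p.1.1 = connectedComponentIn (S q.1.2) q.1.1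
  iseqv := ⟨fun _ => ⟨rfl, rfl⟩, fun h => ⟨h.1.symm, h.2.symm⟩,
    fun h k => ⟨h.1.trans k.1, h.2.trans k.2⟩⟩

/-- The merge tree: the quotient of the sublevel space, with the quotient topology. -/
def MergeTree (S : ℝ → Set X) := Quotient (sublevelSetoid S)

instance (S : ℝ → Set X) : TopologicalSpace (MergeTree S) :=
  inferInstanceAs (TopologicalSpace (Quotient (sublevelSetoid S)))

/-- The height function. -/
def MergeTree.height {S : ℝ → Set X} : MergeTree S → ℝ :=
  Quotient.lift (fun p => p.1.2) (fun _ _ h => h.1)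

/-- The connected component that a point of the merge tree represents. -/
def MergeTree.component {S : ℝ → Set X} : MergeTree S → Set X :=
  Quotient.lift (fun p => connectedComponentIn (S p.1.2) p.1.1) (fun _ _ h => h.2)

end MergeTree

/-! ### Lattices, shadows, and the periodic merge tree -/

/-- The dimension of a lattice: the number of vectors in a basis. -/
def latticeDim {d : ℕ} (L : Submodule ℤ (E d)) : ℕ := Module.finrank ℤ L

/-- The volume, in the dimension of the lattice, of a unit cell: the covolume of the lattice inside
the Euclidean space that is its linear span. -/
def latticeVolume {d : ℕ} (L : Submodule ℤ (E d)) : ℝ :=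
  ZLattice.covolume (ZLattice.comap ℝ L (Submodule.span ℝ (L : Set (E d))).subtype) volume

/-- The lattice spanned by a basis of `ℝ^d`. -/
def latticeOf {d : ℕ} (b : Module.Basis (Fin d) ℝ (E d)) : Submodule ℤ (E d) :=
  Submodule.span ℤ (Set.range b)

section Torus

variable {d : ℕ} (Λ : Submodule ℤ (E d))

/-- The quotient `ℝ^d / Λ`, with the quotient topology. -/
abbrev Torus := E d ⧸ Λ.toAddSubgroup

/-- The projection onto the quotient. -/
def proj (x : E d) : Torus Λ := QuotientAddGroup.mk x

/-- The shadows of `C ⊆ ℝ^d / Λ` are the connected components of its preimage in `ℝ^d`. -/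
def shadows (C : Set (Torus Λ)) : Set (Set (E d)) :=
  {c | ∃ y ∈ proj Λ ⁻¹' C, c = connectedComponentIn (proj Λ ⁻¹' C) y}

/-- The periodicity lattice: all vectors of `Λ` that leave the shadows of `C` invariant. -/
def periodicityLattice (C : Set (Torus Λ)) : Submodule ℤ (E d) :=
  AddSubgroup.toIntSubmodule
    { carrier := {u | u ∈ Λ ∧ ∀ c ∈ shadows Λ C, translate u c = c}
      zero_mem' := ⟨Λ.zero_mem, fun c _ => by simp [translate]⟩
      add_mem' := fun {u v} hu hv => ⟨Λ.add_mem hu.1 hv.1, fun c hc => by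
        have h : translate (u + v) c = translate u (translate v c) := by
          simp only [translate, image_image, add_assoc]
        rw [h, hv.2 c hc, hu.2 c hc]⟩
      neg_mem' := fun {u} hu => ⟨Λ.neg_mem hu.1, fun c hc => by
        have h : translate (-u) (translate u c) = c := by
          simp only [translate, image_image, neg_add_cancel_left, image_id']
        rwa [hu.2 c hc] at h⟩ }

/-- A monomial in the variable `R`, given by its coefficient and its exponent. -/
@[ext] structure Monomial where
  coeff : ℝ
  expo : ℤ

/-- The volume of the unit ball in `ℝ^q`. -/
def ballVolume (q : ℕ) : ℝ := (volume (Metric.ball (0 : E q) 1)).toReal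

/-- The shadow monomial of `C`: with `p` the dimension of the periodicity lattice,
`vol_p(Λ_C) / vol_d(Λ) * ν_{d-p} * R^(d-p)`. -/
def shadowMonomial (C : Set (Torus Λ)) : Monomial where
  coeff := latticeVolume (periodicityLattice Λ C) / latticeVolume Λ
    * ballVolume (d - latticeDim (periodicityLattice Λ C))
  expo := (d : ℤ) - latticeDim (periodicityLattice Λ C)

variable (K : CellComplex d) (f : Set (E d) → ℝ)

/-- The sublevel sets of the quotient filter on `K / Λ`, as sets of points of `ℝ^d / Λ`. -/
def quotientSublevel (t : ℝ) : Set (Torus Λ) := proj Λ '' K.sublevel f t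

/-- The periodic merge tree: the merge tree of the quotient filter. It comes with the functions
`MergeTree.height` and `frequency`. -/
abbrev PeriodicMergeTree := MergeTree (quotientSublevel Λ K f)

/-- The frequency function, which maps every point to its shadow monomial. -/
def frequency (x : PeriodicMergeTree Λ K f) : Monomial := shadowMonomial Λ x.component

end Torus

/-! ### The quotient graph with its shift vectors -/

/-- The lattice vector with given integer coordinates. -/
def latticeVector {d : ℕ} (b : Module.Basis (Fin d) ℝ (E d)) (k : Fin d → ℤ) : E d :=
  ∑ i, k i • b i

/-- A listing of the `n` vertices and the `m` edges of `K / Λ`. The vertices are represented by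
their shadows in a common unit cell of the basis `b` (with `corner` as its lower corner), the edges
by arbitrary shadows. The endpoints of the shadow `edge j` are the translates of
`vertex (src j)` and `vertex (tgt j)` by the lattice vectors with coordinates `srcCell j` and
`tgtCell j`. -/
structure QuotientGraph {d : ℕ} (K : CellComplex d) (b : Module.Basis (Fin d) ℝ (E d))
    (n m : ℕ) where
  corner : E d
  vertex : Fin n → E d
  vertex_mem : ∀ i, vertex i ∈ K.vertices
  vertex_unitCell : ∀ i, vertex i - corner ∈ ZSpan.fundamentalDomain b
  vertex_unique : ∀ x ∈ K.vertices, ∃! i, ∃ u ∈ latticeOf b, x = u + vertex i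
  edge : Fin m → Set (E d)
  edge_mem : ∀ j, edge j ∈ K.edges
  edge_unique : ∀ σ ∈ K.edges, ∃! j, ∃ u ∈ latticeOf b, σ = translate u (edge j)
  src : Fin m → Fin n
  tgt : Fin m → Fin n
  srcCell : Fin m → Fin d → ℤ
  tgtCell : Fin m → Fin d → ℤ
  endpoints : ∀ j, {x | x ∈ K.vertices ∧ x ∈ edge j} =
    {latticeVector b (srcCell j) + vertex (src j), latticeVector b (tgtCell j) + vertex (tgt j)}

namespace QuotientGraph

variable {d n m : ℕ} {K : CellComplex d} {b : Module.Basis (Fin d) ℝ (E d)}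
  (G : QuotientGraph K b n m)

/-- The shift vector of an edge, directed from `src j` to `tgt j`. -/
def shift (j : Fin m) (k : Fin d) : ℤ := G.tgtCell j k - G.srcCell j k

/-- The maximum magnitude of the shift vectors, which is the largest absolute entry. -/
def shiftMagnitude : ℕ :=
  Finset.univ.sup (fun j : Fin m => Finset.univ.sup (fun k : Fin d => (G.shift j k).natAbs))

end QuotientGraph

/-! ### The machine: a random access machine for integers and reals with unit costs -/

/-- The memory consists of arrays of integers and arrays of reals, indexed by integers. A program
mentions only finitely many of the arrays. -/
structure Store where
  int : ℕ → ℤ → ℤ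
  real : ℕ → ℤ → ℝ

/-- Integer expressions: constants, array access, and arithmetic. -/
inductive IExp
  | lit (z : ℤ)
  | get (a : ℕ) (i : IExp)
  | add (x y : IExp)
  | sub (x y : IExp)
  | mul (x y : IExp)
  | div (x y : IExp)

/-- The value of an integer expression. Division rounds down if the divisor is positive. -/
def IExp.eval (s : Store) : IExp → ℤ
  | lit z => z
  | get a i => s.int a (i.eval s)
  | add x y => x.eval s + y.eval s
  | sub x y => x.eval s - y.eval s
  | mul x y => x.eval s * y.eval s
  | div x y => x.eval s / y.eval s

/-- Every operation takes one unit of time. -/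
def IExp.cost : IExp → ℕ
  | lit _ => 1
  | get _ i => i.cost + 1
  | add x y => x.cost + y.cost + 1
  | sub x y => x.cost + y.cost + 1
  | mul x y => x.cost + y.cost + 1
  | div x y => x.cost + y.cost + 1

/-- Real expressions: conversion of integers, the constant `π`, array access, arithmetic, and square
roots. There is no rounding of reals to integers. -/
inductive RExp
  | ofInt (x : IExp)
  | pi
  | get (a : ℕ) (i : IExp)
  | add (x y : RExp)
  | sub (x y : RExp)
  | mul (x y : RExp)
  | div (x y : RExp)
  | sqrt (x : RExp)

/-- The value of a real expression. -/
def RExp.eval (s : Store) : RExp → ℝ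
  | ofInt x => (x.eval s : ℝ)
  | pi => Real.pi
  | get a i => s.real a (i.eval s)
  | add x y => x.eval s + y.eval s
  | sub x y => x.eval s - y.eval s
  | mul x y => x.eval s * y.eval s
  | div x y => x.eval s / y.eval s
  | sqrt x => Real.sqrt (x.eval s)

/-- Every operation takes one unit of time. -/
def RExp.cost : RExp → ℕ
  | ofInt x => x.cost + 1
  | pi => 1
  | get _ i => i.cost + 1
  | add x y => x.cost + y.cost + 1
  | sub x y => x.cost + y.cost + 1
  | mul x y => x.cost + y.cost + 1
  | div x y => x.cost + y.cost + 1
  | sqrt x => x.cost + 1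

/-- Tests: comparisons of integers and of reals, and their Boolean combinations. -/
inductive BExp
  | ile (x y : IExp)
  | rle (x y : RExp)
  | not (t : BExp)
  | and (t u : BExp)

/-- The truth of a test. -/
def BExp.eval (s : Store) : BExp → Prop
  | ile x y => x.eval s ≤ y.eval s
  | rle x y => x.eval s ≤ y.eval s
  | not t => ¬ t.eval s
  | and t u => t.eval s ∧ u.eval s

/-- Every operation takes one unit of time. -/
def BExp.cost : BExp → ℕ
  | ile x y => x.cost + y.cost + 1
  | rle x y => x.cost + y.cost + 1
  | not t => t.cost + 1
  | and t u => t.cost + u.cost + 1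

/-- Programs. -/
inductive Program
  | skip
  | setInt (a : ℕ) (i x : IExp)
  | setReal (a : ℕ) (i : IExp) (x : RExp)
  | seq (p q : Program)
  | branch (t : BExp) (p q : Program)
  | loop (t : BExp) (p : Program)

/-- Overwrite one entry of an integer array. -/
def Store.setInt (s : Store) (a : ℕ) (i x : ℤ) : Store :=
  { s with int := Function.update s.int a (Function.update (s.int a) i x) }

/-- Overwrite one entry of a real array. -/
def Store.setReal (s : Store) (a : ℕ) (i : ℤ) (x : ℝ) : Store :=
  { s with real := Function.update s.real a (Function.update (s.real a) i x) }

/-- `Runs p s s' t`: started with memory `s`, the program `p` halts after `t` units of time with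
memory `s'`. -/
inductive Runs : Program → Store → Store → ℕ → Prop
  | skip (s : Store) : Runs .skip s s 1
  | setInt (a : ℕ) (i x : IExp) (s : Store) :
      Runs (.setInt a i x) s (s.setInt a (i.eval s) (x.eval s)) (i.cost + x.cost + 1)
  | setReal (a : ℕ) (i : IExp) (x : RExp) (s : Store) :
      Runs (.setReal a i x) s (s.setReal a (i.eval s) (x.eval s)) (i.cost + x.cost + 1)
  | seq {p q : Program} {s s' s'' : Store} {t t' : ℕ} :
      Runs p s s' t → Runs q s' s'' t' → Runs (.seq p q) s s'' (t + t')
  | branch_true {c : BExp} {p q : Program} {s s' : Store} {t : ℕ} :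
      c.eval s → Runs p s s' t → Runs (.branch c p q) s s' (c.cost + t + 1)
  | branch_false {c : BExp} {p q : Program} {s s' : Store} {t : ℕ} :
      ¬ c.eval s → Runs q s s' t → Runs (.branch c p q) s s' (c.cost + t + 1)
  | loop_stop {c : BExp} {p : Program} {s : Store} :
      ¬ c.eval s → Runs (.loop c p) s s (c.cost + 1)
  | loop_step {c : BExp} {p : Program} {s s' s'' : Store} {t t' : ℕ} :
      c.eval s → Runs p s s' t → Runs (.loop c p) s' s'' t' →
        Runs (.loop c p) s s'' (c.cost + t + t' + 1)

/-! ### Input and output -/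

/-- The array with entries `v 0, …, v (n - 1)` at the indices `0, …, n - 1`, and zeros elsewhere. -/
def arrayOf {α : Type*} [Zero α] {n : ℕ} (v : Fin n → α) (z : ℤ) : α :=
  if h : 0 ≤ z ∧ z < n then v ⟨z.toNat, by omega⟩ else 0

/-- A matrix with `r` rows and `c` columns as an array: entry `(i, k)` has the index `i * c + k`. -/
def matrixArray {α : Type*} [Zero α] {r c : ℕ} (v : Fin r → Fin c → α) : ℤ → α :=
  arrayOf (fun z : Fin (r * c) => v z.divNat z.modNat)

/-- The input. Integer array `0` holds `d, n, m`, arrays `1` and `2` the two endpoints of every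
edge, array `3` the shift vectors of the edges. Real arrays `0` and `1` hold the filter values of
the vertices and of the edges, in no particular order, and array `2` the coordinates of the basis
vectors of the lattice. Everything else is zero. -/
def inputStore {d n m : ℕ} {K : CellComplex d} {b : Module.Basis (Fin d) ℝ (E d)}
    (f : Set (E d) → ℝ) (G : QuotientGraph K b n m) : Store where
  int := fun a => match a with
    | 0 => arrayOf ![(d : ℤ), (n : ℤ), (m : ℤ)]
    | 1 => arrayOf (fun j : Fin m => ((G.src j : ℕ) : ℤ))
    | 2 => arrayOf (fun j : Fin m => ((G.tgt j : ℕ) : ℤ))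
    | 3 => matrixArray G.shift
    | _ => fun _ => 0
  real := fun a => match a with
    | 0 => arrayOf (fun i : Fin n => f {G.vertex i})
    | 1 => arrayOf (fun j : Fin m => f (G.edge j))
    | 2 => matrixArray (fun i k : Fin d => b i k)
    | _ => fun _ => 0

/-- A tree assembled from `n` beams. Beam `i` is an interval of heights that starts at `birth i`. If
`ending i = some (j, h)`, it ends at height `h`, where it is attached to beam `j`; if
`ending i = none`, it is unbounded. Beam `i` is divided into `epochs i` epochs, the `k`-th of which
starts at `start i k` and carries the monomial `mono i k`, for `k < epochs i`. -/
structure BeamTree (n : ℕ) where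
  birth : Fin n → ℝ
  ending : Fin n → Option (Fin n × ℝ)
  epochs : Fin n → ℕ
  start : Fin n → ℕ → ℝ
  mono : Fin n → ℕ → Monomial

namespace BeamTree

variable {n : ℕ} (T : BeamTree n)

/-- The closed interval of heights of a beam. -/
def beam (i : Fin n) : Set ℝ := {s | T.birth i ≤ s ∧ ∀ j h, T.ending i = some (j, h) → s ≤ h}

/-- The disjoint union of the beams. -/
abbrev Points := Σ i : Fin n, T.beam i

/-- `p` is the end of a beam, and `q` is the point to which it is attached. -/
def Attach (p q : T.Points) : Prop :=
  T.ending p.1 = some (q.1, (p.2 : ℝ)) ∧ (q.2 : ℝ) = p.2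

/-- The tree as a topological space: the beams, with every end of a beam identified with the point
to which it is attached. -/
abbrev Space := Quot T.Attach

/-- The monomial of the epoch of beam `i` that contains height `s` is `μ`. -/
def HasMonomial (i : Fin n) (s : ℝ) (μ : Monomial) : Prop :=
  ∃ k < T.epochs i, T.start i k ≤ s ∧ (∀ l, k < l → l < T.epochs i → s < T.start i l) ∧
    T.mono i k = μ

end BeamTree

/-- The tree described by the output. For every beam `i`, integer array `4` holds the beam to which
it is attached (or a negative number if the beam is unbounded), arrays `5` and `6` the
position and the length of its list of epochs, real array `3` its birth and array `4` the height
of its end. The epochs are stored in integer array `7` (exponents) and real arrays `5` (starts) and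
`6` (coefficients). -/
def outputTree (n : ℕ) (s : Store) : BeamTree n where
  birth i := s.real 3 i
  ending i := if h : 0 ≤ s.int 4 i ∧ s.int 4 i < n
    then some (⟨(s.int 4 i).toNat, by omega⟩, s.real 4 i) else none
  epochs i := (s.int 6 i).toNat
  start i k := s.real 5 (s.int 5 i + k)
  mono i k := ⟨s.real 6 (s.int 5 i + k), s.int 7 (s.int 5 i + k)⟩

/-- `T` is the periodic merge tree of `f`, decomposed into one beam per vertex of `K / Λ` according
to the elder rule: there is a homeomorphism that maps height `s` on beam `i` to
the component of `(K / Λ)_s` that contains vertex `i`, and the monomials of the epochs are the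
values of the frequency function. (The end of a beam belongs to the beam to which it is attached.) -/
def Represents {d n m : ℕ} {K : CellComplex d} {b : Module.Basis (Fin d) ℝ (E d)}
    (T : BeamTree n) (f : Set (E d) → ℝ) (G : QuotientGraph K b n m) : Prop :=
  (∀ i, T.birth i = f {G.vertex i}) ∧
  (∀ i j h, T.ending i = some (j, h) → T.birth j ≤ T.birth i) ∧
  (∀ i, 0 < T.epochs i ∧ T.start i 0 = T.birth i ∧
    ∀ k l, k ≤ l → l < T.epochs i → T.start i k ≤ T.start i l) ∧
  ∃ Φ : T.Space ≃ₜ PeriodicMergeTree (latticeOf b) K f,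
    ∀ p : T.Points,
      (Φ (Quot.mk _ p)).height = p.2 ∧
      proj (latticeOf b) (G.vertex p.1) ∈ (Φ (Quot.mk _ p)).component ∧
      ((∀ j h, T.ending p.1 = some (j, h) → (p.2 : ℝ) < h) →
        T.HasMonomial p.1 p.2 (frequency (latticeOf b) K f (Φ (Quot.mk _ p))))

end PMT

end

noncomputable section

namespace PMT

open Set MeasureTheory

/-! ### Stores -/

/-! Two cells that meet share a vertex, and the boundary of a cell of dimension at least 2 is a
connected sphere. Hence the components of a sublevel set are those of its 1-skeleton: those of the
periodic graph on pairs (vertex of the quotient, integer vector) whose edges are all translates of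
the given edges. Components in the torus are components of the quotient graph; their shadows are the
translates of one component of the periodic graph, and their periodicity lattice consists of the
shifts of closed walks (`connectedComponentIn_node`, `connectedComponentIn_quotient`,
`periodicityLattice_tcomp`).

The tree can therefore be built as in Kruskal's algorithm. A tournament tree delivers the edges by
increasing value, and union-find by rank maintains the components. Each vertex carries a potential,
its shift relative to the root. An edge inside a component adds one vector to the lattice of the
component (`ShiftGraph.Sem.cycle`). An edge between two components adds their lattices
(`ShiftGraph.Sem.merge`), and the younger of the two beams ends. After each edge the volume of the
current lattice is computed as a product of Gram-Schmidt norms (`latticeVolume_tri`), and an epoch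
is appended to the surviving beam.

A lattice is stored as a triangular integer matrix. A vector is inserted column by column with
Euclid's algorithm (`insertVec_spec`). Arithmetic has unit cost, so only the number of Euclidean
steps matters, and it is logarithmic in the pivots. The pivots are controlled by determinants.
Potentials within a component differ by at most D times the number of its merging edges, so all
cycle vectors have entries at most D m. A pivot of a lattice with small generators divides a nonzero
determinant with small entries (`pivot_le`). When one lattice is added to another, rows are inserted
from the last to the first, and the span of the last rows again has moderately small generators
(`boundedGen_tailSpan`). The logarithm of all pivots is thus O(d^2 log(√d D m))
(`log_pivotBound_le`). With O(d^3) operations per Euclidean step count, an edge costs O(d^5 log(√d D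
m)), and d^5 ≤ 2^d d^(d+3).

The program logic yields `TreeSpec`: at every height the beams that have not ended represent each
component exactly once, with the right monomial. The glued beams then map continuously and
bijectively to the merge tree. The map is closed because a closed set of heights on a beam sweeps
out a closed set in the torus times the line (`isClosed_sweep`), so it is a homeomorphism
(`QuotientGraph.represents`). -/

@[simp] theorem Store.setInt_int_same (s : Store) (a : ℕ) (i x j : ℤ) :
    (s.setInt a i x).int a j = if j = i then x else s.int a j := by
  simp [Store.setInt, Function.update_apply]

@[simp] theorem Store.setInt_int_ne (s : Store) {a a' : ℕ} (h : a' ≠ a) (i x : ℤ) :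
    (s.setInt a i x).int a' = s.int a' := by
  simp [Store.setInt, Function.update_of_ne h]

@[simp] theorem Store.setInt_real (s : Store) (a : ℕ) (i x : ℤ) :
    (s.setInt a i x).real = s.real := rfl

@[simp] theorem Store.setReal_real_same (s : Store) (a : ℕ) (i : ℤ) (x : ℝ) (j : ℤ) :
    (s.setReal a i x).real a j = if j = i then x else s.real a j := by
  simp [Store.setReal, Function.update_apply]

@[simp] theorem Store.setReal_real_ne (s : Store) {a a' : ℕ} (h : a' ≠ a) (i : ℤ) (x : ℝ) :
    (s.setReal a i x).real a' = s.real a' := by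
  simp [Store.setReal, Function.update_of_ne h]

@[simp] theorem Store.setReal_int (s : Store) (a : ℕ) (i : ℤ) (x : ℝ) :
    (s.setReal a i x).int = s.int := rfl

/-! ### Abbreviations for expressions and programs -/

/-- An integer variable: entry `0` of an array. -/
abbrev ivar (r : ℕ) : IExp := .get r (.lit 0)

/-- A real variable: entry `0` of an array. -/
abbrev rvar (r : ℕ) : RExp := .get r (.lit 0)

/-- Assignment to an integer variable. -/
abbrev Program.iset (r : ℕ) (x : IExp) : Program := .setInt r (.lit 0) x

/-- Assignment to a real variable. -/
abbrev Program.rset (r : ℕ) (x : RExp) : Program := .setReal r (.lit 0) x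

/-- Equality test for integers. -/
abbrev BExp.ieq (x y : IExp) : BExp := .and (.ile x y) (.ile y x)

/-- Strict comparison of integers. -/
abbrev BExp.ilt (x y : IExp) : BExp := .not (.ile y x)

instance : Add IExp := ⟨.add⟩
instance : Sub IExp := ⟨.sub⟩
instance : Mul IExp := ⟨.mul⟩
instance : Div IExp := ⟨.div⟩
instance : Add RExp := ⟨.add⟩
instance : Sub RExp := ⟨.sub⟩
instance : Mul RExp := ⟨.mul⟩
instance : Div RExp := ⟨.div⟩

section simps
variable (s : Store) (x y : IExp) (u v : RExp) (t t' : BExp)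

@[simp] theorem IExp.eval_lit (z : ℤ) : (IExp.lit z).eval s = z := rfl
@[simp] theorem IExp.eval_get (a : ℕ) : (IExp.get a x).eval s = s.int a (x.eval s) := rfl
@[simp] theorem IExp.eval_hadd : (x + y).eval s = x.eval s + y.eval s := rfl
@[simp] theorem IExp.eval_hsub : (x - y).eval s = x.eval s - y.eval s := rfl
@[simp] theorem IExp.eval_hmul : (x * y).eval s = x.eval s * y.eval s := rfl
@[simp] theorem IExp.eval_hdiv : (x / y).eval s = x.eval s / y.eval s := rfl
@[simp] theorem RExp.eval_ofInt : (RExp.ofInt x).eval s = (x.eval s : ℝ) := rfl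
@[simp] theorem RExp.eval_pi : (RExp.pi).eval s = Real.pi := rfl
@[simp] theorem RExp.eval_get (a : ℕ) : (RExp.get a x).eval s = s.real a (x.eval s) := rfl
@[simp] theorem RExp.eval_sqrt : (RExp.sqrt u).eval s = Real.sqrt (u.eval s) := rfl
@[simp] theorem RExp.eval_hadd : (u + v).eval s = u.eval s + v.eval s := rfl
@[simp] theorem RExp.eval_hsub : (u - v).eval s = u.eval s - v.eval s := rfl
@[simp] theorem RExp.eval_hmul : (u * v).eval s = u.eval s * v.eval s := rfl
@[simp] theorem RExp.eval_hdiv : (u / v).eval s = u.eval s / v.eval s := rfl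
@[simp] theorem BExp.eval_ile : (BExp.ile x y).eval s ↔ x.eval s ≤ y.eval s := Iff.rfl
@[simp] theorem BExp.eval_rle : (BExp.rle u v).eval s ↔ u.eval s ≤ v.eval s := Iff.rfl
@[simp] theorem BExp.eval_not : (BExp.not t).eval s ↔ ¬ t.eval s := Iff.rfl
@[simp] theorem BExp.eval_and : (BExp.and t t').eval s ↔ t.eval s ∧ t'.eval s := Iff.rfl

@[simp] theorem IExp.cost_lit (z : ℤ) : (IExp.lit z).cost = 1 := rfl
@[simp] theorem IExp.cost_get (a : ℕ) : (IExp.get a x).cost = x.cost + 1 := rfl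
@[simp] theorem IExp.cost_hadd : (x + y).cost = x.cost + y.cost + 1 := rfl
@[simp] theorem IExp.cost_hsub : (x - y).cost = x.cost + y.cost + 1 := rfl
@[simp] theorem IExp.cost_hmul : (x * y).cost = x.cost + y.cost + 1 := rfl
@[simp] theorem IExp.cost_hdiv : (x / y).cost = x.cost + y.cost + 1 := rfl
@[simp] theorem RExp.cost_ofInt : (RExp.ofInt x).cost = x.cost + 1 := rfl
@[simp] theorem RExp.cost_pi : (RExp.pi).cost = 1 := rfl
@[simp] theorem RExp.cost_get (a : ℕ) : (RExp.get a x).cost = x.cost + 1 := rfl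
@[simp] theorem RExp.cost_sqrt : (RExp.sqrt u).cost = u.cost + 1 := rfl
@[simp] theorem RExp.cost_hadd : (u + v).cost = u.cost + v.cost + 1 := rfl
@[simp] theorem RExp.cost_hsub : (u - v).cost = u.cost + v.cost + 1 := rfl
@[simp] theorem RExp.cost_hmul : (u * v).cost = u.cost + v.cost + 1 := rfl
@[simp] theorem RExp.cost_hdiv : (u / v).cost = u.cost + v.cost + 1 := rfl
@[simp] theorem BExp.cost_ile : (BExp.ile x y).cost = x.cost + y.cost + 1 := rfl
@[simp] theorem BExp.cost_rle : (BExp.rle u v).cost = u.cost + v.cost + 1 := rfl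
@[simp] theorem BExp.cost_not : (BExp.not t).cost = t.cost + 1 := rfl
@[simp] theorem BExp.cost_and : (BExp.and t t').cost = t.cost + t'.cost + 1 := rfl
end simps

infixr:50 " ;; " => Program.seq

/-! ### Frames: the arrays that a program leaves alone. -/

/-- The integer arrays that a program may change. -/
def Program.wI : Program → ℕ → Bool
  | skip, _ => false
  | setInt b _ _, a => a == b
  | setReal _ _ _, _ => false
  | seq p q, a => p.wI a || q.wI a
  | branch _ p q, a => p.wI a || q.wI a
  | loop _ p, a => p.wI a

/-- The real arrays that a program may change. -/
def Program.wR : Program → ℕ → Bool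
  | skip, _ => false
  | setInt _ _ _, _ => false
  | setReal b _ _, a => a == b
  | seq p q, a => p.wR a || q.wR a
  | branch _ p q, a => p.wR a || q.wR a
  | loop _ p, a => p.wR a

/-- The two stores agree on all arrays that `p` cannot change. -/
structure Frame (p : Program) (s s' : Store) : Prop where
  int : ∀ a, p.wI a = false → s'.int a = s.int a
  real : ∀ a, p.wR a = false → s'.real a = s.real a

theorem Frame.refl (p : Program) (s : Store) : Frame p s s := ⟨fun _ _ => rfl, fun _ _ => rfl⟩

theorem Frame.trans {p : Program} {s s' s'' : Store} (h : Frame p s s') (h' : Frame p s' s'') :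
    Frame p s s'' :=
  ⟨fun a ha => (h'.int a ha).trans (h.int a ha), fun a ha => (h'.real a ha).trans (h.real a ha)⟩

theorem Frame.mono {p q : Program} {s s' : Store} (h : Frame p s s')
    (hI : ∀ a, q.wI a = false → p.wI a = false) (hR : ∀ a, q.wR a = false → p.wR a = false) :
    Frame q s s' :=
  ⟨fun a ha => h.int a (hI a ha), fun a ha => h.real a (hR a ha)⟩

/-- A syntactic frame rule: specifications need to mention only what changes. The side condition
that an array is not written evaluates by computation, so later uses discharge it with `rfl`. -/
theorem Runs.frame {p : Program} {s s' : Store} {t : ℕ} (h : Runs p s s' t) : Frame p s s' := by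
  induction h with
  | skip s => exact Frame.refl _ _
  | setInt a i x s =>
    refine ⟨fun b hb => ?_, fun b hb => rfl⟩
    simp only [Program.wI, beq_eq_false_iff_ne] at hb
    simp [hb]
  | setReal a i x s =>
    refine ⟨fun b hb => rfl, fun b hb => ?_⟩
    simp only [Program.wR, beq_eq_false_iff_ne] at hb
    simp [hb]
  | seq _ _ ih1 ih2 =>
    refine Frame.trans (ih1.mono ?_ ?_) (ih2.mono ?_ ?_) <;> simp +contextual [Program.wI, Program.wR]
  | branch_true _ _ ih => refine ih.mono ?_ ?_ <;> simp +contextual [Program.wI, Program.wR]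
  | branch_false _ _ ih => refine ih.mono ?_ ?_ <;> simp +contextual [Program.wI, Program.wR]
  | loop_stop _ => exact Frame.refl _ _
  | loop_step _ _ _ ih1 ih2 =>
    refine Frame.trans (ih1.mono ?_ ?_) (ih2.mono ?_ ?_) <;> simp +contextual [Program.wI, Program.wR]

/-! ### Total correctness with time bounds -/

/-- Started with `s`, the program halts within `T` units of time in a store that satisfies `Q`. -/
def WP (p : Program) (T : ℕ) (Q : Store → Prop) (s : Store) : Prop :=
  ∃ s' t, Runs p s s' t ∧ t ≤ T ∧ Q s'

/-- The consequence rule also hands the frame to the new postcondition, so facts about untouched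
arrays survive without being part of any specification. -/
theorem WP.mono {p : Program} {T T' : ℕ} {Q Q' : Store → Prop} {s : Store} (h : WP p T Q s)
    (hT : T ≤ T') (hQ : ∀ s', Frame p s s' → Q s' → Q' s') : WP p T' Q' s := by
  obtain ⟨s', t, hr, ht, hq⟩ := h
  exact ⟨s', t, hr, ht.trans hT, hQ s' hr.frame hq⟩

theorem WP.time {p : Program} {T T' : ℕ} {Q : Store → Prop} {s : Store} (h : WP p T Q s)
    (hT : T ≤ T') : WP p T' Q s := h.mono hT fun _ _ h => h

theorem WP.skip {Q : Store → Prop} {s : Store} (h : Q s) : WP .skip 1 Q s :=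
  ⟨s, 1, .skip s, le_rfl, h⟩

theorem WP.setInt {a : ℕ} {i x : IExp} {Q : Store → Prop} {s : Store}
    (h : Q (s.setInt a (i.eval s) (x.eval s))) :
    WP (.setInt a i x) (i.cost + x.cost + 1) Q s :=
  ⟨_, _, .setInt a i x s, le_rfl, h⟩

theorem WP.setReal {a : ℕ} {i : IExp} {x : RExp} {Q : Store → Prop} {s : Store}
    (h : Q (s.setReal a (i.eval s) (x.eval s))) :
    WP (.setReal a i x) (i.cost + x.cost + 1) Q s :=
  ⟨_, _, .setReal a i x s, le_rfl, h⟩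

theorem WP.seq {p q : Program} {T T' : ℕ} {Q : Store → Prop} {s : Store}
    (h : WP p T (fun s' => WP q T' Q s') s) : WP (p ;; q) (T + T') Q s := by
  obtain ⟨s', t, hr, ht, s'', t', hr', ht', hq⟩ := h
  exact ⟨s'', t + t', .seq hr hr', by omega, hq⟩

/-- Sequential composition where the first program has a known specification. -/
theorem WP.seq' {p q : Program} {T T' : ℕ} {P Q : Store → Prop} {s : Store}
    (h : WP p T P s) (h' : ∀ s', Frame p s s' → P s' → WP q T' Q s') : WP (p ;; q) (T + T') Q s :=
  .seq (h.mono le_rfl h')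

/-- The sum of the two bounds replaces their maximum. This costs a constant factor and keeps the
time arithmetic linear. -/
theorem WP.branch {c : BExp} {p q : Program} {T T' : ℕ} {Q : Store → Prop} {s : Store}
    (h : c.eval s → WP p T Q s) (h' : ¬ c.eval s → WP q T' Q s) :
    WP (.branch c p q) (c.cost + (T + T') + 1) Q s := by
  by_cases hc : c.eval s
  · obtain ⟨s', t, hr, ht, hq⟩ := h hc
    exact ⟨s', _, .branch_true hc hr, by omega, hq⟩
  · obtain ⟨s', t, hr, ht, hq⟩ := h' hc
    exact ⟨s', _, .branch_false hc hr, by omega, hq⟩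

/-- The index of the invariant is a variant: it drops with every round, which gives both termination
and the number of rounds. -/
theorem WP.loop {c : BExp} {p : Program} {Q : Store → Prop} {s : Store}
    (Inv : ℕ → Store → Prop) (v T : ℕ) (h0 : Inv v s)
    (hstep : ∀ v s', Frame p s s' → Inv v s' → c.eval s' → ∃ v' < v, WP p T (Inv v') s')
    (hQ : ∀ v s', Frame p s s' → Inv v s' → ¬ c.eval s' → Q s') :
    WP (.loop c p) (v * (c.cost + T + 1) + (c.cost + 1)) Q s := by
  suffices H : ∀ v s', Frame p s s' → Inv v s' →
      WP (.loop c p) (v * (c.cost + T + 1) + (c.cost + 1)) Q s' from H v s (Frame.refl _ _) h0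
  intro v
  induction v using Nat.strong_induction_on with
  | _ v ih =>
    intro s' hf hi
    by_cases hc : c.eval s'
    · obtain ⟨v', hv', s'', t, hr, ht, hi'⟩ := hstep v s' hf hi hc
      obtain ⟨s3, t3, hr3, ht3, hq⟩ := ih v' hv' s'' (hf.trans hr.frame) hi'
      refine ⟨s3, _, .loop_step hc hr hr3, ?_, hq⟩
      have : (v' + 1) * (c.cost + T + 1) ≤ v * (c.cost + T + 1) := Nat.mul_le_mul_right _ hv'
      rw [add_mul] at this
      omega
    · exact ⟨s', _, Runs.loop_stop hc, by omega, hQ v s' hf hi hc⟩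

/-- Repeat a program with the integer variable `r` running from `0` up to (excluding) `N`. -/
def Program.forN (r : ℕ) (N : IExp) (p : Program) : Program :=
  .iset r (.lit 0) ;; .loop (.ilt (ivar r) N) (p ;; .iset r (ivar r + .lit 1))

/-- The body must not write the counter, and the bound must keep its value throughout the loop. The
invariant for `i + 1` is demanded after the counter has been increased, so that it may be checked on
the store with which the next round starts. -/
theorem WP.forN {r : ℕ} {N : IExp} {p : Program} {Q : Store → Prop} {s : Store}
    (Inv : ℕ → Store → Prop) (k T : ℕ)
    (h0 : Inv 0 (s.setInt r 0 0))
    (hr : p.wI r = false)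
    (hN : ∀ s', Frame (.forN r N p) s s' → N.eval s' = k)
    (hstep : ∀ i < k, ∀ s', Frame (.forN r N p) s s' → s'.int r 0 = i → Inv i s' →
      WP p T (fun s'' => Inv (i + 1) (s''.setInt r 0 (i + 1))) s')
    (hQ : ∀ s', Frame (.forN r N p) s s' → Inv k s' → Q s') :
    WP (.forN r N p) (k * (T + N.cost + 12) + (N.cost + 12)) Q s := by
  have hfr : ∀ s', Frame (p ;; .iset r (ivar r + .lit 1)) (s.setInt r 0 0) s' →
      Frame (.forN r N p) s s' := by
    intro s' h
    refine Frame.trans (s' := s.setInt r 0 0) ?_ (h.mono ?_ ?_)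
    · refine ⟨fun a ha => ?_, fun _ _ => rfl⟩
      simp only [Program.forN, Program.wI, Bool.or_eq_false_iff, beq_eq_false_iff_ne] at ha
      simp [ha.1]
    · simp +contextual [Program.forN, Program.wI]
    · simp +contextual [Program.forN, Program.wR]
  -- The variant is the number `k - i` of remaining rounds; the 6 extra units per round pay for
  -- increasing the counter.
  have := WP.seq (p := .iset r (.lit 0)) (Q := Q) (s := s) (.setInt (i := .lit 0) (x := .lit 0)
    (WP.loop (c := .ilt (ivar r) N) (p := p ;; .iset r (ivar r + .lit 1))
      (fun v s' => s'.int r 0 = (k - v : ℤ) ∧ v ≤ k ∧ Inv (k - v) s') k (T + 6) ?_ ?_ ?_))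
  · refine WP.time this ?_
    simp only [IExp.cost_lit, BExp.cost_not, BExp.cost_ile, IExp.cost_get]
    have : k * (N.cost + (1 + 1) + 1 + 1 + (T + 6) + 1) ≤ k * (T + N.cost + 12) :=
      Nat.mul_le_mul_left _ (by omega)
    omega
  · simpa using h0
  · intro v s' hf ⟨h1, h2, h3⟩ hc
    have hf' := hfr s' hf
    simp only [BExp.eval_not, BExp.eval_ile, IExp.eval_get, IExp.eval_lit, hN s' hf', h1] at hc
    have hv : 0 < v := by omega
    refine ⟨v - 1, by omega, ?_⟩
    have hi : s'.int r 0 = ((k - v : ℕ) : ℤ) := by rw [h1]; omega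
    have := hstep (k - v) (by omega) s' hf' hi h3
    refine WP.time (WP.seq' this fun s'' hf2 h => WP.setInt ?_) (by simp)
    have hr' : s''.int r 0 = (k - v : ℕ) := by rw [hf2.int r hr, hi]
    simp only [IExp.eval_lit, IExp.eval_hadd, IExp.eval_get, hr']
    refine ⟨by simp; omega, by omega, ?_⟩
    have : k - (v - 1) = k - v + 1 := by omega
    rw [this]
    exact_mod_cast h
  · intro v s' hf ⟨h1, h2, h3⟩ hc
    have hf' := hfr s' hf
    simp only [BExp.eval_not, BExp.eval_ile, IExp.eval_get, IExp.eval_lit, hN s' hf', h1] at hc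
    have hv : v = 0 := by omega
    subst hv
    exact hQ s' hf' h3


/-! ### Integer lattices in triangular form -/

/-- The position of entry `(k, c)` of the `R`-th matrix in an array of `d × d` matrices. -/
def matIdx (d : ℕ) (R : ℕ) (k c : Fin d) : ℤ := ((R : ℤ) * d + ((k : ℕ) : ℤ)) * d + ((c : ℕ) : ℤ)

/-- The position of entry `k` of the `i`-th vector in an array of vectors of length `d`. -/
def vecIdx (d : ℕ) (i : ℕ) (k : Fin d) : ℤ := (i : ℤ) * d + ((k : ℕ) : ℤ)

/-- Uniqueness of quotient and remainder: row-major positions do not collide. It serves vectors,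
matrices, and the blocks of epochs. -/
theorem nat_mul_add_inj {d a b i j : ℕ} (hi : i < d) (hj : j < d) (h : a * d + i = b * d + j) :
    a = b ∧ i = j := by
  have h1 : (a * d + i) / d = a := by
    rw [mul_comm, Nat.mul_add_div (by omega), Nat.div_eq_of_lt hi, add_zero]
  have h2 : (b * d + j) / d = b := by
    rw [mul_comm, Nat.mul_add_div (by omega), Nat.div_eq_of_lt hj, add_zero]
  have : a = b := by rw [← h1, h, h2]
  subst this
  exact ⟨rfl, by omega⟩

theorem vecIdx_inj {d i j : ℕ} {k l : Fin d} : vecIdx d i k = vecIdx d j l ↔ i = j ∧ k = l := by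
  refine ⟨fun h => ?_, fun h => by rw [h.1, h.2]⟩
  unfold vecIdx at h
  have := nat_mul_add_inj k.2 l.2 (a := i) (b := j) (by exact_mod_cast h)
  exact ⟨this.1, Fin.ext this.2⟩

theorem matIdx_inj {d R S : ℕ} {k l c e : Fin d} :
    matIdx d R k c = matIdx d S l e ↔ R = S ∧ k = l ∧ c = e := by
  refine ⟨fun h => ?_, fun h => by rw [h.1, h.2.1, h.2.2]⟩
  unfold matIdx at h
  have h1 := nat_mul_add_inj c.2 e.2 (a := R * d + k) (b := S * d + l) (by exact_mod_cast h)
  have h2 := nat_mul_add_inj k.2 l.2 h1.1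
  exact ⟨h2.1, Fin.ext h2.2, Fin.ext h1.2⟩

/-- Row `k` has no entries before the diagonal, and it is zero if its diagonal entry is zero. -/
def IsTri {d : ℕ} (M : Fin d → Fin d → ℤ) : Prop :=
  ∀ k, (∀ c < k, M k c = 0) ∧ (M k k = 0 → M k = 0)

/-- The lattice spanned by the rows of a matrix. -/
def rowSpan {d : ℕ} (M : Fin d → Fin d → ℤ) : Submodule ℤ (Fin d → ℤ) :=
  Submodule.span ℤ (Set.range M)

/-- The `R`-th matrix in integer array `13`. -/
def Store.mat (s : Store) (d R : ℕ) : Fin d → Fin d → ℤ := fun k c => s.int 13 (matIdx d R k c)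

/-- The vector in an integer array. -/
def Store.vec (s : Store) (a d : ℕ) : Fin d → ℤ := fun c => s.int a ((c : ℕ) : ℤ)

/-- While column `k` is cleared, only row `k` and the inserted vector change. Splitting off the
other rows reduces invariance of the lattice to invariance of the span of a pair. -/
theorem rowSpan_update_sup {d : ℕ} (M : Fin d → Fin d → ℤ) (k : Fin d) (r w : Fin d → ℤ) :
    rowSpan (Function.update M k r) ⊔ Submodule.span ℤ {w} =
      Submodule.span ℤ (M '' {k}ᶜ) ⊔ Submodule.span ℤ {r, w} := by
  have : Set.range (Function.update M k r) = insert r (M '' {k}ᶜ) := by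
    ext x
    constructor
    · rintro ⟨j, rfl⟩
      by_cases hj : j = k
      · subst hj; simp
      · right; exact ⟨j, hj, by simp [hj]⟩
    · rintro (rfl | ⟨j, hj, rfl⟩)
      · exact ⟨k, by simp⟩
      · exact ⟨j, by simp [Function.update_of_ne hj]⟩
  rw [rowSpan, this, Submodule.span_insert, Submodule.span_insert, sup_comm (Submodule.span ℤ {r}),
    sup_assoc]

theorem span_pair_sub_smul {d : ℕ} (r w : Fin d → ℤ) (q : ℤ) :
    Submodule.span ℤ {r, w - q • r} = Submodule.span ℤ {r, w} := by
  apply le_antisymm <;> rw [Submodule.span_le, Set.insert_subset_iff, Set.singleton_subset_iff]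
  · refine ⟨Submodule.subset_span (by simp), Submodule.sub_mem _ (Submodule.subset_span (by simp))
      (Submodule.smul_mem _ _ (Submodule.subset_span (by simp)))⟩
  · refine ⟨Submodule.subset_span (by simp), ?_⟩
    have h1 : r ∈ Submodule.span ℤ {r, w - q • r} := Submodule.subset_span (by simp)
    have h2 : w - q • r ∈ Submodule.span ℤ {r, w - q • r} := Submodule.subset_span (by simp)
    simpa using Submodule.add_mem _ h2 (Submodule.smul_mem _ q h1)

/-- The product of two consecutive remainders at least halves: with `W' = R % W` the quotient `W /
W'` is at least 1, so `W ≥ W' + W % W' > 2 (W % W')`. The alternative `R = 0` covers an empty row,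
where `W` may be negative and a single exchange finishes. -/
theorem euclid_step {R W : ℤ} {v : ℕ} (hW : W ≠ 0) (h0 : 0 ≤ W ∨ R = 0)
    (h : |W| * (R % W) < 2 ^ v) :
    0 ≤ R % W ∧ (R % W = 0 ∨ (1 ≤ v ∧ |R % W| * (W % (R % W)) < 2 ^ (v - 1))) := by
  have h1 := Int.emod_nonneg R hW
  refine ⟨h1, ?_⟩
  by_cases h2 : R % W = 0
  · exact .inl h2
  right
  have hR : R ≠ 0 := by rintro rfl; simp at h2
  have hWp : 0 < W := by
    rcases h0 with h0 | h0
    · omega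
    · exact absurd h0 hR
  have h3 := Int.emod_lt_of_pos R hWp
  set W' := R % W
  have hW' : 0 < W' := by omega
  have h4 := Int.emod_lt_of_pos W hW'
  have h5 := Int.emod_nonneg W h2
  have h6 : 1 ≤ W / W' := by
    rw [Int.le_ediv_iff_mul_le hW']; omega
  have h7 := Int.mul_ediv_add_emod W W'
  have h8 : 2 * (W % W') < W := by nlinarith
  rw [abs_of_pos hWp] at h
  rw [abs_of_pos hW']
  have hv : 1 ≤ v := by
    by_contra hv
    have : v = 0 := by omega
    subst this
    nlinarith
  refine ⟨hv, ?_⟩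
  obtain ⟨v, rfl⟩ : ∃ u, v = u + 1 := ⟨v - 1, by omega⟩
  rw [pow_succ] at h
  simp only [Nat.add_sub_cancel]
  nlinarith

/-! ### Inserting a vector into a lattice -/

namespace Prog

/-- The expression for `d`. -/
abbrev D : IExp := ivar 0

/-- The position of the entry in row `V 28` and column `V 29` of the matrix `V 23`. -/
abbrev ixM : IExp := (ivar 23 * D + ivar 28) * D + ivar 29

/-- The diagonal entry in row `V 28` of the matrix `V 23`. -/
abbrev diagM : IExp := .get 13 ((ivar 23 * D + ivar 28) * D + ivar 28)

/-- Reduce the vector in array `27` by row `V 28`. -/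
def reduceRow : Program :=
  .iset 31 (.get 27 (ivar 28) / diagM) ;;
  .forN 29 D (.setInt 27 (ivar 29) (.get 27 (ivar 29) - ivar 31 * .get 13 ixM))

/-- One step of the Euclidean algorithm for row `V 28` and the vector in array `27`. -/
def euclidRow : Program :=
  .iset 31 (diagM / .get 27 (ivar 28)) ;;
  .forN 29 D (.iset 32 (.get 13 ixM - ivar 31 * .get 27 (ivar 29)) ;;
    .setInt 13 ixM (.get 27 (ivar 29)) ;; .setInt 27 (ivar 29) (ivar 32))

/-- Insert the vector in array `27` into the lattice `V 23`. -/
def insertVec : Program :=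
  .forN 28 D (reduceRow ;; .loop (.not (.ieq (.get 27 (ivar 28)) (.lit 0))) euclidRow)

end Prog
open Prog

theorem reduceRow_spec {d R : ℕ} {k : Fin d} {s : Store} (hd : s.int 0 0 = d) (hR : s.int 23 0 = R)
    (hk : s.int 28 0 = (k : ℕ)) :
    WP reduceRow (70 * d + 40) (fun s' => s'.vec 27 d =
      s.vec 27 d - (s.vec 27 d k / s.mat d R k k) • s.mat d R k) s := by
  apply WP.time
  · apply WP.seq
    apply WP.setInt
    set q := s.vec 27 d k / s.mat d R k k with hq
    have hq' : (IExp.get 27 (ivar 28) / diagM).eval s = q := by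
      simp [hd, hR, hk, hq, Store.vec, Store.mat, matIdx]
    rw [hq']
    refine WP.forN (fun i s' => ∀ c : Fin d, s'.int 27 (c : ℕ) =
      if (c : ℕ) < i then s.vec 27 d c - q * s.mat d R k c else s.vec 27 d c) d 40 ?_ rfl ?_ ?_ ?_
    rotate_right 1
    · intro s' hf h
      funext c
      simpa [Store.vec] using h c
    · simp [Store.vec]
    · intro s' hf
      have := hf.int 0 rfl
      simp [this, hd]
    · intro i hi s' hf hi' h
      have h0 := hf.int 0 rfl
      have h23 := hf.int 23 rfl
      have h28 := hf.int 28 rfl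
      have h13 := hf.int 13 rfl
      have h31 := hf.int 31 rfl
      refine WP.time (.setInt ?_) (by simp)
      intro c
      have hx := h c
      have hix : (s.int 13 ((R * d + (k : ℕ)) * d + (i : ℕ))) = s.mat d R k ⟨i, hi⟩ := rfl
      have hy := h ⟨i, hi⟩
      simp only [lt_irrefl, if_false] at hy
      simp only [ne_eq, Nat.reduceEqDiff, not_false_eq_true,
        Store.setInt_int_ne, Store.setInt_int_same, IExp.eval_hsub, IExp.eval_get, IExp.eval_lit,
        IExp.eval_hmul, IExp.eval_hadd, hi', h0, h23, h28, h13, h31, hd, hR, hk, Nat.cast_inj, hy, hix,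
        if_true, OfNat.zero_ne_ofNat]
      by_cases hc : (c : ℕ) = i
      · subst hc; simp
      · rw [if_neg hc, hx]
        have : (c : ℕ) < i + 1 ↔ (c : ℕ) < i := by omega
        simp [this]
  · simp; omega

theorem euclidRow_spec {d R : ℕ} {k : Fin d} {s : Store} (hd : s.int 0 0 = d) (hR : s.int 23 0 = R)
    (hk : s.int 28 0 = (k : ℕ)) :
    WP euclidRow (80 * d + 40) (fun s' => s'.vec 27 d =
        s.mat d R k - (s.mat d R k k / s.vec 27 d k) • s.vec 27 d ∧
      s'.mat d R = Function.update (s.mat d R) k (s.vec 27 d) ∧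
      ∀ S ≠ R, s'.mat d S = s.mat d S) s := by
  apply WP.time
  · apply WP.seq
    apply WP.setInt
    set q := s.mat d R k k / s.vec 27 d k with hq
    have hq' : (diagM / IExp.get 27 (ivar 28)).eval s = q := by
      simp [hd, hR, hk, hq, Store.vec, Store.mat, matIdx]
    rw [hq']
    refine WP.forN (fun i s' => (∀ c : Fin d, s'.int 27 (c : ℕ) =
      if (c : ℕ) < i then s.mat d R k c - q * s.vec 27 d c else s.vec 27 d c) ∧
      ∀ (S : ℕ) (l c : Fin d), s'.int 13 (matIdx d S l c) =
        if S = R ∧ l = k ∧ (c : ℕ) < i then s.vec 27 d c else s.mat d S l c) d 60 ?_ rfl ?_ ?_ ?_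
    rotate_right 1
    · intro s' hf ⟨h, h'⟩
      refine ⟨?_, ?_, ?_⟩
      · funext c
        simpa [Store.vec] using h c
      · funext l c
        have := h' R l c
        by_cases hl : l = k
        · subst hl
          simpa [Store.mat] using this
        · simpa [hl, Store.mat] using this
      · intro S hS
        funext l c
        simpa [hS, Store.mat] using h' S l c
    · simp [Store.vec, Store.mat]
    · intro s' hf
      have := hf.int 0 rfl
      simp [this, hd]
    · intro i hi s' hf hi' ⟨h, h'⟩
      have h0 := hf.int 0 rfl
      have h23 := hf.int 23 rfl
      have h28 := hf.int 28 rfl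
      have h31 := hf.int 31 rfl
      refine WP.time (.seq (.setInt (.seq (.setInt (.setInt ?_))))) (by simp)
      have hx : s'.int 27 (i : ℤ) = s.vec 27 d ⟨i, hi⟩ := by simpa using h ⟨i, hi⟩
      have hy : s'.int 13 ((R * d + (k : ℕ)) * d + (i : ℕ)) = s.mat d R k ⟨i, hi⟩ := by
        have := h' R k ⟨i, hi⟩
        simp only [lt_irrefl, and_false, if_false] at this
        exact this
      have hm : ((R : ℤ) * d + (k : ℕ)) * d + (i : ℕ) = matIdx d R k ⟨i, hi⟩ := rfl
      simp only [ne_eq, Nat.reduceEqDiff, not_false_eq_true,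
        Store.setInt_int_ne, Store.setInt_int_same, IExp.eval_hsub, IExp.eval_get, IExp.eval_lit,
        IExp.eval_hmul, IExp.eval_hadd, hi', h0, h23, h28, h31, hd, hR, hk, Nat.cast_inj, hx, hy,
        if_true, OfNat.zero_ne_ofNat]
      constructor
      · intro c
        by_cases hc : (c : ℕ) = i
        · subst hc; simp
        · rw [if_neg hc, h c]
          have : (c : ℕ) < i + 1 ↔ (c : ℕ) < i := by omega
          simp [this]
      · intro S l c
        simp only [hm, matIdx_inj, h' S l c]
        by_cases hc : S = R ∧ l = k ∧ c = ⟨i, hi⟩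
        · obtain ⟨rfl, rfl, rfl⟩ := hc
          simp
        · rw [if_neg hc]
          congr 1
          by_cases hc' : S = R ∧ l = k
          · have : (c : ℕ) ≠ i := fun h => hc ⟨hc'.1, hc'.2, Fin.ext h⟩
            simp only [hc'.1, hc'.2, true_and, eq_iff_iff]
            omega
          · simp only [eq_iff_iff]; tauto
  · simp; omega

/-- The initial reduction makes the entry of the vector smaller than the pivot, so the number of
Euclidean steps depends on the pivot alone and not on the size of the inserted vector. Every step is
unimodular on the pair (row, vector). -/
theorem insertRow_spec {d R ℓ : ℕ} {k : Fin d} {s : Store} (hd : s.int 0 0 = d)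
    (hR : s.int 23 0 = R) (hk : s.int 28 0 = (k : ℕ)) (htri : IsTri (s.mat d R))
    (hl : |s.mat d R k k| < 2 ^ ℓ) (hw : ∀ c < k, s.vec 27 d c = 0) :
    WP (reduceRow ;; .loop (.not (.ieq (.get 27 (ivar 28)) (.lit 0))) euclidRow)
      (350 * d * (ℓ + 1)) (fun s' => IsTri (s'.mat d R) ∧
        rowSpan (s'.mat d R) ⊔ Submodule.span ℤ {s'.vec 27 d} =
          rowSpan (s.mat d R) ⊔ Submodule.span ℤ {s.vec 27 d} ∧
        (∀ c ≤ k, s'.vec 27 d c = 0) ∧ (∀ j ≠ k, s'.mat d R j = s.mat d R j) ∧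
        ∀ S ≠ R, s'.mat d S = s.mat d S) s := by
  have hpos : 0 < d := k.pos
  set M := s.mat d R with hM
  set w₀ := s.vec 27 d with hw₀
  apply WP.time
  · apply WP.seq' (reduceRow_spec hd hR hk)
    intro s₁ hf₁ hv₁
    have h13 : ∀ S, s₁.mat d S = s.mat d S := fun S => by
      unfold Store.mat; rw [hf₁.int 13 rfl]
    have hd₁ : s₁.int 0 0 = d := by rw [hf₁.int 0 rfl, hd]
    have hR₁ : s₁.int 23 0 = R := by rw [hf₁.int 23 rfl, hR]
    have hk₁ : s₁.int 28 0 = (k : ℕ) := by rw [hf₁.int 28 rfl, hk]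
    -- The variant bounds the product of consecutive remainders by a power of two. Both start below
    -- `2 ^ ℓ`, which gives the exponent `2 * ℓ`; one more round is needed to make the last
    -- remainder zero.
    refine WP.loop (fun v s' => ∃ row w : Fin d → ℤ, s'.mat d R = Function.update M k row ∧
      s'.vec 27 d = w ∧ (∀ S ≠ R, s'.mat d S = s.mat d S) ∧
      Submodule.span ℤ {row, w} = Submodule.span ℤ {M k, w₀} ∧ (∀ c < k, row c = 0) ∧
      (∀ c < k, w c = 0) ∧ (row k = 0 → row = 0) ∧ (0 ≤ w k ∨ row k = 0) ∧
      (w k = 0 ∨ (1 ≤ v ∧ |w k| * (row k % w k) < 2 ^ (v - 1)))) (2 * ℓ + 1) (80 * d + 40)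
      ?_ ?_ ?_
    · refine ⟨M k, _, by simp [h13, hM], rfl, fun S _ => h13 S, ?_, (htri k).1, ?_, (htri k).2, ?_,
        ?_⟩
      · rw [hv₁, span_pair_sub_smul]
      · intro c hc
        rw [hv₁]
        have h1 := hw c hc
        have h2 := (htri k).1 c hc
        simp [← hw₀, ← hM, h2, h1]
      · rw [hv₁]
        by_cases h : M k k = 0
        · exact .inr h
        · left
          have := Int.emod_nonneg (w₀ k) h
          rw [Int.emod_def, mul_comm] at this
          simpa [← hw₀, ← hM] using this
      · rw [hv₁]
        have he : (w₀ - (w₀ k / M k k) • M k) k = w₀ k % M k k := by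
          rw [Int.emod_def, mul_comm]; simp
        rw [he]
        -- Division by zero gives zero, so with an empty row the vector stays unreduced and may be
        -- large. The product still vanishes, because `0 % w = 0`.
        by_cases h : M k k = 0
        · right
          simp [h]
        by_cases h' : w₀ k % M k k = 0
        · exact .inl h'
        right
        refine ⟨by omega, ?_⟩
        have h1 := Int.emod_nonneg (w₀ k) h
        have h2 := Int.emod_lt_abs (w₀ k) h
        have h3 := Int.emod_lt_of_pos (M k k) (b := w₀ k % M k k) (by omega)
        have h4 := Int.emod_nonneg (M k k) h'
        rw [abs_of_nonneg h1, show 2 * ℓ + 1 - 1 = ℓ + ℓ by omega, pow_add]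
        apply mul_lt_mul'' <;> omega
    · rintro v s' hf ⟨row, w, h1, h2, h3, h4, h5, h6, h7, h8, h9⟩ hc
      have hd' : s'.int 0 0 = d := by rw [hf.int 0 rfl, hd₁]
      have hR' : s'.int 23 0 = R := by rw [hf.int 23 rfl, hR₁]
      have hk' : s'.int 28 0 = (k : ℕ) := by rw [hf.int 28 rfl, hk₁]
      have hwk : w k ≠ 0 := by
        intro h
        apply hc
        have : s'.int 27 (k : ℕ) = w k := by rw [← h2]; rfl
        simp [hk', this, h]
      have h9' := h9.resolve_left hwk
      refine ⟨v - 1, by omega, (euclidRow_spec hd' hR' hk').mono le_rfl ?_⟩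
      rintro s'' - ⟨g1, g2, g3⟩
      rw [h1, h2] at g1 g2
      simp only [Function.update_self, Function.update_idem] at g1 g2
      have he : (row - (row k / w k) • w) k = row k % w k := by
        rw [Int.emod_def, mul_comm]; simp
      obtain ⟨e1, e2⟩ := euclid_step hwk h8 h9'.2
      refine ⟨w, _, g2, g1, fun S hS => (g3 S hS).trans (h3 S hS), ?_, h6, ?_, ?_, ?_, ?_⟩
      · rw [span_pair_sub_smul, Set.pair_comm, h4]
      · intro c hc
        simp [h5 c hc, h6 c hc]
      · exact fun h => absurd h hwk
      · rw [he]; exact .inl e1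
      · rw [he]
        exact e2
    · rintro v s' hf ⟨row, w, h1, h2, h3, h4, h5, h6, h7, h8, h9⟩ hc
      have hk' : s'.int 28 0 = (k : ℕ) := by rw [hf.int 28 rfl, hk₁]
      have hwk : w k = 0 := by
        have : s'.int 27 (k : ℕ) = w k := by rw [← h2]; rfl
        simp only [BExp.eval_not, BExp.eval_and, BExp.eval_ile, IExp.eval_get, IExp.eval_lit, hk',
          this, not_not] at hc
        omega
      rw [h1, h2]
      refine ⟨?_, ?_, ?_, ?_, h3⟩
      · intro j
        by_cases hj : j = k
        · subst hj; simpa using ⟨h5, h7⟩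
        · simpa [hj] using htri j
      · rw [rowSpan_update_sup, h4, ← rowSpan_update_sup, Function.update_eq_self]
      · intro c hc
        rcases hc.lt_or_eq with hc | rfl
        · exact h6 c hc
        · exact hwk
      · intro j hj
        simp [hj]
  · simp only [BExp.cost_not, BExp.cost_and, BExp.cost_ile, IExp.cost_get, IExp.cost_lit]
    nlinarith

/-- After column `k` the vector vanishes up to `k`, and at the end it is zero, so nothing of it is
left outside the matrix. Row `k` is still the original one when its turn comes, hence bounds on the
initial pivots suffice. -/
theorem insertVec_spec {d R ℓ : ℕ} {s : Store} (hd : s.int 0 0 = d) (hR : s.int 23 0 = R)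
    (htri : IsTri (s.mat d R)) (hl : ∀ k, |s.mat d R k k| < 2 ^ ℓ) (hpos : 0 < d) :
    WP insertVec (400 * d * d * (ℓ + 1)) (fun s' => IsTri (s'.mat d R) ∧
        rowSpan (s'.mat d R) = rowSpan (s.mat d R) ⊔ Submodule.span ℤ {s.vec 27 d} ∧
        ∀ S ≠ R, s'.mat d S = s.mat d S) s := by
  have hmat : ∀ (s' : Store) (x : ℤ) S, (s'.setInt 28 0 x).mat d S = s'.mat d S := by
    intro s' x S
    funext k c
    simp [Store.mat]
  have hvec : ∀ (s' : Store) (x : ℤ), (s'.setInt 28 0 x).vec 27 d = s'.vec 27 d := by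
    intro s' x
    funext c
    simp [Store.vec]
  apply WP.time
  · refine WP.forN (fun i s' => IsTri (s'.mat d R) ∧
        rowSpan (s'.mat d R) ⊔ Submodule.span ℤ {s'.vec 27 d} =
          rowSpan (s.mat d R) ⊔ Submodule.span ℤ {s.vec 27 d} ∧
        (∀ c : Fin d, (c : ℕ) < i → s'.vec 27 d c = 0) ∧
        (∀ j : Fin d, i ≤ (j : ℕ) → s'.mat d R j = s.mat d R j) ∧
        ∀ S ≠ R, s'.mat d S = s.mat d S) d (350 * d * (ℓ + 1)) ?_ rfl ?_ ?_ ?_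
    · simpa [hmat, hvec] using htri
    · intro s' hf
      have := hf.int 0 rfl
      simp [this, hd]
    · rintro i hi s' hf hi' ⟨h1, h2, h3, h4, h5⟩
      have hd' : s'.int 0 0 = d := by rw [hf.int 0 rfl, hd]
      have hR' : s'.int 23 0 = R := by rw [hf.int 23 rfl, hR]
      refine (insertRow_spec (k := ⟨i, hi⟩) hd' hR' hi' h1 (ℓ := ℓ) ?_ ?_).mono le_rfl ?_
      · rw [h4 ⟨i, hi⟩ le_rfl]; exact hl _
      · intro c hc; exact h3 c hc
      · rintro s'' - ⟨g1, g2, g3, g4, g5⟩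
        simp only [hmat, hvec]
        refine ⟨g1, g2.trans h2, ?_, ?_, fun S hS => (g5 S hS).trans (h5 S hS)⟩
        · intro c hc
          exact g3 c (Fin.le_def.2 (by simpa using Nat.lt_succ_iff.1 hc))
        · intro j hj
          rw [g4 j (by rintro rfl; simp at hj), h4 j (by omega)]
    · rintro s' hf ⟨h1, h2, h3, h4, h5⟩
      refine ⟨h1, ?_, h5⟩
      have : s'.vec 27 d = 0 := funext fun c => h3 c c.2
      rw [← h2, this]
      simp
  · simp only [IExp.cost_get, IExp.cost_lit]
    nlinarith [Nat.mul_le_mul hpos hpos, Nat.zero_le (d * ℓ), Nat.mul_le_mul_right (d * ℓ) hpos]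


/-! ### Computing volumes -/

/-! ### Partial sums and products, as loop invariants. -/

section psum
variable {β : Type*} [AddCommMonoid β] {d : ℕ}

/-- The sum of the first `j` terms. -/
def psum (g : Fin d → β) (j : ℕ) : β := ∑ l ∈ Finset.univ.filter (fun l : Fin d => (l : ℕ) < j), g l

theorem psum_zero (g : Fin d → β) : psum g 0 = 0 := by simp [psum]

theorem psum_full (g : Fin d → β) : psum g d = ∑ l, g l := by simp [psum]

theorem psum_succ (g : Fin d → β) {j : ℕ} (hj : j < d) : psum g (j + 1) = psum g j + g ⟨j, hj⟩ := by
  have : (Finset.univ.filter fun l : Fin d => (l : ℕ) < j + 1) =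
      insert ⟨j, hj⟩ (Finset.univ.filter fun l : Fin d => (l : ℕ) < j) := by
    ext l
    simp only [Finset.mem_filter, Finset.mem_univ, true_and, Finset.mem_insert, Fin.ext_iff]
    omega
  rw [psum, this, Finset.sum_insert (by simp), add_comm, psum]

end psum

section pprod
variable {β : Type*} [CommMonoid β] {d : ℕ}

/-- The product of the first `j` terms. -/
def pprod (g : Fin d → β) (j : ℕ) : β := ∏ l ∈ Finset.univ.filter (fun l : Fin d => (l : ℕ) < j), g l

theorem pprod_zero (g : Fin d → β) : pprod g 0 = 1 := by simp [pprod]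

theorem pprod_full (g : Fin d → β) : pprod g d = ∏ l, g l := by simp [pprod]

theorem pprod_succ (g : Fin d → β) {j : ℕ} (hj : j < d) :
    pprod g (j + 1) = pprod g j * g ⟨j, hj⟩ := by
  have : (Finset.univ.filter fun l : Fin d => (l : ℕ) < j + 1) =
      insert ⟨j, hj⟩ (Finset.univ.filter fun l : Fin d => (l : ℕ) < j) := by
    ext l
    simp only [Finset.mem_filter, Finset.mem_univ, true_and, Finset.mem_insert, Fin.ext_iff]
    omega
  rw [pprod, this, Finset.prod_insert (by simp), mul_comm, pprod]

end pprod

namespace Prog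

/-- Sum the values of `x` over `V r = 0, …, d - 1` into the real variable `acc`. -/
def sumLoop (acc r : ℕ) (x : RExp) : Program :=
  .rset acc (.ofInt (.lit 0)) ;; .forN r D (.rset acc (rvar acc + x))

/-- The position in row `V 28`, column `V 29`. -/
abbrev ixK : IExp := ivar 28 * D + ivar 29

/-- The position in row `V 30`, column `V 29`. -/
abbrev ixL : IExp := ivar 30 * D + ivar 29

/-- Compute the coordinates of the lattice vector in row `V 28` of the matrix `V 23`. -/
def volRow : Program :=
  .forN 29 D (sumLoop 24 30 (.ofInt (.get 13 ((ivar 23 * D + ivar 28) * D + ivar 30)) * .get 2 ixL) ;;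
    .setReal 20 ixK (rvar 24))

/-- Make row `V 28` orthogonal to the previous rows. -/
def volOrth : Program :=
  .forN 30 (ivar 28) (sumLoop 23 29 (.get 20 ixL * .get 20 ixK) ;;
    .rset 23 (rvar 23 / .get 21 (ivar 30)) ;;
    .forN 29 D (.setReal 20 ixK (.get 20 ixK - rvar 23 * .get 20 ixL)))

/-- Compute the volume and the dimension of the lattice `V 23`. -/
def latVol : Program :=
  .rset 22 (.ofInt (.lit 1)) ;; .iset 33 (.lit 0) ;;
  .forN 28 D (volRow ;; volOrth ;; sumLoop 23 29 (.get 20 ixK * .get 20 ixK) ;;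
    .setReal 21 (ivar 28) (rvar 23) ;;
    .branch (.ieq diagM (.lit 0)) .skip
      (.rset 22 (rvar 22 * .sqrt (rvar 23)) ;; .iset 33 (ivar 33 + .lit 1)))

end Prog
open Prog

theorem sumLoop_spec {acc r d : ℕ} {x : RExp} {s : Store} (g : Fin d → ℝ) (hd : s.int 0 0 = d)
    (hr : r ≠ 0) (hx : ∀ s', Frame (sumLoop acc r x) s s' → ∀ i : Fin d, s'.int r 0 = (i : ℕ) →
      x.eval s' = g i) :
    WP (sumLoop acc r x) (d * (x.cost + 25) + 20) (fun s' => s'.real acc 0 = ∑ i, g i) s := by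
  apply WP.time
  · apply WP.seq
    apply WP.setReal
    refine WP.forN (fun i s' => s'.real acc 0 = psum g i) d (x.cost + 6) ?_ rfl ?_ ?_ ?_
    · simp [psum_zero]
    · intro s' hf
      have := hf.int 0 (by simp [Program.forN, Program.wI, hr.symm])
      simp [this, hd]
    · intro i hi s' hf hi' h
      have hf' : Frame (sumLoop acc r x) s s' := by
        refine Frame.trans (s' := s.setReal acc 0 0) ?_ ((show Frame _ (s.setReal acc 0 0) s' by simpa using hf).mono ?_ ?_)
        · refine ⟨fun _ _ => rfl, fun a ha => ?_⟩
          simp only [sumLoop, Program.forN, Program.wR, Bool.or_eq_false_iff,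
            beq_eq_false_iff_ne] at ha
          simp [ha.1]
        · simp +contextual [sumLoop, Program.forN, Program.wI]
        · simp +contextual [sumLoop, Program.forN, Program.wR]
      refine WP.time (.setReal ?_) (by simp; omega)
      simp [h, hx s' hf' ⟨i, hi⟩ hi', psum_succ g hi]
    · intro s' hf h
      rw [h, psum_full]
  · simp only [IExp.cost_get, IExp.cost_lit, RExp.cost_ofInt]
    have : d * (x.cost + 6 + (1 + 1) + 12) ≤ d * (x.cost + 25) := Nat.mul_le_mul_left _ (by omega)
    omega

/-- The integer combination of vectors with given coefficients. -/
def intComb {d : ℕ} (u : Fin d → E d) (k : Fin d → ℤ) : E d := ∑ i, k i • u i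

theorem intComb_apply {d : ℕ} (u : Fin d → E d) (k : Fin d → ℤ) (c : Fin d) :
    intComb u k c = ∑ l, (k l : ℝ) * u l c := by
  simp [intComb]

/-- The `i`-th vector of length `d` in a real array. -/
def Store.rvec (s : Store) (a d : ℕ) (i : ℕ) : Fin d → ℝ := fun c => s.real a (vecIdx d i c)

theorem volRow_spec {d R : ℕ} {k : Fin d} {s : Store} {u : Fin d → E d} (hd : s.int 0 0 = d)
    (hR : s.int 23 0 = R) (hk : s.int 28 0 = (k : ℕ)) (hu : ∀ l c : Fin d, s.real 2 (vecIdx d l c) = u l c) :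
    WP volRow (150 * d * d) (fun s' => (∀ c, s'.rvec 20 d k c = intComb u (s.mat d R k) c) ∧
      ∀ l : Fin d, l ≠ k → s'.rvec 20 d l = s.rvec 20 d l) s := by
  have hpos : 0 < d := k.pos
  apply WP.time
  · refine WP.forN (fun i s' => ∀ l c : Fin d, s'.real 20 (vecIdx d l c) = if l = k ∧ (c : ℕ) < i then
      intComb u (s.mat d R k) c else s.rvec 20 d l c) d (60 * d + 40) ?_ rfl ?_ ?_ ?_
    · simp [Store.rvec]
    · intro s' hf
      have := hf.int 0 rfl
      simp [this, hd]
    · intro i hi s' hf hi' h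
      have h0 : s'.int 0 0 = d := by rw [hf.int 0 rfl, hd]
      have h23 : s'.int 23 0 = R := by rw [hf.int 23 rfl, hR]
      have h28 : s'.int 28 0 = (k : ℕ) := by rw [hf.int 28 rfl, hk]
      have h13 := hf.int 13 rfl
      have h2 := hf.real 2 rfl
      apply WP.time
      · refine WP.seq (T' := 20) (WP.mono (sumLoop_spec (fun l => (s.mat d R k l : ℝ) * u l ⟨i, hi⟩) h0 (by decide)
          ?_) le_rfl ?_)
        · intro s₁ hf₁ l hl
          have g0 := hf₁.int 0 rfl
          have g23 := hf₁.int 23 rfl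
          have g28 := hf₁.int 28 rfl
          have g29 := hf₁.int 29 rfl
          have g13 := hf₁.int 13 rfl
          have g2 := hf₁.real 2 rfl
          have e1 : s.mat d R k l = s.int 13 ((R * d + (k : ℕ)) * d + (l : ℕ)) := rfl
          have e2 := hu l ⟨i, hi⟩
          simp only [vecIdx] at e2
          simp [g0, g23, g28, g29, g13, g2, h0, h23, h28, h13, h2, hi', hl, e1, e2]
        · intro s₁ hf₁ h₁
          have g0 := hf₁.int 0 rfl
          have g28 := hf₁.int 28 rfl
          have g29 := hf₁.int 29 rfl
          have g20 := hf₁.real 20 rfl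
          refine WP.time (.setReal ?_) (by simp)
          intro l c
          have hm : ((k : ℕ) : ℤ) * d + (i : ℕ) = vecIdx d k ⟨i, hi⟩ := rfl
          rw [← intComb_apply] at h₁
          simp only [Store.setInt_real, IExp.eval_hadd, IExp.eval_hmul, IExp.eval_get, IExp.eval_lit,
            g28, g0, g29, h28, h0, hi', hm, RExp.eval_get, Store.setReal_real_same, vecIdx_inj,
            h₁, g20, h l c]
          by_cases hc : l = k ∧ c = ⟨i, hi⟩
          · obtain ⟨rfl, rfl⟩ := hc
            simp
          · have hc' : ¬ ((l : ℕ) = k ∧ c = ⟨i, hi⟩) := fun h => hc ⟨Fin.ext h.1, h.2⟩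
            rw [if_neg hc']
            congr 1
            by_cases hl : l = k
            · have : (c : ℕ) ≠ i := fun h => hc ⟨hl, Fin.ext h⟩
              simp only [hl, true_and, eq_iff_iff]
              omega
            · simp [hl]
      · simp; ring_nf; omega
    · intro s' hf h
      refine ⟨fun c => ?_, fun l hl => ?_⟩
      · simpa [Store.rvec] using h k c
      · funext c
        simpa [hl, Store.rvec] using h l c
  · simp
    nlinarith

/-! ### Gram-Schmidt orthogonalization on the machine. -/

section gs
open InnerProductSpace
variable {d : ℕ} (v : Fin d → E d)

/-- The projection of `v k` to the span of the `l`-th vector of the orthogonalization. -/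
def gsProj (k l : Fin d) : E d :=
  (inner ℝ (gramSchmidt ℝ v l) (v k) / ‖gramSchmidt ℝ v l‖ ^ 2) • gramSchmidt ℝ v l

theorem gramSchmidt_eq_psum (k : Fin d) : gramSchmidt ℝ v k = v k - psum (gsProj v k) k := by
  rw [gramSchmidt_def]
  congr 1
  rw [psum]
  refine Finset.sum_congr ?_ fun l _ => ?_
  · ext l; simp
  · rw [Submodule.starProjection_singleton]
    rfl

/-- The program overwrites row `k` while it subtracts projections, so it takes inner products with
the partly reduced row. Orthogonality of the earlier vectors makes this harmless. -/
theorem inner_gs_partial {k l : Fin d} :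
    inner ℝ (gramSchmidt ℝ v l) (v k - psum (gsProj v k) l) = inner ℝ (gramSchmidt ℝ v l) (v k) := by
  rw [inner_sub_right, psum, inner_sum, Finset.sum_eq_zero, sub_zero]
  intro j hj
  simp only [Finset.mem_filter, Finset.mem_univ, true_and] at hj
  rw [gsProj, inner_smul_right, gramSchmidt_orthogonal ℝ v (by rintro rfl; simp at hj), mul_zero]

theorem volOrth_spec {k : Fin d} {s : Store} (hd : s.int 0 0 = d) (hk : s.int 28 0 = (k : ℕ))
    (hv : ∀ c, s.rvec 20 d k c = v k c)
    (hg : ∀ l < k, ∀ c, s.rvec 20 d l c = gramSchmidt ℝ v l c)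
    (hn : ∀ l < k, s.real 21 (l : ℕ) = ‖gramSchmidt ℝ v l‖ ^ 2) :
    WP volOrth (250 * d * d) (fun s' => ∀ l ≤ k, ∀ c, s'.rvec 20 d l c = gramSchmidt ℝ v l c) s := by
  have hpos : 0 < d := k.pos
  apply WP.time
  · refine WP.forN (fun i s' => (∀ c, s'.rvec 20 d k c = (v k - psum (gsProj v k) i) c) ∧
      ∀ l < k, ∀ c, s'.rvec 20 d l c = gramSchmidt ℝ v l c) k (200 * d) ?_ rfl ?_ ?_ ?_
    · refine ⟨fun c => ?_, fun l hl c => ?_⟩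
      · simpa [psum_zero, Store.rvec] using hv c
      · simpa [Store.rvec] using hg l hl c
    · intro s' hf
      have := hf.int 28 rfl
      simp [this, hk]
    · intro i hi s' hf hi' ⟨h, h'⟩
      have hid : i < d := hi.trans k.2
      set j : Fin d := ⟨i, hid⟩ with hj
      have hjk : j < k := hi
      have h0 : s'.int 0 0 = d := by rw [hf.int 0 rfl, hd]
      have h28 : s'.int 28 0 = (k : ℕ) := by rw [hf.int 28 rfl, hk]
      have h21 := hf.real 21 rfl
      apply WP.time
      · refine WP.seq (T' := 60 * d + 40) (WP.mono (sumLoop_spec (fun c => s'.rvec 20 d i c * s'.rvec 20 d k c) h0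
          (by decide) ?_) le_rfl ?_)
        · intro s₁ hf₁ c hc
          have g0 := hf₁.int 0 rfl
          have g28 := hf₁.int 28 rfl
          have g30 := hf₁.int 30 rfl
          have g20 := hf₁.real 20 rfl
          simp [g0, g28, g30, g20, h0, h28, hi', hc, Store.rvec, vecIdx]
        · intro s₁ hf₁ h₁
          have g0 : s₁.int 0 0 = d := by rw [hf₁.int 0 rfl, h0]
          have g28 : s₁.int 28 0 = (k : ℕ) := by rw [hf₁.int 28 rfl, h28]
          have g30 : s₁.int 30 0 = (i : ℕ) := by rw [hf₁.int 30 rfl, hi']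
          have g20 := hf₁.real 20 rfl
          have g21 := hf₁.real 21 rfl
          have hin : ∑ c, s'.rvec 20 d i c * s'.rvec 20 d k c =
              inner ℝ (gramSchmidt ℝ v j) (v k) := by
            rw [← inner_gs_partial, PiLp.inner_apply]
            refine Finset.sum_congr rfl fun c _ => ?_
            have e1 := h' j hjk c
            simp only [hj] at e1
            rw [e1, h c]
            simp [mul_comm, hj]
          rw [hin] at h₁
          apply WP.time
          · apply WP.seq
            apply WP.setReal
            -- If the Gram-Schmidt vector is zero, both the machine and `gsProj` divide by zero with
            -- result zero, so zero rows need no special case.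
            set q := inner ℝ (gramSchmidt ℝ v j) (v k) / ‖gramSchmidt ℝ v j‖ ^ 2 with hq
            have hq' : (rvar 23 / RExp.get 21 (ivar 30)).eval s₁ = q := by
              have := hn j hjk
              simp only [hj] at this
              simp [h₁, g30, g21, h21, this, hq, hj]
            rw [hq']
            refine WP.forN (fun a s'' => ∀ l c : Fin d, s''.real 20 (vecIdx d l c) =
              if l = k ∧ (c : ℕ) < a then s'.rvec 20 d k c - q * s'.rvec 20 d i c
                else s'.rvec 20 d l c) d 40 ?_ rfl ?_ ?_ ?_
            · simp [Store.rvec, g20]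
            · intro s'' hf''
              have := hf''.int 0 rfl
              simp [this, g0]
            · intro a ha s₂ hf₂ ha' h₂
              have e0 := hf₂.int 0 rfl
              have e28 := hf₂.int 28 rfl
              have e30 := hf₂.int 30 rfl
              have e23 := hf₂.real 23 rfl
              refine WP.time (.setReal ?_) (by simp)
              have hm : ((k : ℕ) : ℤ) * d + (a : ℕ) = vecIdx d k ⟨a, ha⟩ := rfl
              have hm' : (i : ℤ) * d + (a : ℕ) = vecIdx d j ⟨a, ha⟩ := rfl
              intro l c
              simp only [Store.setInt_real, IExp.eval_hadd, IExp.eval_hmul, IExp.eval_get,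
                IExp.eval_lit, Store.setReal_int, RExp.eval_hsub, RExp.eval_hmul, e23,
                e28, e0, e30, g28, g0, g30, ha', hm, hm', RExp.eval_get, Store.setReal_real_same,
                vecIdx_inj, h₂]
              by_cases hc : l = k ∧ c = ⟨a, ha⟩
              · obtain ⟨rfl, rfl⟩ := hc
                simp [hj]
              · have hc' : ¬ ((l : ℕ) = k ∧ c = ⟨a, ha⟩) := fun h => hc ⟨Fin.ext h.1, h.2⟩
                rw [if_neg hc']
                congr 1
                by_cases hl : l = k
                · have : (c : ℕ) ≠ a := fun h => hc ⟨hl, Fin.ext h⟩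
                  simp only [hl, true_and, eq_iff_iff]
                  omega
                · simp [hl]
            · intro s₂ hf₂ h₂
              refine ⟨fun c => ?_, fun l hl c => ?_⟩
              · have e1 := h₂ k c
                have e2 := h c
                have e3 := h' j hjk c
                simp only [c.2, and_self, if_true] at e1
                simp only [Store.rvec, Store.setInt_real] at e1 e2 e3 ⊢
                simp only [hj] at e3
                rw [e1, e2, e3, psum_succ _ hid]
                simp only [PiLp.sub_apply, PiLp.add_apply, gsProj, ← hj, ← hq, PiLp.smul_apply,
                  smul_eq_mul]
                ring
              · have e1 := h₂ l c
                simp only [hl.ne, false_and, if_false] at e1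
                simp only [Store.rvec, Store.setInt_real] at e1 ⊢
                rw [e1]
                exact h' l hl c
          · simp; ring_nf; omega
      · simp; ring_nf; omega
    · intro s' hf ⟨h, h'⟩ l hl c
      rcases hl.lt_or_eq with hl | rfl
      · exact h' l hl c
      · rw [h c, ← gramSchmidt_eq_psum]
  · have := k.2
    simp
    nlinarith

/-- Rows with zero pivot are zero and must be left out of the product; the others are counted to
obtain the dimension. The result is identified with the lattice volume in `latticeVolume_tri`. -/
theorem latVol_spec {d R : ℕ} {s : Store} {u : Fin d → E d} (hd : s.int 0 0 = d)
    (hR : s.int 23 0 = R) (hu : ∀ l c : Fin d, s.real 2 (vecIdx d l c) = u l c) (hpos : 0 < d) :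
    WP latVol (800 * d * d * d) (fun s' =>
      s'.real 22 0 = ∏ k, (if s.mat d R k k = 0 then 1 else
        ‖gramSchmidt ℝ (fun k => intComb u (s.mat d R k)) k‖) ∧
      s'.int 33 0 = ((∑ k, (if s.mat d R k k = 0 then 0 else 1) : ℕ) : ℤ)) s := by
  set v := fun k => intComb u (s.mat d R k) with hv
  set M := s.mat d R with hM
  apply WP.time
  · apply WP.seq
    apply WP.setReal
    apply WP.seq
    apply WP.setInt
    refine WP.forN (fun i s' => (∀ l : Fin d, (l : ℕ) < i → ∀ c, s'.rvec 20 d l c = gramSchmidt ℝ v l c)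
      ∧ (∀ l : Fin d, (l : ℕ) < i → s'.real 21 (l : ℕ) = ‖gramSchmidt ℝ v l‖ ^ 2) ∧
      s'.real 22 0 = pprod (fun k => if M k k = 0 then 1 else ‖gramSchmidt ℝ v k‖) i ∧
      s'.int 33 0 = ((psum (fun k => if M k k = 0 then 0 else 1) i : ℕ) : ℤ)) d (600 * d * d)
      ?_ rfl ?_ ?_ ?_
    · simp [pprod_zero, psum_zero]
    · intro s' hf
      have := hf.int 0 rfl
      simp [this, hd]
    · intro i hi s' hf hi' ⟨h1, h2, h3, h4⟩
      set k : Fin d := ⟨i, hi⟩ with hk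
      have h0 : s'.int 0 0 = d := by rw [hf.int 0 rfl]; simpa using hd
      have h23 : s'.int 23 0 = R := by rw [hf.int 23 rfl]; simpa using hR
      have hu' : ∀ l c : Fin d, s'.real 2 (vecIdx d l c) = u l c := by
        rw [hf.real 2 rfl]; simpa using hu
      have hmat : s'.mat d R = M := by
        funext a c
        simp only [hM, Store.mat, hf.int 13 rfl]
        simp
      apply WP.time
      · refine WP.seq (T' := 400 * d * d) (WP.mono (volRow_spec (k := k) h0 h23 hi' hu') le_rfl ?_)
        rw [hmat]
        rintro s₁ hf₁ ⟨a1, a2⟩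
        have b0 : s₁.int 0 0 = d := by rw [hf₁.int 0 rfl, h0]
        have b28 : s₁.int 28 0 = (k : ℕ) := by rw [hf₁.int 28 rfl, hi']
        apply WP.time
        · refine WP.seq (T' := 140 * d) (WP.mono (volOrth_spec v (k := k) b0 b28 a1 ?_ ?_) le_rfl ?_)
          · intro l hl c
            rw [a2 l hl.ne]
            exact h1 l hl c
          · intro l hl
            rw [hf₁.real 21 rfl]
            exact h2 l hl
          intro s₂ hf₂ c1
          have d0 : s₂.int 0 0 = d := by rw [hf₂.int 0 rfl, b0]
          have d28 : s₂.int 28 0 = (k : ℕ) := by rw [hf₂.int 28 rfl, b28]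
          apply WP.time
          · refine WP.seq (T' := 70) (WP.mono (sumLoop_spec (fun c => s₂.rvec 20 d k c * s₂.rvec 20 d k c) d0
              (by decide) ?_) le_rfl ?_)
            · intro s₃ hf₃ c hc
              have g0 := hf₃.int 0 rfl
              have g28 := hf₃.int 28 rfl
              have g20 := hf₃.real 20 rfl
              simp [g0, g28, g20, d0, d28, hc, Store.rvec, vecIdx]
            · intro s₃ hf₃ e1
              have hnorm : ∑ c, s₂.rvec 20 d k c * s₂.rvec 20 d k c = ‖gramSchmidt ℝ v k‖ ^ 2 := by
                rw [EuclideanSpace.real_norm_sq_eq]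
                refine Finset.sum_congr rfl fun c _ => ?_
                rw [c1 k le_rfl, sq]
              rw [hnorm] at e1
              have f0 : s₃.int 0 0 = d := by rw [hf₃.int 0 rfl, d0]
              have f28 : s₃.int 28 0 = (k : ℕ) := by rw [hf₃.int 28 rfl, d28]
              have f23 : s₃.int 23 0 = R := by
                rw [hf₃.int 23 rfl, hf₂.int 23 rfl, hf₁.int 23 rfl, h23]
              have f13 : s₃.int 13 ((R * d + (k : ℕ)) * d + (k : ℕ)) = M k k := by
                rw [hf₃.int 13 rfl, hf₂.int 13 rfl, hf₁.int 13 rfl, ← hmat]; rfl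
              have f22 : s₃.real 22 0 = s'.real 22 0 := by
                rw [hf₃.real 22 rfl, hf₂.real 22 rfl, hf₁.real 22 rfl]
              have f33 : s₃.int 33 0 = s'.int 33 0 := by
                rw [hf₃.int 33 rfl, hf₂.int 33 rfl, hf₁.int 33 rfl]
              have f20 : ∀ l ≤ k, ∀ c, s₃.real 20 (vecIdx d l c) = gramSchmidt ℝ v l c := by
                rw [hf₃.real 20 rfl]; exact c1
              have f21 : ∀ l < k, s₃.real 21 (l : ℕ) = ‖gramSchmidt ℝ v l‖ ^ 2 := by
                rw [hf₃.real 21 rfl, hf₂.real 21 rfl, hf₁.real 21 rfl]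
                exact h2
              have A : ∀ (X : ℤ → ℝ), (∀ l < k, X (l : ℕ) = ‖gramSchmidt ℝ v l‖ ^ 2) →
                  ∀ l : Fin d, (l : ℕ) < i + 1 → (if (l : ℕ) = (k : ℕ) then ‖gramSchmidt ℝ v k‖ ^ 2
                    else X (l : ℕ)) = ‖gramSchmidt ℝ v l‖ ^ 2 := by
                intro X hX l hl
                by_cases hlk : l = k
                · simp [hlk]
                · have : (l : ℕ) ≠ k := fun h => hlk (Fin.ext h)
                  rw [if_neg this]
                  exact hX l (Fin.lt_def.2 (by simp only [hk] at this ⊢; omega))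
              have B : ∀ l : Fin d, (l : ℕ) < i + 1 → l ≤ k :=
                fun l hl => Fin.le_def.2 (by simp only [hk]; omega)
              apply WP.time
              · apply WP.seq
                apply WP.setReal
                apply WP.branch
                · intro hc
                  have hc0 : M k k = 0 := by
                    simp [f0, f23, f28, f13] at hc
                    omega
                  apply WP.skip
                  refine ⟨fun l hl c => ?_, fun l hl => ?_, ?_, ?_⟩
                  · simpa [Store.rvec] using f20 l (B l hl) c
                  · simpa [f28, e1] using A _ f21 l hl
                  · simp [f22, h3, pprod_succ _ hi, ← hk, hc0]
                  · simp [f33, h4, psum_succ _ hi, ← hk, hc0]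
                · intro hc
                  have hc0 : M k k ≠ 0 := by
                    simp [f0, f23, f28, f13] at hc
                    intro h
                    simp [h] at hc
                  refine .seq (.setReal (.setInt ?_))
                  refine ⟨fun l hl c => ?_, fun l hl => ?_, ?_, ?_⟩
                  · simpa [Store.rvec] using f20 l (B l hl) c
                  · simpa [f28, e1] using A _ f21 l hl
                  · simp [f22, h3, pprod_succ _ hi, ← hk, hc0, e1]
                  · simp [f33, h4, psum_succ _ hi, ← hk, hc0]
              · simp
          · simp; ring_nf; omega
        · nlinarith
      · nlinarith
    · intro s' hf ⟨h1, h2, h3, h4⟩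
      rw [pprod_full] at h3
      rw [psum_full] at h4
      exact ⟨h3, h4⟩
  · simp
    nlinarith [Nat.mul_le_mul hpos hpos, Nat.mul_le_mul (Nat.mul_le_mul hpos hpos) hpos]

end gs


/-! ### A tournament tree -/

/-- The winner of a match: the index with the smaller value, where negative indices lose. -/
def win (g : ℤ → ℝ) (a b : ℤ) : ℤ :=
  if a < 0 then b else if b < 0 then a else if g a ≤ g b then a else b

/-- The winner of the match is stored in the `i`-th node. -/
def NodeOK (g : ℤ → ℝ) (T : ℤ → ℤ) (i : ℕ) : Prop := T i = win g (T (2 * i)) (T (2 * i + 1))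

/-- `T` is a tournament tree for the elements of `alive`. -/
structure IsTournament {m : ℕ} (g : ℤ → ℝ) (T : ℤ → ℤ) (alive : Finset (Fin m)) : Prop where
  leaf : ∀ j : Fin m, T (m + (j : ℕ)) = if j ∈ alive then ((j : ℕ) : ℤ) else -1
  node : ∀ i : ℕ, 1 ≤ i → i < m → NodeOK g T i

/-- Heap numbering works for every `m`, not only for powers of two: each index from 2 to `2 * m - 1`
has its parent `i / 2` among the inner nodes `1, …, m - 1`. For `m = 1` the only leaf is the root.
-/
theorem IsTournament.root {m : ℕ} {g : ℤ → ℝ} {T : ℤ → ℤ} {alive : Finset (Fin m)}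
    (h : IsTournament g T alive) (hne : alive.Nonempty) :
    ∃ e ∈ alive, T 1 = ((e : ℕ) : ℤ) ∧ ∀ e' ∈ alive, g (e : ℕ) ≤ g (e' : ℕ) := by
  have hm : 0 < m := hne.choose.pos
  -- From the leaves to the root: every node is empty or holds a living edge.
  have hval : ∀ t i : ℕ, 2 * m - i = t → 1 ≤ i → i < 2 * m →
      T i = -1 ∨ ∃ e ∈ alive, T i = ((e : ℕ) : ℤ) := by
    intro t
    induction t using Nat.strong_induction_on with
    | _ t ih =>
      intro i ht h1 h2
      by_cases him : i < m
      · have hn := h.node i h1 him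
        have c1 := ih (2 * m - 2 * i) (by omega) (2 * i) rfl (by omega) (by omega)
        have c2 := ih (2 * m - (2 * i + 1)) (by omega) (2 * i + 1) rfl (by omega) (by omega)
        push_cast at c1 c2
        rw [NodeOK, win] at hn
        rw [hn]
        split_ifs <;> assumption
      · have := h.leaf ⟨i - m, by omega⟩
        have e : ((m : ℤ) + ((i - m : ℕ) : ℤ)) = i := by omega
        simp only [e] at this
        rw [this]
        split_ifs with hi
        · exact .inr ⟨_, hi, rfl⟩
        · exact .inl rfl
  -- From the root to the leaves: the winner at the root beats the content of every nonempty node,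
  -- because a parent beats its children.
  have hle : ∀ i : ℕ, 1 ≤ i → i < 2 * m → T i < 0 ∨ (0 ≤ T 1 ∧ g (T 1) ≤ g (T i)) := by
    intro i
    induction i using Nat.strong_induction_on with
    | _ i ih =>
      intro h1 h2
      by_cases hi : i = 1
      · subst hi
        have : T (1 : ℕ) < 0 ∨ 0 ≤ T (1 : ℕ) := by omega
        simpa using this
      · have hp := ih (i / 2) (by omega) (by omega) (by omega)
        have hn := h.node (i / 2) (by omega) (by omega)
        rw [NodeOK, win] at hn
        rcases Nat.even_or_odd' i with ⟨c, hc | hc⟩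
        · have hc2 : i / 2 = c := by omega
          rw [hc2] at hp hn
          have e : (2 * (c : ℤ)) = (i : ℕ) := by omega
          rw [e] at hn
          by_contra hcon
          push Not at hcon
          rw [if_neg (by omega)] at hn
          split_ifs at hn with h3 h4
          · rw [hn] at hp; grind
          · rw [hn] at hp; grind
          · rw [hn] at hp
            have : (T i : ℤ) ≥ 0 := hcon.1
            rcases hp with hp | ⟨hp, hp'⟩
            · omega
            · have := hcon.2 hp
              linarith
        · have hc2 : i / 2 = c := by omega
          rw [hc2] at hp hn
          have e : (2 * (c : ℤ) + 1) = (i : ℕ) := by omega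
          rw [e] at hn
          by_contra hcon
          push Not at hcon
          split_ifs at hn with h3 h4 h5
          · rw [hn] at hp; grind
          · omega
          · rw [hn] at hp
            rcases hp with hp | ⟨hp, hp'⟩
            · omega
            · have := hcon.2 hp
              linarith
          · rw [hn] at hp; grind
  have hall : ∀ e' ∈ alive, 0 ≤ T 1 ∧ g (T 1) ≤ g (e' : ℕ) := by
    intro e' he'
    have h1 := hle (m + e') (by omega) (by omega)
    have h2 := h.leaf e'
    rw [if_pos he'] at h2
    push_cast at h1
    rw [h2] at h1
    exact h1.resolve_left (by omega)
  obtain ⟨e₀, he₀⟩ := hne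
  have h0 := hall e₀ he₀
  have h1 := hval _ 1 rfl le_rfl (by omega)
  simp only [Nat.cast_one] at h1
  rcases h1 with h1 | ⟨e, he, h1⟩
  · omega
  · refine ⟨e, he, h1, fun e' he' => ?_⟩
    rw [← h1]
    exact (hall e' he').2

namespace Prog

/-- The expression for `m`. -/
abbrev mE : IExp := .get 0 (.lit 2)

abbrev leftE : IExp := .get 15 (.lit 2 * ivar 34)
abbrev rightE : IExp := .get 15 (.lit 2 * ivar 34 + .lit 1)

/-- Play the match in node `V 34`. -/
def pull : Program :=
  .branch (.ilt leftE (.lit 0)) (.setInt 15 (ivar 34) rightE)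
    (.branch (.ilt rightE (.lit 0)) (.setInt 15 (ivar 34) leftE)
      (.branch (.rle (.get 1 leftE) (.get 1 rightE)) (.setInt 15 (ivar 34) leftE)
        (.setInt 15 (ivar 34) rightE)))

/-- Build the tournament tree of all edges. -/
def buildTournament : Program :=
  .forN 35 mE (.setInt 15 (mE + ivar 35) (ivar 35)) ;;
  .forN 35 (mE - .lit 1) (.iset 34 (mE - .lit 1 - ivar 35) ;; pull)

/-- Remove the edge `V 21` from the tournament. -/
def removeEdge : Program :=
  .iset 34 (mE + ivar 21) ;; .setInt 15 (ivar 34) (.lit (-1)) ;;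
  .loop (.ile (.lit 2) (ivar 34)) (.iset 34 (ivar 34 / .lit 2) ;; pull)

end Prog
open Prog

theorem pull_spec {s : Store} {i : ℤ} (hi : s.int 34 0 = i) :
    WP pull 110 (fun s' => ∀ k, s'.int 15 k =
      if k = i then win (s.real 1) (s.int 15 (2 * i)) (s.int 15 (2 * i + 1)) else s.int 15 k) s := by
  apply WP.time
  · refine WP.branch (T := 15) (T' := 80) (fun h => .time (.setInt ?_) ?_) fun h =>
      .time (.branch (T := 15) (T' := 50) (fun h' => .time (.setInt ?_) ?_) fun h' =>
      .time (.branch (T := 15) (T' := 15) (fun h'' => .time (.setInt ?_) ?_) fun h'' =>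
      .time (.setInt ?_) ?_) ?_) ?_
    all_goals try simp
    all_goals
      intro k
      simp [hi] at *
      unfold win
      grind
  · simp

theorem removeEdge_spec {m ℓ : ℕ} {s : Store} {alive : Finset (Fin m)} {e : Fin m}
    (hm : s.int 0 2 = m) (he : s.int 21 0 = (e : ℕ)) (hT : IsTournament (s.real 1) (s.int 15) alive)
    (hl : 2 * m ≤ 2 ^ ℓ) :
    WP removeEdge (150 * (ℓ + 1))
      (fun s' => IsTournament (s.real 1) (s'.int 15) (alive.erase e)) s := by
  apply WP.time
  · apply WP.seq
    apply WP.setInt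
    apply WP.seq
    apply WP.setInt
    -- Only the parent of the current node may be out of date. Moving up halves the index, and at
    -- the root the parent would be 0, which is no node.
    refine WP.loop (fun v s' => ∃ i : ℕ, s'.int 34 0 = i ∧ 1 ≤ i ∧ i < 2 ^ v ∧ i < 2 * m ∧
      (∀ j : Fin m, s'.int 15 (m + (j : ℕ)) = if j ∈ alive.erase e then ((j : ℕ) : ℤ) else -1) ∧
      ∀ k : ℕ, 1 ≤ k → k < m → k ≠ i / 2 → NodeOK (s.real 1) (s'.int 15) k) ℓ 130 ?_ ?_ ?_
    · refine ⟨m + e, by simp [hm, he], by have := e.pos; omega, by omega, by omega, ?_, ?_⟩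
      · intro j
        have := hT.leaf j
        simp only [IExp.eval_lit, IExp.eval_hadd, IExp.eval_get, hm, he, ne_eq, Nat.reduceEqDiff,
          not_false_eq_true, Store.setInt_int_same, Store.setInt_int_ne, if_true, this]
        by_cases hj : j = e
        · subst hj; simp
        · have : (j : ℕ) ≠ e := fun h => hj (Fin.ext h)
          simp [hj, this]
      · intro k h1 h2 h3
        have := hT.node k h1 h2
        have e1 : (k : ℤ) ≠ m + (e : ℕ) := by omega
        have e2 : 2 * (k : ℤ) ≠ m + (e : ℕ) := by omega
        have e3 : 2 * (k : ℤ) + 1 ≠ m + (e : ℕ) := by omega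
        simp only [NodeOK, IExp.eval_lit, IExp.eval_hadd, IExp.eval_get, hm, he, ne_eq,
          Nat.reduceEqDiff,
          not_false_eq_true, Store.setInt_int_same, Store.setInt_int_ne, if_true, e1, e2, e3, if_false]
        exact this
    · rintro v s' hf ⟨i, h1, h2, h3, h4, h5, h6⟩ hc
      simp only [BExp.eval_ile, IExp.eval_lit, IExp.eval_get, h1] at hc
      have hreal : s'.real 1 = s.real 1 := by
        rw [hf.real 1 rfl]; simp
      have hv : v ≠ 0 := by rintro rfl; simp at h3; omega
      refine ⟨v - 1, by omega, WP.time (.seq (.setInt ((pull_spec (i := (i / 2 : ℕ)) ?_).mono le_rfl ?_)))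
        ?_⟩
      · simp [h1]
      · intro s'' hf'' hs
        have h34 : s''.int 34 0 = ((i / 2 : ℕ) : ℤ) := by
          rw [hf''.int 34 rfl]; simp [h1]
        simp only [IExp.eval_lit, IExp.eval_hdiv, IExp.eval_get, ne_eq, Nat.reduceEqDiff,
          not_false_eq_true, Store.setInt_int_ne, Store.setInt_real, hreal] at hs
        refine ⟨i / 2, h34, by omega, ?_, by omega, ?_, ?_⟩
        · have : 2 ^ v = 2 * 2 ^ (v - 1) := by
            rw [← pow_succ']; congr 1; omega
          omega
        · intro j
          rw [hs, if_neg (by omega), h5 j]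
        · intro k hk1 hk2 hk3
          rw [NodeOK]
          by_cases hki : k = i / 2
          · subst hki
            rw [hs, hs, hs, if_pos rfl, if_neg (by omega), if_neg (by omega)]
          · rw [hs, hs, hs, if_neg (by omega), if_neg (by omega), if_neg (by omega)]
            exact h6 k hk1 hk2 hki
      · simp
    · rintro v s' hf ⟨i, h1, h2, h3, h4, h5, h6⟩ hc
      simp only [BExp.eval_ile, IExp.eval_lit, IExp.eval_get, h1] at hc
      exact ⟨h5, fun k hk1 hk2 => h6 k hk1 hk2 (by omega)⟩
  · simp; omega

theorem buildTournament_spec {m : ℕ} {s : Store} (hm : s.int 0 2 = m) (hpos : 0 < m) :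
    WP buildTournament (300 * m)
      (fun s' => IsTournament (s.real 1) (s'.int 15) (Finset.univ : Finset (Fin m))) s := by
  apply WP.time
  · refine WP.seq' (P := fun s' => ∀ j : Fin m, s'.int 15 (m + (j : ℕ)) = ((j : ℕ) : ℤ))
      (T' := 200 * m)
      (WP.forN (fun i s' => ∀ j : Fin m, (j : ℕ) < i → s'.int 15 (m + (j : ℕ)) = ((j : ℕ) : ℤ)) m 20
        (by simp) rfl ?_ ?_ ?_) ?_
    · intro s' hf
      simp [hf.int 0 rfl, hm]
    · intro i hi s' hf hi' h
      refine WP.time (.setInt ?_) (by simp)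
      intro j hj
      have h0 := hf.int 0 rfl
      have := h j
      simp only [IExp.eval_hadd, IExp.eval_get, IExp.eval_lit, h0, hm, hi', ne_eq, Nat.reduceEqDiff,
        not_false_eq_true, Store.setInt_int_ne, Store.setInt_int_same]
      split_ifs with h1
      · omega
      · exact this (by omega)
    · intro s' _ h j
      exact h j j.2
    · intro s₁ hf₁ h₁
      apply WP.time
      -- The matches are played in the order `m - 1, …, 1`, so both children of a node are final
      -- when it is played.
      · refine WP.forN (fun t s' => (∀ j : Fin m, s'.int 15 (m + (j : ℕ)) = ((j : ℕ) : ℤ)) ∧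
          ∀ i : ℕ, m ≤ t + i → 1 ≤ i → i < m → NodeOK (s.real 1) (s'.int 15) i) (m - 1) 130 ?_ rfl
          ?_ ?_ ?_
        · exact ⟨by simpa using h₁, fun i h1 _ h2 => by omega⟩
        · intro s' hf
          simp [hf.int 0 rfl, hf₁.int 0 rfl, hm]
          omega
        · rintro t ht s' hf ht' ⟨h2, h3⟩
          have hm' : s'.int 0 2 = m := by rw [hf.int 0 rfl, hf₁.int 0 rfl, hm]
          have hreal : s'.real 1 = s.real 1 := by rw [hf.real 1 rfl, hf₁.real 1 rfl]
          refine WP.time (.seq (.setInt ((pull_spec (i := (m - 1 - t : ℕ)) ?_).mono le_rfl ?_))) ?_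
          · simp [hm', ht']
            omega
          · intro s'' hf'' hs
            simp only [IExp.eval_lit, IExp.eval_hsub, IExp.eval_get, ne_eq, Nat.reduceEqDiff,
              not_false_eq_true, Store.setInt_int_ne, Store.setInt_real, hreal] at hs
            constructor
            · intro j
              rw [Store.setInt_int_ne _ (by decide), hs, if_neg (by omega), h2 j]
            · intro k hk0 hk1 hk2
              rw [Store.setInt_int_ne _ (by decide), NodeOK]
              by_cases hki : k = m - 1 - t
              · rw [hki, hs, hs, hs, if_pos rfl, if_neg (by omega), if_neg (by omega)]
              · rw [hs, hs, hs, if_neg (by omega), if_neg (by omega), if_neg (by omega)]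
                exact h3 k (by omega) hk1 hk2
          · simp
        · rintro s' hf ⟨h2, h3⟩
          exact ⟨by simpa using h2, fun i hi1 hi2 => h3 i (by omega) hi1 hi2⟩
      · simp; omega
  · simp; omega


/-! ### Connectivity in periodic graphs -/

/-- A graph with shift vectors on its edges. -/
structure ShiftGraph (n m d : ℕ) where
  src : Fin m → Fin n
  tgt : Fin m → Fin n
  sh : Fin m → Fin d → ℤ

namespace ShiftGraph
variable {n m d : ℕ} (Γ : ShiftGraph n m d)

/-- The edges of the periodic graph that are shadows of edges in `P`. -/
def Step (P : Set (Fin m)) (p q : Fin n × (Fin d → ℤ)) : Prop :=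
  ∃ e ∈ P, ∃ k, p = (Γ.src e, k) ∧ q = (Γ.tgt e, k + Γ.sh e)

/-- Connectivity in the periodic graph with edges in `P`. -/
def Conn (P : Set (Fin m)) : Fin n × (Fin d → ℤ) → Fin n × (Fin d → ℤ) → Prop :=
  Relation.EqvGen (Γ.Step P)

variable {Γ} {P Q : Set (Fin m)}

theorem Conn.refl (p) : Γ.Conn P p p := Relation.EqvGen.refl p

theorem Conn.symm {p q} (h : Γ.Conn P p q) : Γ.Conn P q p := Relation.EqvGen.symm _ _ h

theorem Conn.trans {p q r} (h : Γ.Conn P p q) (h' : Γ.Conn P q r) : Γ.Conn P p r :=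
  Relation.EqvGen.trans _ _ _ h h'

theorem Conn.mono (hPQ : P ⊆ Q) {p q} (h : Γ.Conn P p q) : Γ.Conn Q p q :=
  Relation.EqvGen.mono (r := Γ.Step P) (fun _ _ ⟨e, he, h⟩ => ⟨e, hPQ he, h⟩) _ _ h

theorem Conn.edge {e : Fin m} (he : e ∈ P) (k : Fin d → ℤ) :
    Γ.Conn P (Γ.src e, k) (Γ.tgt e, k + Γ.sh e) := .rel _ _ ⟨e, he, k, rfl, rfl⟩

/-- All inductions over walks go through this minimality of connectivity among equivalence
relations. -/
theorem conn_le {S : Fin n × (Fin d → ℤ) → Fin n × (Fin d → ℤ) → Prop} (hS : Equivalence S)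
    (h : ∀ e ∈ P, ∀ k, S (Γ.src e, k) (Γ.tgt e, k + Γ.sh e)) {p q} (hpq : Γ.Conn P p q) : S p q := by
  induction hpq with
  | rel p q h' => obtain ⟨e, he, k, rfl, rfl⟩ := h'; exact h e he k
  | refl p => exact hS.refl p
  | symm p q _ ih => exact hS.symm ih
  | trans p q r _ _ ih ih' => exact hS.trans ih ih'

theorem Conn.shift {p q} (h : Γ.Conn P p q) (u : Fin d → ℤ) :
    Γ.Conn P (p.1, p.2 + u) (q.1, q.2 + u) := by
  refine conn_le (S := fun p q => Γ.Conn P (p.1, p.2 + u) (q.1, q.2 + u)) ⟨fun _ => .refl _,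
    fun h => h.symm, fun h h' => h.trans h'⟩ (fun e he k => ?_) h
  have := Conn.edge (Γ := Γ) he (k + u)
  rwa [add_right_comm] at this

theorem Conn.of_shift {x y : Fin n} {k l : Fin d → ℤ} (h : Γ.Conn P (x, k) (y, l))
    {k' l' : Fin d → ℤ} (hkl : k' - k = l' - l) : Γ.Conn P (x, k') (y, l') := by
  have := h.shift (k' - k)
  simp only [add_sub_cancel] at this
  rwa [hkl, add_sub_cancel] at this

variable (Γ P)

/-- The shifts of closed walks at a vertex. -/
def cyc (x : Fin n) : Submodule ℤ (Fin d → ℤ) :=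
  AddSubgroup.toIntSubmodule
    { carrier := {k | Γ.Conn P (x, 0) (x, k)}
      zero_mem' := Conn.refl _
      add_mem' := fun {k l} hk hl => Conn.trans hk (hl.of_shift (by simp))
      neg_mem' := fun {k} hk => Conn.symm (Conn.of_shift hk (by simp)) }

variable {Γ P}

theorem mem_cyc {x : Fin n} {k : Fin d → ℤ} : k ∈ Γ.cyc P x ↔ Γ.Conn P (x, 0) (x, k) := Iff.rfl

theorem mem_cyc' {x : Fin n} {k l : Fin d → ℤ} : l - k ∈ Γ.cyc P x ↔ Γ.Conn P (x, k) (x, l) :=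
  ⟨fun h => Conn.of_shift (mem_cyc.1 h) (by simp), fun h => mem_cyc.2 (h.of_shift (by simp))⟩

/-- A closed walk is moved to another base point by conjugation with a path. Since shifts commute,
this does not change its total shift. -/
theorem cyc_eq {x y : Fin n} {k l : Fin d → ℤ} (h : Γ.Conn P (x, k) (y, l)) :
    Γ.cyc P x = Γ.cyc P y := by
  suffices H : ∀ {x y : Fin n} {k l : Fin d → ℤ}, Γ.Conn P (x, k) (y, l) → Γ.cyc P x ≤ Γ.cyc P y from
    le_antisymm (H h) (H h.symm)
  intro x y k l h u hu
  rw [← add_sub_cancel_left l u, mem_cyc']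
  exact h.symm.trans ((Conn.of_shift (mem_cyc.1 hu) (by simp)).trans
    (h.of_shift (k' := k + u) (by simp)))

theorem cyc_mono (h : P ⊆ Q) (x : Fin n) : Γ.cyc P x ≤ Γ.cyc Q x :=
  fun _ hk => Conn.mono h hk

variable (Γ P)

/-- Connectivity in the quotient graph. -/
def QConn (x y : Fin n) : Prop := ∃ k, Γ.Conn P (x, 0) (y, k)

variable {Γ P}

theorem QConn.refl (x : Fin n) : Γ.QConn P x x := ⟨0, Conn.refl _⟩

theorem QConn.symm {x y : Fin n} (h : Γ.QConn P x y) : Γ.QConn P y x := by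
  obtain ⟨k, h⟩ := h
  exact ⟨-k, h.symm.of_shift (by simp)⟩

theorem QConn.of_conn {x y : Fin n} {k l : Fin d → ℤ} (h : Γ.Conn P (x, k) (y, l)) :
    Γ.QConn P x y := ⟨l - k, h.of_shift (by simp)⟩

theorem QConn.trans {x y z : Fin n} (h : Γ.QConn P x y) (h' : Γ.QConn P y z) : Γ.QConn P x z := by
  obtain ⟨k, h⟩ := h
  obtain ⟨l, h'⟩ := h'
  exact ⟨k + l, h.trans (h'.of_shift (by simp))⟩

theorem QConn.mono (hPQ : P ⊆ Q) {x y : Fin n} (h : Γ.QConn P x y) : Γ.QConn Q x y :=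
  h.imp fun _ h => h.mono hPQ

variable (Γ)

/-- The connectivity relation is described by representatives of the components, potentials of the
vertices, and the lattices of the components. -/
def Sem (P : Set (Fin m)) (root : Fin n → Fin n) (phi : Fin n → Fin d → ℤ)
    (L : Fin n → Submodule ℤ (Fin d → ℤ)) : Prop :=
  ∀ x k y l, Γ.Conn P (x, k) (y, l) ↔ root x = root y ∧ (l - phi y) - (k - phi x) ∈ L (root x)

variable {Γ} {root : Fin n → Fin n} {phi : Fin n → Fin d → ℤ}
  {L : Fin n → Submodule ℤ (Fin d → ℤ)}

theorem Sem.qconn (h : Γ.Sem P root phi L) {x y : Fin n} : Γ.QConn P x y ↔ root x = root y := by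
  constructor
  · rintro ⟨k, hk⟩
    exact ((h _ _ _ _).1 hk).1
  · intro hxy
    exact ⟨phi y - phi x, (h _ _ _ _).2 ⟨hxy, by simp⟩⟩

theorem Sem.cyc (h : Γ.Sem P root phi L) (x : Fin n) : Γ.cyc P x = L (root x) := by
  ext k
  rw [mem_cyc, h]
  simp

theorem Sem.equivalence (root : Fin n → Fin n) (phi : Fin n → Fin d → ℤ)
    (L : Fin n → Submodule ℤ (Fin d → ℤ)) :
    Equivalence fun p q : Fin n × (Fin d → ℤ) =>
      root p.1 = root q.1 ∧ (q.2 - phi q.1) - (p.2 - phi p.1) ∈ L (root p.1) := by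
  refine ⟨fun p => by simp, fun {p q} h => ⟨h.1.symm, ?_⟩, fun {p q r} h h' => ⟨h.1.trans h'.1, ?_⟩⟩
  · rw [← h.1, ← neg_sub]
    exact Submodule.neg_mem _ h.2
  · have := Submodule.add_mem _ h.2 (h.1 ▸ h'.2)
    convert this using 1
    abel

theorem sem_empty : Γ.Sem ∅ id 0 ⊥ := by
  intro x k y l
  constructor
  · intro h
    exact conn_le (Sem.equivalence id 0 ⊥) (by simp) h
  · rintro ⟨rfl, h⟩
    have : l = k := by simpa [sub_eq_zero] using h
    rw [this]
    exact .refl _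

/-- `R` is generated by `Conn P` and one more family of edges. -/
structure Extends (Γ : ShiftGraph n m d) (P Q : Set (Fin m)) (a b : Fin n) (w : Fin d → ℤ) : Prop where
  mono : P ⊆ Q
  edge : ∀ k, Γ.Conn Q (a, k) (b, k + w)
  le : ∀ S : Fin n × (Fin d → ℤ) → Fin n × (Fin d → ℤ) → Prop, Equivalence S →
    (∀ p q, Γ.Conn P p q → S p q) → (∀ k, S (a, k) (b, k + w)) → ∀ p q, Γ.Conn Q p q → S p q

theorem Extends.insert (e : Fin m) : Extends Γ P (insert e P) (Γ.src e) (Γ.tgt e) (Γ.sh e) where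
  mono := Set.subset_insert _ _
  edge := fun k => Conn.edge (Set.mem_insert _ _) k
  le := fun S hS h h' p q hpq => by
    refine conn_le hS (fun e' he' k => ?_) hpq
    rcases he' with rfl | he'
    · exact h' k
    · exact h _ _ (Conn.edge he' k)

/-- Union by rank may exchange the two roots; the edge is then traversed backwards and its shift
changes sign. This is why `Extends` is kept apart from the insertion of an edge. -/
theorem Extends.symm {a b : Fin n} {w : Fin d → ℤ} (h : Extends Γ P Q a b w) :
    Extends Γ P Q b a (-w) where
  mono := h.mono
  edge := fun k => (h.edge (k - w)).symm.of_shift (by simp)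
  le := fun S hS h1 h2 => h.le S hS h1 fun k => by
    have := hS.symm (h2 (k + w))
    simpa using this

/-- The common part of the two cases of an edge. Soundness: the new description is an equivalence
relation that contains the old connectivity and the new edges. Completeness: in the component of
`a`, every vertex is walked to `a` by its potential (`h4`), and the remaining shift is a closed walk
(`h5`); all other components are as before (`h6`). -/
theorem Sem.of_normal {root' : Fin n → Fin n} {phi' : Fin n → Fin d → ℤ}
    {L' : Fin n → Submodule ℤ (Fin d → ℤ)} {a b : Fin n} {w : Fin d → ℤ}
    (h : Γ.Sem P root phi L) (hE : Extends Γ P Q a b w)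
    (h1 : ∀ x y, root x = root y → root' x = root' y ∧ phi' x - phi x = phi' y - phi y ∧
      L (root x) ≤ L' (root' x))
    (h2 : root' a = root' b) (h3 : w - phi' b + phi' a ∈ L' (root' a))
    (h4 : ∀ x, root' x = root' a → ∀ k, Γ.Conn Q (x, k) (a, k - phi' x + phi' a))
    (h5 : L' (root' a) ≤ Γ.cyc Q a)
    (h6 : ∀ x, root' x ≠ root' a → (∀ y, root' x = root' y → root x = root y) ∧
      L' (root' x) = L (root x)) : Γ.Sem Q root' phi' L' := by
  intro x k y l
  constructor
  · refine hE.le (fun p q => root' p.1 = root' q.1 ∧ (q.2 - phi' q.1) - (p.2 - phi' p.1) ∈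
      L' (root' p.1)) (Sem.equivalence _ _ _) ?_ ?_ _ _
    · rintro ⟨x, k⟩ ⟨y, l⟩ hc
      obtain ⟨g1, g2⟩ := (h _ _ _ _).1 hc
      obtain ⟨e1, e2, e3⟩ := h1 x y g1
      refine ⟨e1, ?_⟩
      convert e3 g2 using 1
      simp only
      have : phi' y = phi y + (phi' x - phi x) := by rw [e2]; abel
      rw [this]
      abel
    · intro k
      refine ⟨h2, ?_⟩
      convert h3 using 1
      simp only
      abel
  · rintro ⟨g1, g2⟩
    by_cases hx : root' x = root' a
    · have n1 := h4 x hx k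
      have n2 := h4 y (g1 ▸ hx) l
      refine n1.trans (Conn.trans ?_ n2.symm)
      rw [← mem_cyc']
      apply h5
      rw [← hx]
      convert g2 using 1
      abel
    · obtain ⟨e1, e2⟩ := h6 x hx
      have hxy := e1 y g1
      refine (hE.mono |> Conn.mono) ((h _ _ _ _).2 ⟨hxy, ?_⟩)
      rw [← e2]
      convert g2 using 1
      have : phi' y = phi y + (phi' x - phi x) := by rw [(h1 x y hxy).2.1]; abel
      rw [this]
      abel

/-- An edge within a component adds a vector to the lattice of the component. -/
theorem Sem.cycle {a b : Fin n} {w : Fin d → ℤ} (h : Γ.Sem P root phi L)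
    (hE : Extends Γ P Q a b w) (hab : root a = root b) :
    Γ.Sem Q root phi (Function.update L (root a)
      (L (root a) ⊔ Submodule.span ℤ {phi a + w - phi b})) := by
  refine h.of_normal hE ?_ hab ?_ ?_ ?_ ?_
  · intro x y hxy
    refine ⟨hxy, by simp, ?_⟩
    by_cases hx : root x = root a
    · rw [hx]; simp
    · rw [Function.update_of_ne hx]
  · simp only [Function.update_self]
    apply Submodule.mem_sup_right
    rw [show w - phi b + phi a = phi a + w - phi b by abel]
    exact Submodule.mem_span_singleton_self _
  · intro x hx k
    refine Conn.mono hE.mono ((h _ _ _ _).2 ⟨hx, ?_⟩)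
    convert Submodule.zero_mem _ using 1
    abel
  · simp only [Function.update_self]
    rw [sup_le_iff, ← h.cyc, Submodule.span_singleton_le_iff_mem]
    refine ⟨cyc_mono hE.mono a, ?_⟩
    rw [mem_cyc]
    refine (hE.edge 0).trans (Conn.mono hE.mono ((h _ _ _ _).2 ⟨hab.symm, ?_⟩))
    convert Submodule.zero_mem _ using 1
    abel
  · intro x hx
    exact ⟨fun y hy => hy, Function.update_of_ne hx _ _⟩

/-- An edge between different components merges the components. -/
theorem Sem.merge {a b : Fin n} {w : Fin d → ℤ} (h : Γ.Sem P root phi L)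
    (hE : Extends Γ P Q a b w) (hab : root a ≠ root b) :
    Γ.Sem Q (fun x => if root x = root b then root a else root x)
      (fun x => if root x = root b then phi x + (phi a + w - phi b) else phi x)
      (Function.update L (root a) (L (root a) ⊔ L (root b))) := by
  -- The potentials on the side of `b` are shifted so that the new edge is consistent with them. It
  -- then creates no cycle, and the lattices are just added.
  have hphib : w - (phi b + (phi a + w - phi b)) + phi a = 0 := by abel
  refine h.of_normal hE ?_ ?_ ?_ ?_ ?_ ?_
  · intro x y hxy
    by_cases hx : root x = root b
    · have hy : root y = root b := hxy ▸ hx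
      refine ⟨by simp [hx, hy], by simp [hx, hy], ?_⟩
      simp [hx]
    · have hy : root y ≠ root b := hxy ▸ hx
      refine ⟨by simp [hy, hxy], by simp [hx, hy], ?_⟩
      by_cases hxa : root x = root a
      · simp [hxa, hab]
      · simp [hx, Function.update_of_ne hxa]
  · simp
  · simp [hab]
  · intro x hx k
    simp only [hab, if_false] at hx ⊢
    by_cases hxb : root x = root b
    · have e1 : Γ.Conn Q (x, k) (b, k - phi x + phi b) := by
        refine Conn.mono hE.mono ((h _ _ _ _).2 ⟨hxb, ?_⟩)
        convert Submodule.zero_mem _ using 1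
        abel
      refine e1.trans ((hE.edge (k - phi x + phi b - w)).of_shift ?_).symm
      simp only [hxb, if_true]
      abel
    · simp only [hxb, if_false] at hx ⊢
      refine Conn.mono hE.mono ((h _ _ _ _).2 ⟨hx, ?_⟩)
      convert Submodule.zero_mem _ using 1
      abel
  · simp only [hab, if_false, Function.update_self]
    rw [sup_le_iff, ← h.cyc, ← h.cyc]
    refine ⟨cyc_mono hE.mono a, ?_⟩
    rw [cyc_eq (hE.edge 0)]
    exact cyc_mono hE.mono b
  · intro x hx
    simp only [hab, if_false] at hx
    have hxb : root x ≠ root b := by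
      intro hxb; simp [hxb] at hx
    simp only [hxb, if_false] at hx ⊢
    refine ⟨fun y hy => ?_, Function.update_of_ne hx _ _⟩
    split_ifs at hy with hyb
    · exact absurd hy hx
    · exact hy

end ShiftGraph

/-! ### Union-find with potentials -/

/-- A forest with parents `par`, ranks `rk` and potential differences `pot`; the roots and the
potentials relative to the roots are `root` and `phi`. -/
structure Forest {n d : ℕ} (par : Fin n → Fin n) (rk : Fin n → ℕ) (pot : Fin n → Fin d → ℤ)
    (root : Fin n → Fin n) (phi : Fin n → Fin d → ℤ) : Prop where
  root_par : ∀ x, root (par x) = root x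
  par_root : ∀ x, par (root x) = root x
  root_of_fix : ∀ x, par x = x → root x = x
  rk_lt : ∀ x, par x ≠ x → rk x < rk (par x)
  rk_root : ∀ x, rk x ≤ rk (root x)
  phi_fix : ∀ x, par x = x → phi x = 0
  phi_par : ∀ x, par x ≠ x → phi x = pot x + phi (par x)

namespace Forest
variable {n d : ℕ} {par : Fin n → Fin n} {rk : Fin n → ℕ} {pot : Fin n → Fin d → ℤ}
    {root : Fin n → Fin n} {phi : Fin n → Fin d → ℤ}

theorem root_root (h : Forest par rk pot root phi) (x : Fin n) : root (root x) = root x :=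
  h.root_of_fix _ (h.par_root x)

theorem discrete : Forest (n := n) (d := d) id 0 0 id 0 where
  root_par := fun _ => rfl
  par_root := fun _ => rfl
  root_of_fix := fun _ _ => rfl
  rk_lt := fun _ h => absurd rfl h
  rk_root := fun _ => le_rfl
  phi_fix := fun _ _ => rfl
  phi_par := fun _ h => absurd rfl h

/-- Ranks increase strictly towards the root, so the rank of a root bounds the height of its tree.
Attaching the root of smaller rank requires an increase of the other rank only in case of a tie. -/
theorem union (h : Forest par rk pot root phi) {a b : Fin n} (ha : par a = a) (hb : par b = b)
    (hab : a ≠ b) (hrk : rk b ≤ rk a) (z : Fin d → ℤ) :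
    Forest (Function.update par b a)
      (Function.update rk a (if rk a ≤ rk b then rk a + 1 else rk a)) (Function.update pot b z)
      (fun x => if root x = b then a else root x) (fun x => if root x = b then phi x + z else phi x) := by
  have ra := h.root_of_fix a ha
  have rb := h.root_of_fix b hb
  have hle : rk a ≤ (if rk a ≤ rk b then rk a + 1 else rk a) := by split_ifs <;> omega
  have hmono : ∀ x, rk x ≤ Function.update rk a (if rk a ≤ rk b then rk a + 1 else rk a) x := by
    intro x
    by_cases hx : x = a
    · subst hx; simpa using hle
    · simp [hx]
  refine ⟨fun x => ?_, fun x => ?_, fun x hx => ?_, fun x hx => ?_, fun x => ?_, fun x hx => ?_,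
    fun x hx => ?_⟩
  · by_cases hxb : x = b
    · subst hxb; simp [ra, rb, hab]
    · simp [hxb, h.root_par]
  · by_cases hxb : root x = b
    · simp [hxb, hab, ha]
    · simp [hxb, h.par_root]
  · have hxb : x ≠ b := by rintro rfl; simp at hx; exact hab hx
    rw [Function.update_of_ne hxb] at hx
    simp [h.root_of_fix x hx, hxb]
  · by_cases hxb : x = b
    · subst hxb
      simp only [Function.update_self, Function.update_of_ne hab.symm]
      split_ifs <;> omega
    · rw [Function.update_of_ne hxb] at hx ⊢
      have hxa : x ≠ a := by rintro rfl; exact hx ha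
      rw [Function.update_of_ne hxa]
      exact (h.rk_lt x hx).trans_le (hmono _)
  · have h1 := h.rk_root x
    by_cases hxa : x = a
    · subst hxa; simp [ra, hab]
    · rw [Function.update_of_ne hxa]
      by_cases hxb : root x = b
      · rw [hxb] at h1
        rw [if_pos hxb]
        exact (h1.trans hrk).trans (hmono a)
      · rw [if_neg hxb]
        exact h1.trans (hmono _)
  · have hxb : x ≠ b := by rintro rfl; simp at hx; exact hab hx
    rw [Function.update_of_ne hxb] at hx
    simp [h.root_of_fix x hx, hxb, h.phi_fix x hx]
  · by_cases hxb : x = b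
    · subst hxb
      simp [rb, ra, hab, h.phi_fix _ hb, h.phi_fix _ ha]
    · rw [Function.update_of_ne hxb] at hx ⊢
      rw [Function.update_of_ne hxb]
      rw [h.root_par, h.phi_par x hx]
      split_ifs
      · abel
      · rfl

end Forest


/-! ### Processing an edge -/

namespace Prog

/-- Replace the vertex `V 22` by its root, and compute its potential in array `25`. -/
def find : Program :=
  .forN 28 D (.setInt 25 (ivar 28) (.lit 0)) ;;
  .loop (.not (.ieq (.get 10 (ivar 22)) (ivar 22)))
    (.forN 28 D (.setInt 25 (ivar 28) (.get 25 (ivar 28) + .get 12 (ivar 22 * D + ivar 28))) ;;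
      .iset 22 (.get 10 (ivar 22)))

/-- Find the roots of the endpoints of the edge `V 21`, and the shift between the roots. -/
def locate : Program :=
  .iset 22 (.get 1 (ivar 21)) ;; find ;; .iset 23 (ivar 22) ;;
  .forN 28 D (.setInt 27 (ivar 28) (.get 3 (ivar 21 * D + ivar 28) + .get 25 (ivar 28))) ;;
  .iset 22 (.get 2 (ivar 21)) ;; find ;; .iset 24 (ivar 22) ;;
  .forN 28 D (.setInt 27 (ivar 28) (.get 27 (ivar 28) - .get 25 (ivar 28)))

/-- Exchange the two roots if the first one has the smaller rank. -/
def swapRoots : Program :=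
  .branch (.ilt (.get 11 (ivar 23)) (.get 11 (ivar 24)))
    (.iset 32 (ivar 23) ;; .iset 23 (ivar 24) ;; .iset 24 (ivar 32) ;;
      .forN 28 D (.setInt 27 (ivar 28) (.lit 0 - .get 27 (ivar 28)))) .skip

/-- Attach the root `V 24` to the root `V 23`. -/
def link : Program :=
  .setInt 10 (ivar 24) (ivar 23) ;;
  .forN 28 D (.setInt 12 (ivar 24 * D + ivar 28) (.get 27 (ivar 28))) ;;
  .branch (.ile (.get 11 (ivar 23)) (.get 11 (ivar 24)))
    (.setInt 11 (ivar 23) (.get 11 (ivar 23) + .lit 1)) .skip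

/-- Add the lattice `V 24` to the lattice `V 23`. -/
def sumLat : Program :=
  .forN 30 D (.forN 28 D (.setInt 27 (ivar 28)
    (.get 13 ((ivar 24 * D + (D - .lit 1 - ivar 30)) * D + ivar 28))) ;; insertVec)

/-- The younger of the two beams ends at the edge `V 21`. -/
def mergeBeams : Program :=
  .branch (.rle (.get 0 (.get 14 (ivar 23))) (.get 0 (.get 14 (ivar 24))))
    (.iset 36 (.get 14 (ivar 24)) ;; .iset 37 (.get 14 (ivar 23)))
    (.iset 36 (.get 14 (ivar 23)) ;; .iset 37 (.get 14 (ivar 24))) ;;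
  .setInt 4 (ivar 36) (ivar 37) ;; .setReal 4 (ivar 36) (.get 1 (ivar 21)) ;;
  .setInt 14 (ivar 23) (ivar 37)

end Prog
open Prog

/-- A loop that sets the entries of a vector in an integer array. -/
theorem vecLoop_spec {d a : ℕ} {x : IExp} {s : Store} (g : Fin d → ℤ) (hd : s.int 0 0 = d)
    (ha : a ≠ 28) (ha0 : a ≠ 0) (hx : ∀ s', Frame (.forN 28 D (.setInt a (ivar 28) x)) s s' →
      ∀ i : Fin d, s'.int 28 0 = (i : ℕ) → s'.int a (i : ℕ) = s.int a (i : ℕ) → x.eval s' = g i) :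
    WP (.forN 28 D (.setInt a (ivar 28) x)) (d * (x.cost + 20) + 20) (fun s' => s'.vec a d = g) s := by
  apply WP.time
  · refine WP.forN (fun i s' => ∀ c : Fin d, s'.int a (c : ℕ) =
      if (c : ℕ) < i then g c else s.int a (c : ℕ)) d (x.cost + 3) ?_ ?_ ?_ ?_ ?_
    · simp [ha]
    · simp [Program.wI, ha.symm]
    · intro s' hf
      have := hf.int 0 (by simp [Program.forN, Program.wI, ha0.symm])
      simp [this, hd]
    · intro i hi s' hf hi' h
      have hc := h ⟨i, hi⟩
      simp only [lt_irrefl, if_false] at hc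
      have he := hx s' hf ⟨i, hi⟩ hi' hc
      refine WP.time (.setInt ?_) (by simp; omega)
      intro c
      rw [Store.setInt_int_ne _ ha, he]
      simp only [IExp.eval_get, IExp.eval_lit, hi', Store.setInt_int_same, Nat.cast_inj]
      by_cases hci : (c : ℕ) = i
      · have : c = ⟨i, hi⟩ := Fin.ext hci
        subst this
        simp
      · rw [if_neg hci, h c]
        have : (c : ℕ) < i + 1 ↔ (c : ℕ) < i := by omega
        simp [this]
    · intro s' hf h
      funext c
      have := h c
      rwa [if_pos c.2] at this
  · simp
    have : d * (x.cost + 3 + 2 + 12) ≤ d * (x.cost + 20) := Nat.mul_le_mul_left _ (by omega)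
    omega

/-! ### Finding roots and potentials. -/

section find
variable {n m d : ℕ} {par : Fin n → Fin n} {rk : Fin n → ℕ} {pot : Fin n → Fin d → ℤ}
    {root : Fin n → Fin n} {phi : Fin n → Fin d → ℤ}

/-- There is no path compression. The potential is the sum of the potential differences along the
path to the root, and the length of the path is at most the rank of the root. -/
theorem find_spec {ℓ : ℕ} {s : Store} (hF : Forest par rk pot root phi) (hd : s.int 0 0 = d)
    (hpar : ∀ x : Fin n, s.int 10 (x : ℕ) = (par x : ℕ))
    (hpot : ∀ (x : Fin n) k, s.int 12 (vecIdx d x k) = pot x k) (hrk : ∀ x, rk (root x) ≤ ℓ)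
    {x₀ : Fin n} (hx : s.int 22 0 = (x₀ : ℕ)) (hpos : 0 < d) :
    WP find (150 * d * (ℓ + 1)) (fun s' => s'.int 22 0 = (root x₀ : ℕ) ∧ s'.vec 25 d = phi x₀) s := by
  apply WP.time
  · apply WP.seq' (vecLoop_spec (d := d) 0 hd (by decide) (by decide) (by simp))
    intro s₁ hf₁ h₁
    -- The variant is an upper bound for the rank still to be gained on the way to the root.
    refine WP.loop (fun v s' => ∃ x : Fin n, s'.int 22 0 = (x : ℕ) ∧ root x = root x₀ ∧
      s'.vec 25 d + phi x = phi x₀ ∧ rk (root x₀) ≤ v + rk x) (rk (root x₀)) (40 * d + 40) ?_ ?_ ?_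
    · refine ⟨x₀, ?_, rfl, ?_, by omega⟩
      · rw [hf₁.int 22 rfl, hx]
      · rw [h₁, zero_add]
    · rintro v s' hf ⟨x, g1, g2, g3, g4⟩ hc
      have hd' : s'.int 0 0 = d := by rw [hf.int 0 rfl, hf₁.int 0 rfl, hd]
      have hpar' : s'.int 10 (x : ℕ) = (par x : ℕ) := by rw [hf.int 10 rfl, hf₁.int 10 rfl, hpar]
      have hpot' : ∀ k, s'.int 12 (vecIdx d x k) = pot x k := by
        intro k; rw [hf.int 12 rfl, hf₁.int 12 rfl, hpot]
      have hne : par x ≠ x := by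
        intro h
        apply hc
        simp [g1, hpar', h]
      have hr1 := hF.rk_lt x hne
      have hr2 := hF.rk_root (par x)
      rw [hF.root_par, g2] at hr2
      refine ⟨v - 1, by omega, ?_⟩
      apply WP.time
      · refine WP.seq' (T' := 10) (vecLoop_spec (d := d) (s'.vec 25 d + pot x) hd' (by decide)
          (by decide) ?_) ?_
        · intro s'' hf'' i hi h25
          have e1 := hpot' i
          simp only [vecIdx] at e1
          simp [hf''.int 0 rfl, hf''.int 12 rfl, hf''.int 22 rfl, hi, h25, g1, hd', e1, Store.vec]
        · intro s'' hf'' h''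
          refine WP.time (.setInt ⟨par x, ?_, ?_, ?_, by omega⟩) (by simp)
          · simp [hf''.int 10 rfl, hf''.int 22 rfl, g1, hpar']
          · rw [hF.root_par, g2]
          · have : ∀ y, (s''.setInt 22 0 y).vec 25 d = s''.vec 25 d := by
              intro y; funext c; simp [Store.vec]
            simp only [IExp.eval_lit] at this ⊢
            rw [this, h'', ← g3, hF.phi_par x hne, add_assoc]
      · simp; omega
    · rintro v s' hf ⟨x, g1, g2, g3, g4⟩ hc
      have hpar' : s'.int 10 (x : ℕ) = (par x : ℕ) := by rw [hf.int 10 rfl, hf₁.int 10 rfl, hpar]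
      have he : par x = x := by
        simp only [BExp.eval_not, BExp.eval_and, BExp.eval_ile, IExp.eval_get, IExp.eval_lit, g1,
          hpar', not_not] at hc
        apply Fin.ext
        omega
      rw [hF.root_of_fix x he] at g2
      rw [hF.phi_fix x he, add_zero] at g3
      exact ⟨by rw [g1, g2], g3⟩
  · have := hrk x₀
    simp
    nlinarith [Nat.mul_le_mul this hpos, Nat.mul_le_mul_right (40 * d) this]

/-- The vector that an edge adds to the lattice of a component. -/
def loopVec (Γ : ShiftGraph n m d) (phi : Fin n → Fin d → ℤ) (e : Fin m) : Fin d → ℤ :=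
  phi (Γ.src e) + Γ.sh e - phi (Γ.tgt e)

theorem locate_spec {ℓ : ℕ} {s : Store} {Γ : ShiftGraph n m d}
    (hF : Forest par rk pot root phi) (hd : s.int 0 0 = d)
    (hpar : ∀ x : Fin n, s.int 10 (x : ℕ) = (par x : ℕ))
    (hpot : ∀ (x : Fin n) k, s.int 12 (vecIdx d x k) = pot x k) (hrk : ∀ x, rk (root x) ≤ ℓ)
    (hsrc : ∀ e : Fin m, s.int 1 (e : ℕ) = (Γ.src e : ℕ))
    (htgt : ∀ e : Fin m, s.int 2 (e : ℕ) = (Γ.tgt e : ℕ))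
    (hsh : ∀ (e : Fin m) k, s.int 3 (vecIdx d e k) = Γ.sh e k)
    {e : Fin m} (he : s.int 21 0 = (e : ℕ)) (hpos : 0 < d) :
    WP locate (500 * d * (ℓ + 1)) (fun s' => s'.int 23 0 = (root (Γ.src e) : ℕ) ∧
      s'.int 24 0 = (root (Γ.tgt e) : ℕ) ∧ s'.vec 27 d = loopVec Γ phi e) s := by
  have hset : ∀ (s' : Store) (a b : ℕ) (x : ℤ), a ≠ b → (s'.setInt b 0 x).vec a d = s'.vec a d := by
    intro s' a b x h; funext c; simp [Store.vec, h]
  apply WP.time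
  · apply WP.seq
    apply WP.setInt
    simp only [IExp.eval_lit, IExp.eval_get, he, hsrc]
    set s₁ := s.setInt 22 0 (Γ.src e : ℕ) with hs₁
    apply WP.seq' (find_spec (s := s₁) (x₀ := Γ.src e) hF (by simp [hs₁, hd]) (by simpa [hs₁] using hpar)
      (by simpa [hs₁] using hpot) hrk (by simp [hs₁]) hpos)
    rintro s₂ hf₂ ⟨a1, a2⟩
    have I : ∀ a, a ≠ 22 → find.wI a = false → s₂.int a = s.int a := by
      intro a h h'; rw [hf₂.int a h']; simp [hs₁, h]
    apply WP.seq
    apply WP.setInt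
    simp only [IExp.eval_lit, IExp.eval_get, a1]
    apply WP.seq' (vecLoop_spec (d := d) (Γ.sh e + phi (Γ.src e)) (by simp [I 0 (by decide) rfl, hd])
      (by decide) (by decide) ?_)
    rotate_left 2
    · intro s' hf i hi h27
      have e1 := hsh e i
      simp only [vecIdx] at e1
      have e2 : s₂.int 25 (i : ℕ) = phi (Γ.src e) i := by rw [← a2]; rfl
      simp [hf.int 0 rfl, hf.int 3 rfl, hf.int 21 rfl, hf.int 25 rfl, hi, I 0 (by decide) rfl,
        I 3 (by decide) rfl, I 21 (by decide) rfl, he, hd, e1, e2]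
    intro s₃ hf₃ b1
    have J : ∀ a, a ≠ 22 → find.wI a = false → a ≠ 23 → a ≠ 28 → a ≠ 27 → s₃.int a = s.int a := by
      intro a h h' h1 h2 h3
      rw [hf₃.int a (by simp [Program.forN, Program.wI, h2, h3])]
      simp [h1, I a h h']
    apply WP.seq
    apply WP.setInt
    simp only [IExp.eval_lit, IExp.eval_get, J 21 (by decide) rfl (by decide) (by decide) (by decide),
      J 2 (by decide) rfl (by decide) (by decide) (by decide), he, htgt]
    set s₄ := s₃.setInt 22 0 (Γ.tgt e : ℕ) with hs₄
    apply WP.seq' (find_spec (s := s₄) (x₀ := Γ.tgt e) hF ?_ ?_ ?_ hrk (by simp [hs₄]) hpos)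
    rotate_left 2
    · simp [hs₄, J 0 (by decide) rfl (by decide) (by decide) (by decide), hd]
    · simpa [hs₄, J 10 (by decide) rfl (by decide) (by decide) (by decide)] using hpar
    · simpa [hs₄, J 12 (by decide) rfl (by decide) (by decide) (by decide)] using hpot
    rintro s₅ hf₅ ⟨c1, c2⟩
    have K : ∀ a, a ≠ 22 → find.wI a = false → s₅.int a = s₃.int a := by
      intro a h h'; rw [hf₅.int a h']; simp [hs₄, h]
    apply WP.seq
    apply WP.setInt
    simp only [IExp.eval_lit, IExp.eval_get, c1]
    refine (vecLoop_spec (d := d) (loopVec Γ phi e) ?_ (by decide) (by decide) ?_).mono le_rfl ?_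
    · simp [K 0 (by decide) rfl, J 0 (by decide) rfl (by decide) (by decide) (by decide), hd]
    · intro s' hf i hi h27
      have e2 : s₅.int 25 (i : ℕ) = phi (Γ.tgt e) i := by rw [← c2]; rfl
      have e3 : s₃.int 27 (i : ℕ) = (Γ.sh e + phi (Γ.src e)) i := by rw [← b1]; rfl
      simp [hf.int 25 rfl, hi, h27, e2, K 27 (by decide) rfl, e3, loopVec, add_comm]
    · intro s₆ hf₆ h₆
      refine ⟨?_, ?_, h₆⟩
      · rw [hf₆.int 23 rfl]
        simp only [ne_eq, Nat.reduceEqDiff, not_false_eq_true, Store.setInt_int_ne]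
        rw [K 23 (by decide) rfl, hf₃.int 23 rfl]
        simp
      · rw [hf₆.int 24 rfl]
        simp
  · simp
    nlinarith [Nat.zero_le (d * ℓ)]

end find

theorem swapRoots_spec {d : ℕ} {s : Store} {ra rb : ℤ} {w : Fin d → ℤ} (hd : s.int 0 0 = d)
    (ha : s.int 23 0 = ra) (hb : s.int 24 0 = rb) (hw : s.vec 27 d = w) :
    WP swapRoots (50 * d + 50) (fun s' =>
      (s'.int 23 0 = ra ∧ s'.int 24 0 = rb ∧ s'.vec 27 d = w ∧ s.int 11 rb ≤ s.int 11 ra) ∨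
      (s'.int 23 0 = rb ∧ s'.int 24 0 = ra ∧ s'.vec 27 d = -w ∧ s.int 11 ra ≤ s.int 11 rb)) s := by
  apply WP.time
  · refine WP.branch (T := 40 * d + 32) (fun hlt => ?_) fun h => WP.skip (.inl ⟨ha, hb, hw, ?_⟩)
    · apply WP.time
      · apply WP.seq
        apply WP.setInt
        apply WP.seq
        apply WP.setInt
        apply WP.seq
        apply WP.setInt
        refine (vecLoop_spec (d := d) (-w) ?_ (by decide) (by decide) ?_).mono le_rfl ?_
        · simp [hd]
        · intro s' hf i hi h27
          have : s.int 27 (i : ℕ) = w i := by rw [← hw]; rfl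
          simp [hi, h27, this]
        · intro s' hf h
          right
          refine ⟨?_, ?_, h, ?_⟩
          · rw [hf.int 23 rfl]; simp [hb]
          · rw [hf.int 24 rfl]; simp [ha]
          · simp only [BExp.eval_not, BExp.eval_ile, IExp.eval_get, IExp.eval_lit, ha, hb] at hlt
            omega
      · simp; omega
    · simpa [ha, hb] using h
  · simp; omega

theorem link_spec {n d : ℕ} {s : Store} {a b : Fin n} {par : Fin n → Fin n} {rk : Fin n → ℕ}
    {pot : Fin n → Fin d → ℤ} {w : Fin d → ℤ} (hd : s.int 0 0 = d)
    (ha : s.int 23 0 = (a : ℕ)) (hb : s.int 24 0 = (b : ℕ)) (hw : s.vec 27 d = w)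
    (hpar : ∀ x : Fin n, s.int 10 (x : ℕ) = (par x : ℕ)) (hrk : ∀ x : Fin n, s.int 11 (x : ℕ) = rk x)
    (hpot : ∀ (x : Fin n) k, s.int 12 (vecIdx d x k) = pot x k) :
    WP link (60 * d + 60) (fun s' =>
      (∀ x : Fin n, s'.int 10 (x : ℕ) = (Function.update par b a x : ℕ)) ∧
      (∀ x : Fin n, s'.int 11 (x : ℕ) =
        (Function.update rk a (if rk a ≤ rk b then rk a + 1 else rk a) x : ℕ)) ∧
      (∀ (x : Fin n) k, s'.int 12 (vecIdx d x k) = Function.update pot b w x k)) s := by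
  apply WP.time
  · apply WP.seq
    apply WP.setInt
    simp only [IExp.eval_lit, IExp.eval_get, ha, hb]
    refine WP.seq' (T' := 30) (P := fun s' => ∀ (x : Fin n) k, s'.int 12 (vecIdx d x k) =
      Function.update pot b w x k) (WP.forN (fun i s' => ∀ (x : Fin n) (k : Fin d),
        s'.int 12 (vecIdx d x k) = if x = b ∧ (k : ℕ) < i then w k else pot x k) d 25
          ?_ rfl ?_ ?_ ?_) ?_
    · simpa using hpot
    · intro s' hf
      simp [hf.int 0 rfl, hd]
    · intro i hi s' hf hi' h
      refine WP.time (.setInt ?_) (by simp)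
      have e1 : s.int 27 (i : ℕ) = w ⟨i, hi⟩ := by rw [← hw]; rfl
      have hm : ((b : ℕ) : ℤ) * d + (i : ℕ) = vecIdx d b ⟨i, hi⟩ := rfl
      intro x k
      simp only [ne_eq, Nat.reduceEqDiff, not_false_eq_true, Store.setInt_int_ne, IExp.eval_hadd,
        IExp.eval_hmul, IExp.eval_get, IExp.eval_lit, hf.int 24 rfl, hf.int 0 rfl, hf.int 27 rfl, hb,
        hd, hi', hm, Store.setInt_int_same, vecIdx_inj, e1, OfNat.zero_ne_ofNat, h x k]
      by_cases hc : x = b ∧ k = ⟨i, hi⟩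
      · obtain ⟨rfl, rfl⟩ := hc
        simp
      · have hc' : ¬ ((x : ℕ) = b ∧ k = ⟨i, hi⟩) := fun h => hc ⟨Fin.ext h.1, h.2⟩
        rw [if_neg hc']
        congr 1
        by_cases hl : x = b
        · have : (k : ℕ) ≠ i := fun h => hc ⟨hl, Fin.ext h⟩
          simp only [hl, true_and, eq_iff_iff]
          omega
        · simp [hl]
    · intro s' hf h x k
      rw [h x k]
      by_cases hx : x = b
      · subst hx; simp
      · simp [hx]
    · intro s₁ hf₁ h₁
      have h10 : ∀ x : Fin n, s₁.int 10 (x : ℕ) = (Function.update par b a x : ℕ) := by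
        intro x
        rw [hf₁.int 10 rfl]
        simp only [Store.setInt_int_same, Nat.cast_inj]
        by_cases hx : x = b
        · subst hx; simp
        · have : (x : ℕ) ≠ b := fun h => hx (Fin.ext h)
          simp [hx, this, hpar]
      have h11 : ∀ x : Fin n, s₁.int 11 (x : ℕ) = rk x := by
        intro x
        rw [hf₁.int 11 rfl]
        simp [hrk]
      have e23 : s₁.int 23 0 = (a : ℕ) := by rw [hf₁.int 23 rfl]; simp [ha]
      have e24 : s₁.int 24 0 = (b : ℕ) := by rw [hf₁.int 24 rfl]; simp [hb]
      apply WP.time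
      · apply WP.branch
        · intro hc
          simp only [BExp.eval_ile, IExp.eval_get, IExp.eval_lit, e23, e24, h11, Nat.cast_le] at hc
          apply WP.setInt
          refine ⟨by simpa using h10, fun x => ?_, by simpa using h₁⟩
          simp only [IExp.eval_get, IExp.eval_lit, IExp.eval_hadd, e23, h11, Store.setInt_int_same,
            Nat.cast_inj, hc, if_true]
          by_cases hx : x = a
          · subst hx; simp
          · have : (x : ℕ) ≠ a := fun h => hx (Fin.ext h)
            simp [hx, this]
        · intro hc
          simp only [BExp.eval_ile, IExp.eval_get, IExp.eval_lit, e23, e24, h11, Nat.cast_le] at hc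
          apply WP.skip
          refine ⟨h10, fun x => ?_, h₁⟩
          rw [h11, if_neg hc, Function.update_eq_self]
      · simp
  · simp; omega

/-! ### Adding one lattice to another. -/

/-- The lattice spanned by the rows from row `r` on. -/
def tailSpan {d : ℕ} (M : Fin d → Fin d → ℤ) (r : ℕ) : Submodule ℤ (Fin d → ℤ) :=
  Submodule.span ℤ (M '' {l | r ≤ (l : ℕ)})

theorem tailSpan_zero {d : ℕ} (M : Fin d → Fin d → ℤ) : tailSpan M 0 = rowSpan M := by
  simp [tailSpan, rowSpan]

theorem tailSpan_self {d : ℕ} (M : Fin d → Fin d → ℤ) : tailSpan M d = ⊥ := by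
  have : {l : Fin d | d ≤ (l : ℕ)} = ∅ := by
    ext l; simp
  rw [tailSpan, this, Set.image_empty, Submodule.span_empty]

theorem tailSpan_eq {d : ℕ} (M : Fin d → Fin d → ℤ) (r : Fin d) :
    tailSpan M r = tailSpan M (r + 1) ⊔ Submodule.span ℤ {M r} := by
  have : {l : Fin d | (r : ℕ) ≤ (l : ℕ)} = insert r {l : Fin d | (r : ℕ) + 1 ≤ (l : ℕ)} := by
    ext l
    simp only [Set.mem_ofPred_eq, Set.mem_insert_iff, Fin.ext_iff]
    omega
  rw [tailSpan, this, Set.image_insert_eq, Submodule.span_insert, sup_comm, tailSpan]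

/-- The rows of the second matrix are inserted from the last to the first, so every intermediate
lattice is the first lattice plus a `tailSpan`, whose generators can be controlled. The hypothesis
on pivots quantifies over all triangular bases of these lattices, since the basis that the program
produces is not canonical. -/
theorem sumLat_spec {d a b ℓ : ℕ} {s : Store} (hd : s.int 0 0 = d) (ha : s.int 23 0 = a)
    (hb : s.int 24 0 = b) (hab : a ≠ b) (htri : IsTri (s.mat d a)) (hpos : 0 < d)
    (hl : ∀ r ≤ d, ∀ M : Fin d → Fin d → ℤ, IsTri M →
      rowSpan M = rowSpan (s.mat d a) ⊔ tailSpan (s.mat d b) r → ∀ k, |M k k| < 2 ^ ℓ) :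
    WP sumLat (500 * d * d * d * (ℓ + 1)) (fun s' => IsTri (s'.mat d a) ∧
      rowSpan (s'.mat d a) = rowSpan (s.mat d a) ⊔ rowSpan (s.mat d b) ∧
      ∀ S ≠ a, s'.mat d S = s.mat d S) s := by
  have hmat : ∀ (s' : Store) (x : ℤ) S, (s'.setInt 30 0 x).mat d S = s'.mat d S := by
    intro s' x S
    funext k c
    simp [Store.mat]
  apply WP.time
  · refine WP.forN (fun i s' => IsTri (s'.mat d a) ∧
      rowSpan (s'.mat d a) = rowSpan (s.mat d a) ⊔ tailSpan (s.mat d b) (d - i) ∧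
      ∀ S ≠ a, s'.mat d S = s.mat d S) d (470 * d * d * (ℓ + 1)) ?_ rfl ?_ ?_ ?_
    · simp only [hmat]
      refine ⟨htri, ?_, fun _ _ => trivial⟩
      rw [Nat.sub_zero, tailSpan_self, sup_bot_eq]
    · intro s' hf
      simp [hf.int 0 rfl, hd]
    · rintro i hi s' hf hi' ⟨h1, h2, h3⟩
      have hd' : s'.int 0 0 = d := by rw [hf.int 0 rfl, hd]
      have ha' : s'.int 23 0 = a := by rw [hf.int 23 rfl, ha]
      have hb' : s'.int 24 0 = b := by rw [hf.int 24 rfl, hb]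
      set r : Fin d := ⟨d - 1 - i, by omega⟩ with hr
      apply WP.time
      · apply WP.seq' (vecLoop_spec (d := d) (s.mat d b r) hd' (by decide) (by decide) ?_)
        rotate_left 2
        · intro s'' hf'' c hc h27
          have e1 : (d : ℤ) - 1 - i = (r : ℕ) := by simp only [hr]; omega
          rw [← h3 b hab.symm]
          simp only [IExp.eval_get, IExp.eval_lit, IExp.eval_hadd, IExp.eval_hmul, IExp.eval_hsub,
            hf''.int 24 rfl, hf''.int 0 rfl, hf''.int 30 rfl, hf''.int 13 rfl, hb', hd', hi', hc, e1]
          rfl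
        · intro s'' hf'' h''
          have hm : ∀ S, s''.mat d S = s'.mat d S := by
            intro S; funext k c; simp only [Store.mat, hf''.int 13 rfl]
          refine (insertVec_spec (d := d) (R := a) (ℓ := ℓ) ?_ ?_ ?_ ?_ hpos).mono le_rfl ?_
          · rw [hf''.int 0 rfl, hd']
          · rw [hf''.int 23 rfl, ha']
          · rw [hm]; exact h1
          · rw [hm]
            exact hl (d - i) (by omega) _ h1 h2
          · rintro s₃ - ⟨g1, g2, g3⟩
            simp only [hmat]
            refine ⟨g1, ?_, fun S hS => by rw [g3 S hS, hm, h3 S hS]⟩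
            rw [g2, hm, h2, h'', sup_assoc]
            congr 1
            have e1 : d - (i + 1) = (r : ℕ) := by simp only [hr]; omega
            have e2 : d - i = (r : ℕ) + 1 := by simp only [hr]; omega
            rw [e1, e2, tailSpan_eq]
      · simp
        nlinarith [Nat.mul_le_mul hpos hpos, Nat.zero_le (d * d * ℓ)]
    · rintro s' hf ⟨h1, h2, h3⟩
      rw [Nat.sub_self, tailSpan_zero] at h2
      exact ⟨h1, h2, h3⟩
  · simp
    nlinarith [Nat.mul_le_mul hpos hpos, Nat.mul_le_mul (Nat.mul_le_mul hpos hpos) hpos,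
      Nat.zero_le (d * d * ℓ), Nat.zero_le (d * d * d * ℓ)]


/-! ### The decomposition into beams -/

/-- The beam has not ended at height `t`. -/
def BeamTree.AliveAt {n : ℕ} (T : BeamTree n) (i : Fin n) (t : ℝ) : Prop :=
  ∀ j h, T.ending i = some (j, h) → t < h

section
variable {n m d : ℕ} (Γ : ShiftGraph n m d) (vb : Fin n → ℝ) (ev : Fin m → ℝ)
  (μ : Submodule ℤ (Fin d → ℤ) → Monomial)

/-- The edges with value at most `t`. -/
def lowEdges (ev : Fin m → ℝ) (t : ℝ) : Set (Fin m) := {e | ev e ≤ t}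

/-- At height `t`, the beams represent the components of the sublevel set. -/
structure GoodAt (T : BeamTree n) (t : ℝ) : Prop where
  ex : ∀ i, vb i ≤ t → ∃ k, Γ.QConn (lowEdges ev t) i k ∧ vb k ≤ t ∧ T.AliveAt k t
  uniq : ∀ k k', T.AliveAt k t → T.AliveAt k' t → Γ.QConn (lowEdges ev t) k k' → k = k'
  mono : ∀ k, vb k ≤ t → T.AliveAt k t → T.HasMonomial k t (μ (Γ.cyc (lowEdges ev t) k))

/-- `T'` arises from `T` by adding ends of beams and epochs at height `x`. -/
structure Appends (T T' : BeamTree n) (x : ℝ) : Prop where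
  ending : ∀ i, T'.ending i = T.ending i ∨ (T.ending i = none ∧ ∃ j, T'.ending i = some (j, x))
  epochs : ∀ i, T.epochs i ≤ T'.epochs i
  old : ∀ i, ∀ k < T.epochs i, T'.start i k = T.start i k ∧ T'.mono i k = T.mono i k
  new : ∀ i k, T.epochs i ≤ k → k < T'.epochs i → T'.start i k = x

variable {Γ vb ev μ}

theorem Appends.aliveAt {T T' : BeamTree n} {x t : ℝ} (h : Appends T T' x) (ht : t < x) (i : Fin n) :
    T'.AliveAt i t ↔ T.AliveAt i t := by
  unfold BeamTree.AliveAt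
  rcases h.ending i with h' | ⟨h1, j, h2⟩
  · rw [h']
  · simp [h1, h2, ht]

/-- Below height `x`, ends and epochs placed at `x` are invisible. What is right at lower heights
stays right. -/
theorem GoodAt.append {T T' : BeamTree n} {x t : ℝ} (h : Appends T T' x) (ht : t < x)
    (hg : GoodAt Γ vb ev μ T t) : GoodAt Γ vb ev μ T' t := by
  refine ⟨fun i hi => ?_, fun k k' hk hk' => ?_, fun k hk hk' => ?_⟩
  · obtain ⟨k, h1, h2, h3⟩ := hg.ex i hi
    exact ⟨k, h1, h2, (h.aliveAt ht k).2 h3⟩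
  · exact hg.uniq k k' ((h.aliveAt ht k).1 hk) ((h.aliveAt ht k').1 hk')
  · obtain ⟨l, h1, h2, h3, h4⟩ := hg.mono k hk ((h.aliveAt ht k).1 hk')
    refine ⟨l, h1.trans_le (h.epochs k), ?_, fun l' hl hl' => ?_, ?_⟩
    · rw [(h.old k l h1).1]; exact h2
    · by_cases hl2 : l' < T.epochs k
      · rw [(h.old k l' hl2).1]; exact h3 l' hl hl2
      · rw [h.new k l' (not_lt.1 hl2) hl']; exact ht
    · rw [(h.old k l h1).2]; exact h4

variable (Γ vb ev μ)

/-- The elder rule, for the edges that have been processed. -/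
structure CurInv (P : Set (Fin m)) (N : ℕ) (T : BeamTree n) (root el : Fin n → Fin n)
    (dt : Fin n → ℕ) : Prop where
  el_alive : ∀ x, T.ending (el (root x)) = none
  el_root : ∀ x, root (el (root x)) = root x
  el_birth : ∀ x, vb (el (root x)) ≤ vb x
  alive_el : ∀ i, T.ending i = none → el (root i) = i
  dead : ∀ i j h, T.ending i = some (j, h) → vb j ≤ vb i ∧ vb i ≤ h ∧
    Γ.QConn (lowEdges ev h) i j ∧ (∃ e ∈ P, h = ev e) ∧ dt i < N ∧
    (T.ending j = none ∨ dt i < dt j) ∧ ∀ j' h', T.ending j = some (j', h') → h ≤ h'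

/-- The epochs, for the edges that have been processed. -/
structure EpochInv (P : Set (Fin m)) (N : ℕ) (T : BeamTree n) (root : Fin n → Fin n)
    (L : Fin n → Submodule ℤ (Fin d → ℤ)) : Prop where
  pos : ∀ i, 0 < T.epochs i
  le : ∀ i, T.epochs i ≤ N + 1
  start_zero : ∀ i, T.start i 0 = vb i
  start_mono : ∀ i k l, k ≤ l → l < T.epochs i → T.start i k ≤ T.start i l
  start : ∀ i, ∀ k < T.epochs i, T.start i k = vb i ∨ ∃ e ∈ P, T.start i k = ev e
  last : ∀ i, T.ending i = none → T.mono i (T.epochs i - 1) = μ (L (root i))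

variable {Γ vb ev μ} {P : Set (Fin m)} {N : ℕ} {T T' : BeamTree n} {root el : Fin n → Fin n}
  {dt : Fin n → ℕ} {phi : Fin n → Fin d → ℤ} {L L' : Fin n → Submodule ℤ (Fin d → ℤ)}

/-- If the processed edges are exactly those of value at most `t`, then every beam that has an end
has it at height at most `t`. Alive at `t` then means not ended so far, and the current state
describes height `t`. -/
theorem goodAt_of_cur (hS : Γ.Sem P root phi L) (hC : CurInv Γ vb ev P N T root el dt)
    (hE : EpochInv vb ev μ P N T root L) {t : ℝ} (ht : lowEdges ev t = P) :
    GoodAt Γ vb ev μ T t := by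
  have halive : ∀ i, T.AliveAt i t ↔ T.ending i = none := by
    intro i
    refine ⟨fun h => ?_, fun h j x hx => by simp [h] at hx⟩
    rcases hi : T.ending i with _ | ⟨j, x⟩
    · rfl
    · obtain ⟨e, he, rfl⟩ := (hC.dead i j x hi).2.2.2.1
      have := h j _ hi
      rw [← ht] at he
      exact absurd he (not_le.2 this)
  rw [← ht] at hS
  refine ⟨fun i hi => ⟨el (root i), ?_, ?_, ?_⟩, fun k k' hk hk' hq => ?_, fun k hk hk' => ?_⟩
  · rw [hS.qconn, hC.el_root]
  · exact (hC.el_birth i).trans hi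
  · exact (halive _).2 (hC.el_alive i)
  · rw [hS.qconn] at hq
    rw [← hC.alive_el k ((halive _).1 hk), ← hC.alive_el k' ((halive _).1 hk'), hq]
  · have hp := hE.pos k
    refine ⟨T.epochs k - 1, by omega, ?_, fun l hl hl' => by omega, ?_⟩
    · rcases hE.start k (T.epochs k - 1) (by omega) with h | ⟨e, he, h⟩
      · rw [h]; exact hk
      · rw [h]
        rw [← ht] at he
        exact he
    · rw [hS.cyc]
      exact hE.last k ((halive _).1 hk')

/-- The history of the beams stays correct when an edge is processed. -/
theorem hist_step {e : Fin m} (hS : Γ.Sem P root phi L) (hC : CurInv Γ vb ev P N T root el dt)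
    (hE : EpochInv vb ev μ P N T root L) (hsort : ∀ p ∈ P, ev p ≤ ev e)
    (hH : ∀ t, lowEdges ev t ⊆ P → (∃ e ∈ P, t < ev e) → GoodAt Γ vb ev μ T t)
    (hA : Appends T T' (ev e)) :
    ∀ t, lowEdges ev t ⊆ insert e P → (∃ p ∈ insert e P, t < ev p) → GoodAt Γ vb ev μ T' t := by
  intro t ht ⟨p, hp, hpt⟩
  have hte : t < ev e := by
    rcases hp with rfl | hp
    · exact hpt
    · exact hpt.trans_le (hsort p hp)
  have hle : lowEdges ev t ⊆ P := by
    intro q hq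
    rcases ht hq with rfl | h
    · exact absurd hq (not_le.2 hte)
    · exact h
  refine GoodAt.append hA hte ?_
  -- Either height `t` was settled before, or no processed edge lies above `t`; then the processed
  -- edges are precisely the sublevel set, and the state before this edge is the one valid at `t`.
  by_cases h : ∃ q ∈ P, t < ev q
  · exact hH t hle h
  · push Not at h
    exact goodAt_of_cur hS hC hE (Set.Subset.antisymm hle h)

/-- Every edge appends an epoch to the surviving beam, whether or not the monomial changes. Edges of
equal value produce epochs of length zero. Therefore starts are only weakly increasing, and the last
epoch that has started counts. -/
theorem EpochInv.step {e : Fin m} {root' : Fin n → Fin n} {surv : Fin n}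
    (hE : EpochInv vb ev μ P N T root L)
    (hsort : ∀ p ∈ P, ev p ≤ ev e) (hA : Appends T T' (ev e)) (hb : vb surv ≤ ev e)
    (hep : T'.epochs = Function.update T.epochs surv (T.epochs surv + 1))
    (hmono : T'.mono surv (T.epochs surv) = μ (L' (root' surv)))
    (hL : ∀ i, T'.ending i = none → i ≠ surv → L' (root' i) = L (root i)) :
    EpochInv vb ev μ (insert e P) (N + 1) T' root' L' := by
  have hlast : ∀ i k, T.epochs i ≤ k → k < T'.epochs i → i = surv := by
    intro i k h1 h2
    by_contra h
    rw [hep, Function.update_of_ne h] at h2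
    omega
  refine ⟨fun i => (hE.pos i).trans_le (hA.epochs i), fun i => ?_, fun i => ?_, fun i k l hkl hl => ?_,
    fun i k hk => ?_, fun i hi => ?_⟩
  · have := hE.le i
    rw [hep]
    by_cases h : i = surv
    · subst h; simp; omega
    · simp [h]; omega
  · rw [(hA.old i 0 (hE.pos i)).1, hE.start_zero]
  · by_cases hl' : l < T.epochs i
    · rw [(hA.old i l hl').1, (hA.old i k (hkl.trans_lt hl')).1]
      exact hE.start_mono i k l hkl hl'
    · have hi := hlast i l (not_lt.1 hl') hl
      rw [hA.new i l (not_lt.1 hl') hl]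
      by_cases hk' : k < T.epochs i
      · rw [(hA.old i k hk').1]
        rcases hE.start i k hk' with h | ⟨p, hp, h⟩
        · rw [h, hi]; exact hb
        · rw [h]; exact hsort p hp
      · rw [hA.new i k (not_lt.1 hk') (hkl.trans_lt hl)]
  · by_cases hk' : k < T.epochs i
    · rw [(hA.old i k hk').1]
      rcases hE.start i k hk' with h | ⟨p, hp, h⟩
      · exact .inl h
      · exact .inr ⟨p, .inr hp, h⟩
    · exact .inr ⟨e, .inl rfl, hA.new i k (not_lt.1 hk') hk⟩
  · by_cases h : i = surv
    · subst h
      rw [hep]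
      simpa using hmono
    · rw [hL i hi h, hep, Function.update_of_ne h]
      have hp := hE.pos i
      rw [(hA.old i _ (by omega)).2]
      apply hE.last
      rcases hA.ending i with h' | ⟨h', -⟩
      · rw [← h', hi]
      · exact h'

theorem CurInv.cycle (hC : CurInv Γ vb ev P N T root el dt) {e : Fin m}
    (hend : T'.ending = T.ending) : CurInv Γ vb ev (insert e P) (N + 1) T' root el dt := by
  refine ⟨by simpa [hend] using hC.el_alive, hC.el_root, hC.el_birth,
    by simpa [hend] using hC.alive_el, fun i j h hi => ?_⟩
  rw [hend] at hi ⊢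
  obtain ⟨h1, h2, h3, ⟨p, hp, h4⟩, h5, h6, h7⟩ := hC.dead i j h hi
  exact ⟨h1, h2, h3, ⟨p, .inr hp, h4⟩, by omega, h6, h7⟩

/-- The elder rule: the eldest beam of the merged component is the survivor. Several beams may end
at the same height, so heights cannot exclude cyclic attachments. The order `dt` of the deaths does:
a beam is attached to one that is unfinished at that time and hence ends later in this order, if at
all. -/
theorem CurInv.merge (hC : CurInv Γ vb ev P N T root el dt) {e : Fin m} {ra rb dead surv : Fin n}
    (hra : root ra = ra) (hrb : root rb = rb) (hab : ra ≠ rb) (hsort : ∀ p ∈ P, ev p ≤ ev e)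
    (hbirth : vb surv ≤ vb dead) (hdead : vb dead ≤ ev e)
    (hds : dead = el ra ∧ surv = el rb ∨ dead = el rb ∧ surv = el ra)
    (hq : Γ.QConn (insert e P) dead surv)
    (hend : T'.ending = Function.update T.ending dead (some (surv, ev e))) :
    CurInv Γ vb ev (insert e P) (N + 1) T' (fun x => if root x = rb then ra else root x)
      (Function.update el ra surv) (Function.update dt dead N) := by
  have r1 : root (el ra) = ra := by have := hC.el_root ra; rwa [hra] at this
  have r2 : root (el rb) = rb := by have := hC.el_root rb; rwa [hrb] at this
  have a1 : T.ending (el ra) = none := by have := hC.el_alive ra; rwa [hra] at this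
  have a2 : T.ending (el rb) = none := by have := hC.el_alive rb; rwa [hrb] at this
  have hds' : surv ≠ dead := by
    rintro rfl
    rcases hds with ⟨h1, h2⟩ | ⟨h1, h2⟩ <;> rw [h1] at h2 <;> grind
  have hsurv : T'.ending surv = none := by
    rw [hend, Function.update_of_ne hds']
    rcases hds with ⟨h1, h2⟩ | ⟨h1, h2⟩ <;> rw [h2] <;> assumption
  have hrd : root dead = ra ∨ root dead = rb := by
    rcases hds with ⟨h1, h2⟩ | ⟨h1, h2⟩ <;> rw [h1] <;> simp [r1, r2]
  have hrs : root surv = ra ∨ root surv = rb := by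
    rcases hds with ⟨h1, h2⟩ | ⟨h1, h2⟩ <;> rw [h2] <;> simp [r1, r2]
  have hbs : vb surv ≤ vb (el ra) ∧ vb surv ≤ vb (el rb) := by
    rcases hds with ⟨h1, h2⟩ | ⟨h1, h2⟩ <;> rw [← h1, ← h2] <;> exact ⟨by linarith, by linarith⟩
  refine ⟨fun x => ?_, fun x => ?_, fun x => ?_, fun i hi => ?_, fun i j h hi => ?_⟩
  · by_cases hx : root x = rb ∨ root x = ra
    · have : (if root x = rb then ra else root x) = ra := by rcases hx with hx | hx <;> simp [hx]
      rw [this, Function.update_self]; exact hsurv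
    · push Not at hx
      rw [if_neg hx.1, Function.update_of_ne hx.2, hend, Function.update_of_ne]
      · exact hC.el_alive x
      · rintro h
        have := hC.el_root x
        rw [h] at this
        rcases hrd with h | h <;> rw [h] at this
        · exact hx.2 this.symm
        · exact hx.1 this.symm
  · by_cases hx : root x = rb ∨ root x = ra
    · have : (if root x = rb then ra else root x) = ra := by rcases hx with hx | hx <;> simp [hx]
      simp only [this, Function.update_self]
      rcases hrs with h | h <;> simp [h]
    · push Not at hx
      simp only [if_neg hx.1, Function.update_of_ne hx.2, hC.el_root]
  · by_cases hx : root x = rb ∨ root x = ra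
    · have : (if root x = rb then ra else root x) = ra := by rcases hx with hx | hx <;> simp [hx]
      simp only [this, Function.update_self]
      have := hC.el_birth x
      rcases hx with hx | hx <;> rw [hx] at this
      · exact hbs.2.trans this
      · exact hbs.1.trans this
    · push Not at hx
      simp only [if_neg hx.1, Function.update_of_ne hx.2, hC.el_birth]
  · have hid : i ≠ dead := by
      rintro rfl
      rw [hend] at hi; simp at hi
    rw [hend, Function.update_of_ne hid] at hi
    have hel := hC.alive_el i hi
    by_cases hx : root i = rb ∨ root i = ra
    · have : (if root i = rb then ra else root i) = ra := by rcases hx with hx | hx <;> simp [hx]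
      simp only [this, Function.update_self]
      rcases hx with hx | hx <;> rw [hx] at hel <;> rcases hds with ⟨h1, h2⟩ | ⟨h1, h2⟩ <;> grind
    · push Not at hx
      simp only [if_neg hx.1, Function.update_of_ne hx.2, hel]
  · by_cases hid : i = dead
    · subst hid
      rw [hend, Function.update_self] at hi
      obtain ⟨rfl, rfl⟩ : surv = j ∧ ev e = h := by simpa using hi
      refine ⟨hbirth, hdead, hq.mono ?_, ⟨e, .inl rfl, rfl⟩, by simp, .inl hsurv, ?_⟩
      · rintro p (rfl | hp)
        · exact le_refl (ev p)
        · exact hsort p hp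
      · intro j' h' hj; rw [hsurv] at hj; simp at hj
    · rw [hend, Function.update_of_ne hid] at hi
      obtain ⟨h1, h2, h3, ⟨p, hp, h4⟩, h5, h6, h7⟩ := hC.dead i j h hi
      refine ⟨h1, h2, h3, ⟨p, .inr hp, h4⟩, ?_, ?_, ?_⟩
      · rw [Function.update_of_ne hid]; omega
      · by_cases hj : j = dead
        · subst hj
          right
          simpa [hid] using h5
        · rw [hend, Function.update_of_ne hj, Function.update_of_ne hid, Function.update_of_ne hj]
          exact h6
      · intro j' h' hj'
        by_cases hj : j = dead
        · subst hj
          rw [hend, Function.update_self] at hj'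
          obtain ⟨-, rfl⟩ : surv = j' ∧ ev e = h' := by simpa using hj'
          rw [h4]; exact hsort p hp
        · rw [hend, Function.update_of_ne hj] at hj'
          exact h7 j' h' hj'

/-- The combinatorial properties of the decomposition into beams. -/
structure TreeSpec (Γ : ShiftGraph n m d) (vb : Fin n → ℝ) (ev : Fin m → ℝ)
    (μ : Submodule ℤ (Fin d → ℤ) → Monomial) (T : BeamTree n) : Prop where
  birth : T.birth = vb
  good : ∀ t, GoodAt Γ vb ev μ T t
  dead : ∃ r : Fin n → ℕ, ∀ i j h, T.ending i = some (j, h) → vb j ≤ vb i ∧ vb i ≤ h ∧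
    Γ.QConn (lowEdges ev h) i j ∧ r i < r j ∧ ∀ j' h', T.ending j = some (j', h') → h ≤ h'
  pos : ∀ i, 0 < T.epochs i
  start_zero : ∀ i, T.start i 0 = vb i
  start_mono : ∀ i k l, k ≤ l → l < T.epochs i → T.start i k ≤ T.start i l

theorem treeSpec_of_inv (hb : T.birth = vb) (hS : Γ.Sem Set.univ root phi L)
    (hC : CurInv Γ vb ev Set.univ N T root el dt) (hE : EpochInv vb ev μ Set.univ N T root L)
    (hH : ∀ t, lowEdges ev t ⊆ Set.univ → (∃ e ∈ Set.univ, t < ev e) → GoodAt Γ vb ev μ T t) :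
    TreeSpec Γ vb ev μ T := by
  -- Unfinished beams receive the rank `N`, which exceeds all times of death.
  refine ⟨hb, fun t => ?_, ⟨fun i => if T.ending i = none then N else dt i, fun i j h hi => ?_⟩,
    hE.pos, hE.start_zero, hE.start_mono⟩
  · by_cases h : ∃ e ∈ Set.univ, t < ev e
    · exact hH t (Set.subset_univ _) h
    · push Not at h
      exact goodAt_of_cur hS hC hE (Set.Subset.antisymm (Set.subset_univ _) h)
  · obtain ⟨h1, h2, h3, -, h5, h6, h7⟩ := hC.dead i j h hi
    refine ⟨h1, h2, h3, ?_, h7⟩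
    simp only [hi, reduceCtorEq, if_false]
    split_ifs with hj
    · exact h5
    · exact h6.resolve_left hj

end


/-! ### The size of the pivots -/

/-- The lattice is generated by vectors with entries of magnitude at most `B`. -/
def BoundedGen {d : ℕ} (B : ℕ) (L : Submodule ℤ (Fin d → ℤ)) : Prop :=
  ∃ S : Set (Fin d → ℤ), (∀ v ∈ S, ∀ k, |v k| ≤ B) ∧ Submodule.span ℤ S = L

theorem boundedGen_bot {d : ℕ} (B : ℕ) : BoundedGen B (⊥ : Submodule ℤ (Fin d → ℤ)) :=
  ⟨∅, by simp, by simp⟩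

theorem boundedGen_span_singleton {d B : ℕ} {v : Fin d → ℤ} (h : ∀ k, |v k| ≤ B) :
    BoundedGen B (Submodule.span ℤ {v}) :=
  ⟨{v}, by simpa using h, rfl⟩

theorem BoundedGen.sup {d B : ℕ} {L L' : Submodule ℤ (Fin d → ℤ)} (h : BoundedGen B L)
    (h' : BoundedGen B L') : BoundedGen B (L ⊔ L') := by
  obtain ⟨S, h1, rfl⟩ := h
  obtain ⟨S', h1', rfl⟩ := h'
  exact ⟨S ∪ S', fun v hv => hv.elim (h1 v) (h1' v), Submodule.span_union S S'⟩

theorem BoundedGen.mono {d B B' : ℕ} {L : Submodule ℤ (Fin d → ℤ)} (h : BoundedGen B L)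
    (hB : B ≤ B') : BoundedGen B' L := by
  obtain ⟨S, h1, h2⟩ := h
  exact ⟨S, fun v hv k => (h1 v hv k).trans (by exact_mod_cast hB), h2⟩

/-- Integer vectors as rational vectors. -/
def ratVec {d : ℕ} (v : Fin d → ℤ) : Fin d → ℚ := fun c => v c

theorem ratVec_mem_span {d : ℕ} {S : Set (Fin d → ℤ)} {v : Fin d → ℤ}
    (h : v ∈ Submodule.span ℤ S) : ratVec v ∈ Submodule.span ℚ (ratVec '' S) := by
  induction h using Submodule.span_induction with
  | mem x hx => exact Submodule.subset_span ⟨x, hx, rfl⟩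
  | zero =>
    have : ratVec (0 : Fin d → ℤ) = 0 := by funext c; simp [ratVec]
    rw [this]; exact Submodule.zero_mem _
  | add x y _ _ hx hy =>
    have : ratVec (x + y) = ratVec x + ratVec y := by funext c; simp [ratVec]
    rw [this]; exact Submodule.add_mem _ hx hy
  | smul a x _ hx =>
    have : ratVec (a • x) = (a : ℚ) • ratVec x := by funext c; simp [ratVec]
    rw [this]; exact Submodule.smul_mem _ _ hx

/-- A triangular matrix with its zero rows replaced by unit vectors. -/
def fillUnits {d : ℕ} (M : Fin d → Fin d → ℤ) : Matrix (Fin d) (Fin d) ℤ :=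
  fun k => if M k k = 0 then Pi.single k 1 else M k

theorem fillUnits_diag {d : ℕ} (M : Fin d → Fin d → ℤ) (k : Fin d) :
    fillUnits M k k = if M k k = 0 then 1 else M k k := by
  unfold fillUnits; split_ifs <;> simp

theorem det_fillUnits {d : ℕ} {M : Fin d → Fin d → ℤ} (h : IsTri M) :
    (fillUnits M).det = ∏ k, if M k k = 0 then 1 else M k k := by
  rw [Matrix.det_of_isUpperTriangular]
  · exact Finset.prod_congr rfl fun k _ => fillUnits_diag M k
  · intro k c hck
    simp only [id] at hck
    unfold fillUnits
    split_ifs with h0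
    · simp [hck.ne]
    · exact (h k).1 c hck

theorem det_fillUnits_ne_zero {d : ℕ} {M : Fin d → Fin d → ℤ} (h : IsTri M) :
    (fillUnits M).det ≠ 0 := by
  rw [det_fillUnits h, Finset.prod_ne_zero_iff]
  intro k _
  split_ifs with h0
  · exact one_ne_zero
  · exact h0

/-- A rational combination of the rows of a triangular matrix is determined by its pivot entries. -/
theorem eq_zero_of_pivots {d : ℕ} {M : Fin d → Fin d → ℤ} (h : IsTri M) {x : Fin d → ℚ}
    (hx : x ∈ Submodule.span ℚ (ratVec '' Set.range M)) (h0 : ∀ k, M k k ≠ 0 → x k = 0) : x = 0 := by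
  rw [← Set.range_comp] at hx
  obtain ⟨a, rfl⟩ := (Submodule.mem_span_range_iff_exists_fun ℚ).1 hx
  have key : ∀ k, a k • (ratVec ∘ M) k = 0 := by
    intro k
    induction k using WellFoundedLT.induction with
    | ind k ih =>
      by_cases hk : M k k = 0
      · have : (ratVec ∘ M) k = 0 := by
          funext c; simp [ratVec, (h k).2 hk]
        rw [this, smul_zero]
      · have e := h0 k hk
        rw [Finset.sum_apply, Finset.sum_eq_single k] at e
        · have : a k = 0 := by
            simpa [ratVec, hk] using e
          rw [this, zero_smul]
        · intro j _ hj
          rcases lt_or_gt_of_ne hj with hj | hj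
          · rw [ih j hj]; rfl
          · simp [ratVec, (h j).1 k hj]
        · simp
  exact Finset.sum_eq_zero fun k _ => key k

/-- A full rank matrix with bounded entries: bounded generators of the row span, and unit vectors in
place of the missing pivots. -/
theorem exists_frame {d B : ℕ} {M : Fin d → Fin d → ℤ} (h : IsTri M) (hB : 1 ≤ B)
    (hg : BoundedGen B (rowSpan M)) :
    ∃ T : Matrix (Fin d) (Fin d) ℤ, (∀ i k, |T i k| ≤ B) ∧ T.det ≠ 0 ∧
      (∀ i, T i ∈ rowSpan (fillUnits M)) ∧
      ∀ v ∈ rowSpan M, ∃ y : Fin d → ℚ,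
        (∀ k, M k k = 0 → ∃ i, y i = - v k) ∧
        ∑ i, y i • ratVec (T i) = fun k => if M k k = 0 then 0 else (v k : ℚ) := by
  obtain ⟨S, hS, hSM⟩ := hg
  have hMS : Submodule.span ℚ (ratVec '' S) = Submodule.span ℚ (ratVec '' Set.range M) := by
    apply le_antisymm
    · rw [Submodule.span_le]
      rintro _ ⟨v, hv, rfl⟩
      exact ratVec_mem_span (hSM ▸ Submodule.subset_span hv : v ∈ rowSpan M)
    · rw [Submodule.span_le]
      rintro _ ⟨v, hv, rfl⟩
      refine ratVec_mem_span (hSM ▸ Submodule.subset_span hv)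
  -- A rational basis of the span is selected among the small generators themselves. Unit vectors at
  -- the missing pivots complete it to full rank: a vector of the row span that is supported on the
  -- missing pivots vanishes.
  obtain ⟨b, hbS, hbs, hbi⟩ := exists_linearIndependent ℚ (ratVec '' S)
  choose g hg hgb using fun x : b => hbS x.2
  let t : b ⊕ {k // M k k = 0} → Fin d → ℤ := Sum.elim g (fun k => Pi.single k.1 1)
  have ht1 : (fun x : b => ratVec (t (Sum.inl x))) = ((↑) : b → Fin d → ℚ) := funext hgb
  have ht2 : (fun k : {k // M k k = 0} => ratVec (t (Sum.inr k))) =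
      fun k : {k // M k k = 0} => (Pi.single (k : Fin d) (1 : ℚ) : Fin d → ℚ) := by
    funext k c
    simp only [ratVec, t, Sum.elim_inr, Pi.single_apply]
    split_ifs <;> simp
  have hbs' : Submodule.span ℚ (Set.range ((↑) : b → Fin d → ℚ)) =
      Submodule.span ℚ (ratVec '' Set.range M) := by
    rw [Subtype.range_coe, hbs, hMS]
  have hli : LinearIndependent ℚ (fun x => ratVec (t x)) := by
    rw [linearIndependent_sum]
    refine ⟨?_, ?_, ?_⟩
    · change LinearIndependent ℚ (fun x : b => ratVec (t (Sum.inl x)))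
      rw [ht1]; exact hbi
    · change LinearIndependent ℚ (fun k : {k // M k k = 0} => ratVec (t (Sum.inr k)))
      rw [ht2]
      have := (Pi.basisFun ℚ (Fin d)).linearIndependent.comp (fun k : {k // M k k = 0} => (k : Fin d))
        Subtype.val_injective
      convert this using 1
      funext k
      simp
    · change Disjoint (Submodule.span ℚ (Set.range fun x : b => ratVec (t (Sum.inl x))))
        (Submodule.span ℚ (Set.range fun k : {k // M k k = 0} => ratVec (t (Sum.inr k))))
      rw [ht1, ht2, hbs', Submodule.disjoint_def]
      intro x hx hx'
      apply eq_zero_of_pivots h hx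
      intro k hk
      obtain ⟨a, rfl⟩ := (Submodule.mem_span_range_iff_exists_fun ℚ).1 hx'
      rw [Finset.sum_apply]
      refine Finset.sum_eq_zero fun j _ => ?_
      have : k ≠ j := by rintro rfl; exact hk j.2
      simp [this]
  have htop : ⊤ ≤ Submodule.span ℚ (Set.range fun x => ratVec (t x)) := by
    have hu : LinearIndependent ℚ (fun k => ratVec (fillUnits M k)) := by
      have : ((fillUnits M).map (Int.castRingHom ℚ)).det ≠ 0 := by
        rw [← RingHom.mapMatrix_apply, ← RingHom.map_det]
        simpa using det_fillUnits_ne_zero h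
      exact Matrix.linearIndependent_rows_of_det_ne_zero this
    rw [← hu.span_eq_top_of_card_eq_finrank' (by simp), Submodule.span_le]
    rintro _ ⟨k, rfl⟩
    by_cases hk : M k k = 0
    · refine Submodule.subset_span ⟨Sum.inr ⟨k, hk⟩, ?_⟩
      simp [fillUnits, hk, t]
    · have : ratVec (M k) ∈ Submodule.span ℚ (Set.range fun x : b => ratVec (t (Sum.inl x))) := by
        rw [ht1, hbs']
        exact Submodule.subset_span ⟨_, ⟨k, rfl⟩, rfl⟩
      simp only [fillUnits, hk, if_false]
      refine Submodule.span_mono ?_ this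
      rintro _ ⟨x, rfl⟩
      exact ⟨_, rfl⟩
  let bas := Module.Basis.mk hli htop
  have : Fintype b := hbi.setFinite.fintype
  have hcard : Fintype.card (b ⊕ {k // M k k = 0}) = Fintype.card (Fin d) := by
    rw [← Module.finrank_eq_card_basis bas]; simp
  let e := Fintype.equivOfCardEq hcard
  have htB : ∀ x k, |t x k| ≤ B := by
    rintro (x | x) k
    · exact hS _ (hg x) k
    · simp only [t, Sum.elim_inr, Pi.single_apply]
      split_ifs <;> simp
      exact_mod_cast hB
  have hle : rowSpan M ≤ rowSpan (fillUnits M) := by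
    refine Submodule.span_le.2 ?_
    rintro _ ⟨k, rfl⟩
    by_cases hk : M k k = 0
    · rw [(h k).2 hk]; exact Submodule.zero_mem _
    · exact Submodule.subset_span ⟨k, by simp [fillUnits, hk]⟩
  refine ⟨Matrix.of fun i => t (e.symm i), fun i => htB _, ?_, ?_, ?_⟩
  · have hli' : LinearIndependent ℚ (fun i => ratVec (t (e.symm i))) := hli.comp _ e.symm.injective
    have hdet : IsUnit (Matrix.of fun i => ratVec (t (e.symm i))) :=
      Matrix.linearIndependent_rows_iff_isUnit.1 hli'
    intro h0
    have : (Matrix.of fun i => ratVec (t (e.symm i))).det = 0 := by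
      have e1 : (Matrix.of fun i => ratVec (t (e.symm i))) =
        (Int.castRingHom ℚ).mapMatrix (Matrix.of fun i => t (e.symm i)) := rfl
      rw [e1, ← RingHom.map_det, h0, map_zero]
    rw [Matrix.isUnit_iff_isUnit_det, this] at hdet
    simp at hdet
  · intro i
    change t (e.symm i) ∈ _
    rcases e.symm i with x | k
    · exact hle (hSM ▸ Submodule.subset_span (hg x))
    · exact Submodule.subset_span ⟨k, by simp [fillUnits, k.2, t]⟩
  · intro v hv
    have hv' : ratVec v ∈ Submodule.span ℚ (Set.range ((↑) : b → Fin d → ℚ)) := by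
      rw [hbs']; exact ratVec_mem_span hv
    obtain ⟨a, ha⟩ := (Submodule.mem_span_range_iff_exists_fun ℚ).1 hv'
    -- The unit vectors cancel the entries of `v` at the missing pivots. These entries thereby
    -- become coefficients of a linear system with a small right-hand side, ready for Cramer's rule.
    let w : {k // M k k = 0} → ℚ := fun k => - (v k : ℚ)
    refine ⟨fun i => Sum.elim a w (e.symm i), fun k hk => ⟨e (Sum.inr ⟨k, hk⟩), ?_⟩, ?_⟩
    · change Sum.elim a w (e.symm (e _)) = _
      rw [e.symm_apply_apply]; rfl
    change ∑ i, Sum.elim a w (e.symm i) • ratVec (t (e.symm i)) = _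
    rw [e.symm.sum_comp (fun x => Sum.elim a w x • ratVec (t x)), Fintype.sum_sum_type]
    have this : (∑ x, a x • ratVec (t (Sum.inl x))) + ∑ k, w k • ratVec (t (Sum.inr k)) =
        (∑ x, a x • (x : Fin d → ℚ)) + ∑ k, w k • (Pi.single (k : Fin d) (1 : ℚ) : Fin d → ℚ) := by
      congr 1
      · exact Finset.sum_congr rfl fun x _ => congrArg (a x • ·) (hgb x)
      · exact Finset.sum_congr rfl fun k _ => congrArg (w k • ·) (congrFun ht2 k)
    simp only [Sum.elim_inl, Sum.elim_inr]
    rw [this, ha]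
    funext c
    rw [Pi.add_apply, Finset.sum_apply]
    by_cases hc : M c c = 0
    · rw [Finset.sum_eq_single ⟨c, hc⟩]
      · simp [ratVec, hc, w]
      · intro j _ hj
        have : c ≠ j := fun h => hj (Subtype.ext h.symm)
        simp [this]
      · simp
    · rw [Finset.sum_eq_zero]
      · simp [ratVec, hc]
      · intro j _
        have : c ≠ j := by rintro rfl; exact hc j.2
        simp [this]

theorem abs_det_le {d B : ℕ} {T : Matrix (Fin d) (Fin d) ℤ} (h : ∀ i k, |T i k| ≤ B) :
    |T.det| ≤ (d.factorial * B ^ d : ℕ) := by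
  have := Matrix.det_le (A := T) (abv := AbsoluteValue.abs) (x := (B : ℤ)) h
  simpa using this

/-- An integer coordinate matrix is the other factor of the determinant. -/
theorem dvd_det_fillUnits {d : ℕ} {M : Fin d → Fin d → ℤ} {T : Matrix (Fin d) (Fin d) ℤ}
    (h : ∀ i, T i ∈ rowSpan (fillUnits M)) : (fillUnits M).det ∣ T.det := by
  choose a ha using fun i => (Submodule.mem_span_range_iff_exists_fun ℤ).1 (h i)
  have : T = Matrix.of a * fillUnits M := by
    ext i k
    rw [← ha i, Finset.sum_apply, Matrix.mul_apply]
    rfl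
  rw [this, Matrix.det_mul]
  exact dvd_mul_left _ _

/-- A lattice with small generators has small pivots. -/
theorem pivot_le {d B : ℕ} {M : Fin d → Fin d → ℤ} (h : IsTri M) (hB : 1 ≤ B)
    (hg : BoundedGen B (rowSpan M)) (k : Fin d) : |M k k| ≤ (d.factorial * B ^ d : ℕ) := by
  obtain ⟨T, h1, h2, h3, -⟩ := exists_frame h hB hg
  by_cases hk : M k k = 0
  · rw [hk, abs_zero]; exact Nat.cast_nonneg _
  -- The determinant of the filled triangular matrix is the product of its diagonal, so the pivot
  -- divides it, and it divides the nonzero determinant of the small matrix.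
  · have e1 : M k k ∣ T.det := by
      refine dvd_trans ?_ (dvd_det_fillUnits h3)
      rw [det_fillUnits h]
      have := Finset.dvd_prod_of_mem (fun k => if M k k = 0 then 1 else M k k) (Finset.mem_univ k)
      simpa [hk] using this
    refine le_trans ?_ (abs_det_le h1)
    exact Int.le_of_dvd (abs_pos.2 h2) ((abs_dvd_abs _ _).2 e1)

/-- A lattice vector with small pivot entries is small. -/
theorem entry_le {d B X : ℕ} {M : Fin d → Fin d → ℤ} (h : IsTri M) (hB : 1 ≤ B)
    (hg : BoundedGen B (rowSpan M)) {v : Fin d → ℤ} (hv : v ∈ rowSpan M)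
    (hX : ∀ k, M k k ≠ 0 → |v k| ≤ X) {k : Fin d} (hk : M k k = 0) :
    |v k| ≤ (d * X * (d.factorial * B ^ d) : ℕ) := by
  obtain ⟨T, h1, h2, -, h4⟩ := exists_frame h hB hg
  obtain ⟨y, hy, hyw⟩ := h4 v hv
  obtain ⟨i, hi⟩ := hy k hk
  set w : Fin d → ℤ := fun k => if M k k = 0 then 0 else v k with hw
  have hw' : (fun k => if M k k = 0 then 0 else (v k : ℚ)) = ratVec w := by
    funext k; simp only [hw, ratVec]; split_ifs <;> simp
  have hwX : ∀ c, |w c| ≤ X := by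
    intro c
    simp only [hw]
    split_ifs with hc
    · simp
    · exact hX c hc
  rw [hw'] at hyw
  let TQ : Matrix (Fin d) (Fin d) ℚ := T.map (Int.castRingHom ℚ)
  have e1 : Matrix.vecMul y TQ = ratVec w := by
    rw [← hyw]
    funext c
    simp [Matrix.vecMul, dotProduct, TQ, ratVec]
  -- Cramer's rule. In coordinate `i` it expresses `-(det T) * v k` by `w` and cofactors of `T`, and
  -- `|det T| ≥ 1` since it is a nonzero integer.
  have e2 : Matrix.vecMul (ratVec w) TQ.adjugate = TQ.det • y := by
    rw [← e1, Matrix.vecMul_vecMul, Matrix.mul_adjugate, Matrix.vecMul_smul, Matrix.vecMul_one]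
  have e3 : TQ.det = (T.det : ℚ) := by
    have : TQ = (Int.castRingHom ℚ).mapMatrix T := rfl
    rw [this, ← RingHom.map_det]; rfl
  have e4 : TQ.adjugate = T.adjugate.map (Int.castRingHom ℚ) :=
    (RingHom.map_adjugate (Int.castRingHom ℚ) T).symm
  have e5 : ∑ c, w c * T.adjugate c i = - (T.det * v k) := by
    have := congrFun e2 i
    rw [e3, e4, Pi.smul_apply, hi] at this
    simp only [Matrix.vecMul, dotProduct, ratVec, Matrix.map_apply, eq_intCast, smul_eq_mul] at this
    have h' : ((∑ c, w c * T.adjugate c i : ℤ) : ℚ) = ((-(T.det * v k) : ℤ) : ℚ) := by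
      rw [Int.cast_sum, Int.cast_neg, Int.cast_mul, ← mul_neg, ← this]
      exact Finset.sum_congr rfl fun c _ => Int.cast_mul _ _
    exact_mod_cast h'
  have e6 : |T.det * v k| ≤ ∑ c : Fin d, ((X * (d.factorial * B ^ d) : ℕ) : ℤ) := by
    rw [← abs_neg, ← e5]
    refine (Finset.abs_sum_le_sum_abs _ _).trans (Finset.sum_le_sum fun c _ => ?_)
    rw [abs_mul, Nat.cast_mul]
    refine mul_le_mul (hwX c) ?_ (abs_nonneg _) (by positivity)
    rw [Matrix.adjugate_apply]
    apply abs_det_le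
    intro a c'
    rw [Matrix.updateRow_apply]
    split_ifs
    · rw [Pi.single_apply]
      split_ifs <;> simp
      exact_mod_cast hB
    · exact h1 _ _
  have e7 : |v k| ≤ |T.det * v k| := by
    rw [abs_mul]
    exact le_mul_of_one_le_left (abs_nonneg _) (Int.one_le_abs h2)
  refine e7.trans (e6.trans (le_of_eq ?_))
  simp [mul_assoc]

theorem tailSpan_coord {d r : ℕ} {M : Fin d → Fin d → ℤ} (h : IsTri M) {v : Fin d → ℤ}
    (hv : v ∈ tailSpan M r) {c : Fin d} (hc : (c : ℕ) < r) : v c = 0 := by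
  induction hv using Submodule.span_induction with
  | mem x hx =>
    obtain ⟨l, hl, rfl⟩ := hx
    exact (h l).1 c (Fin.lt_def.2 (hc.trans_le hl))
  | zero => rfl
  | add x y _ _ hx hy => simp [hx, hy]
  | smul a x _ hx => simp [hx]

theorem tailSpan_le {d : ℕ} (M : Fin d → Fin d → ℤ) (r : ℕ) : tailSpan M r ≤ rowSpan M :=
  Submodule.span_mono (Set.image_subset_range _ _)

/-- Every vector can be reduced by the last rows of a triangular matrix. -/
theorem exists_reduced {d : ℕ} {M : Fin d → Fin d → ℤ} (h : IsTri M) (r : ℕ) (hr : r ≤ d) :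
    ∀ v : Fin d → ℤ, ∃ t ∈ tailSpan M r,
      ∀ j : Fin d, r ≤ (j : ℕ) → M j j ≠ 0 → |(v - t) j| ≤ |M j j| := by
  induction hr using Nat.decreasingInduction with
  | self => exact fun v => ⟨0, Submodule.zero_mem _, fun j hj => absurd j.2 (by omega)⟩
  | of_succ r hr ih =>
    intro v
    set k : Fin d := ⟨r, hr⟩
    obtain ⟨t, ht, h2⟩ := ih (v - (v k / M k k) • M k)
    refine ⟨(v k / M k k) • M k + t, ?_, ?_⟩
    · have : tailSpan M r = _ := tailSpan_eq M k
      rw [this, add_comm (_ • _)]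
      exact Submodule.add_mem_sup ht
        (Submodule.smul_mem _ _ (Submodule.mem_span_singleton_self _))
    · intro j hj hjM
      rw [← sub_sub]
      rcases hj.lt_or_eq with hj | hj
      · exact h2 j hj hjM
      · have hjk : j = k := Fin.ext hj.symm
        rw [hjk] at hjM ⊢
        have e1 : t k = 0 := tailSpan_coord h ht (Nat.lt_succ_self r)
        have e2 : (v - (v k / M k k) • M k - t) k = v k % M k k := by
          simp only [Pi.sub_apply, Pi.smul_apply, smul_eq_mul, e1, sub_zero]
          rw [Int.emod_def, mul_comm]
        rw [e2, abs_of_nonneg (Int.emod_nonneg _ hjM)]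
        exact (Int.emod_lt_abs _ hjM).le

/-- The last rows of a triangular matrix generate a lattice with moderately small generators. -/
theorem boundedGen_tailSpan {d B : ℕ} {M : Fin d → Fin d → ℤ} (h : IsTri M) (hB : 1 ≤ B)
    (hg : BoundedGen B (rowSpan M)) (hd : 0 < d) (r : ℕ) (hr : r ≤ d) :
    BoundedGen (d * (d.factorial * B ^ d) ^ 2) (tailSpan M r) := by
  induction hr using Nat.decreasingInduction with
  | self => rw [tailSpan_self]; exact boundedGen_bot _
  | of_succ r hr ih =>
    set k : Fin d := ⟨r, hr⟩
    have e : tailSpan M r = tailSpan M (r + 1) ⊔ Submodule.span ℤ {M k} := tailSpan_eq M k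
    by_cases hk : M k k = 0
    · rw [e, (h k).2 hk]
      simpa using ih
    -- Row `k` is replaced by its reduction modulo the later rows. Its entries at pivots are then at
    -- most `d! * B ^ d`, and `entry_le` bounds the remaining ones by `d` times the square of this
    -- number.
    · obtain ⟨t, ht, h2⟩ := exists_reduced h (r + 1) hr (M k)
      have e' : tailSpan M r = tailSpan M (r + 1) ⊔ Submodule.span ℤ {M k - t} := by
        rw [e]
        apply le_antisymm
        · refine sup_le le_sup_left ((Submodule.span_singleton_le_iff_mem _ _).2 ?_)
          have := Submodule.add_mem_sup ht (Submodule.mem_span_singleton_self (R := ℤ) (M k - t))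
          rwa [add_sub_cancel] at this
        · refine sup_le le_sup_left ((Submodule.span_singleton_le_iff_mem _ _).2 ?_)
          have : M k - t = -t + M k := by abel
          rw [this]
          exact Submodule.add_mem_sup (neg_mem ht) (Submodule.mem_span_singleton_self _)
      rw [e']
      refine ih.sup (boundedGen_span_singleton ?_)
      have hmem : M k - t ∈ rowSpan M :=
        sub_mem (Submodule.subset_span ⟨k, rfl⟩) (tailSpan_le _ _ ht)
      have hp : ∀ c, M c c ≠ 0 → |(M k - t) c| ≤ (d.factorial * B ^ d : ℕ) := by
        intro c hc
        rcases lt_trichotomy (c : ℕ) r with hcr | hcr | hcr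
        · have : (M k - t) c = 0 := by
            rw [Pi.sub_apply, (h k).1 c hcr, tailSpan_coord h ht (by omega), sub_zero]
          rw [this, abs_zero]
          exact Nat.cast_nonneg _
        · have hck : c = k := Fin.ext hcr
          rw [Pi.sub_apply, tailSpan_coord h ht (by omega), sub_zero, hck]
          exact pivot_le h hB hg k
        · exact (h2 c hcr hc).trans (pivot_le h hB hg c)
      intro c
      by_cases hc : M c c = 0
      · refine (entry_le h hB hg hmem hp hc).trans (le_of_eq ?_)
        rw [pow_two]; push_cast; ring
      · refine (hp c hc).trans ?_
        norm_cast
        have : 1 ≤ d.factorial * B ^ d := Nat.mul_pos (Nat.factorial_pos d) (pow_pos hB d)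
        nlinarith [Nat.mul_le_mul hd this]

/-- A bound on the pivots while one lattice is added to another. -/
def pivotBound (d B : ℕ) : ℕ := d.factorial * (d * (d.factorial * B ^ d) ^ 2) ^ d

theorem le_tailBound {d B : ℕ} (hd : 0 < d) (hB : 1 ≤ B) : B ≤ d * (d.factorial * B ^ d) ^ 2 := by
  have h1 : B ≤ B ^ d := Nat.le_self_pow hd.ne' B
  have h2 : B ^ d ≤ d.factorial * B ^ d := Nat.le_mul_of_pos_left _ (Nat.factorial_pos d)
  nlinarith [Nat.mul_le_mul hd (Nat.mul_le_mul (hB.trans (h1.trans h2)) (h1.trans h2))]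

theorem pivot_le_pivotBound {d B : ℕ} {M : Fin d → Fin d → ℤ} (h : IsTri M) (hB : 1 ≤ B)
    (hd : 0 < d) (hg : BoundedGen B (rowSpan M)) (k : Fin d) : |M k k| ≤ pivotBound d B :=
  pivot_le h (hB.trans (le_tailBound hd hB)) (hg.mono (le_tailBound hd hB)) k

/-- This is the bound that `sumLat_spec` needs for its intermediate lattices: `pivotBound` is the
bound of `pivot_le` for the generator size of `boundedGen_tailSpan`. -/
theorem pivot_sum_le_pivotBound {d B r : ℕ} {M Mb : Fin d → Fin d → ℤ}
    {La : Submodule ℤ (Fin d → ℤ)} (h : IsTri M) (hB : 1 ≤ B) (hd : 0 < d) (hr : r ≤ d)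
    (hb : IsTri Mb) (hga : BoundedGen B La) (hgb : BoundedGen B (rowSpan Mb))
    (hM : rowSpan M = La ⊔ tailSpan Mb r) (k : Fin d) : |M k k| ≤ pivotBound d B := by
  refine pivot_le h (hB.trans (le_tailBound hd hB)) ?_ k
  rw [hM]
  exact (hga.mono (le_tailBound hd hB)).sup (boundedGen_tailSpan hb hB hgb hd r hr)


/-! ### Volumes of unit cells -/

open InnerProductSpace in
theorem inner_gramSchmidt_self {d : ℕ} (v : Fin d → E d) (k : Fin d) :
    inner ℝ (gramSchmidt ℝ v k) (v k) = ‖gramSchmidt ℝ v k‖ ^ 2 := by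
  conv_lhs => rw [gramSchmidt_def'' ℝ v k, inner_add_right, inner_sum]
  rw [Finset.sum_eq_zero, add_zero, real_inner_self_eq_norm_sq]
  intro i hi
  rw [inner_smul_right, gramSchmidt_orthogonal ℝ v (Finset.mem_Iio.1 hi).ne', mul_zero]

open InnerProductSpace in
-- Zero vectors interspersed in an independent family do not enlarge any span, so a vanishing
-- Gram-Schmidt vector would make `v k` dependent on its nonzero predecessors.
theorem gramSchmidt_ne_zero_of_indep {d : ℕ} {v : Fin d → E d} {p : Fin d → Prop}
    (h0 : ∀ k, ¬ p k → v k = 0) (hli : LinearIndependent ℝ (fun k : {k // p k} => v k))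
    (k : {k // p k}) : gramSchmidt ℝ v k ≠ 0 := by
  intro h
  have h1 : v k ∈ Submodule.span ℝ (v '' Set.Iio (k : Fin d)) := by
    rw [← span_gramSchmidt_Iio ℝ v k, gramSchmidt_def' ℝ v k, h, zero_add]
    refine Submodule.sum_mem _ fun i hi => ?_
    have hi' : gramSchmidt ℝ v i ∈ gramSchmidt ℝ v '' Set.Iio (k : Fin d) :=
      ⟨i, Finset.mem_Iio.1 hi, rfl⟩
    exact Submodule.span_mono (Set.singleton_subset_iff.2 hi')
      (Submodule.starProjection_apply_mem _ _)
  refine hli.notMem_span_image (s := {j | j < k}) (x := k) (lt_irrefl k) ?_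
  refine Submodule.span_le.2 ?_ h1
  rintro _ ⟨j, hj, rfl⟩
  by_cases hp : p j
  · exact Submodule.subset_span ⟨⟨j, hp⟩, hj, rfl⟩
  · rw [h0 j hp]; exact Submodule.zero_mem _

theorem span_range_subtype {R : Type*} [Semiring R] {d : ℕ} [Module R (E d)] {v : Fin d → E d}
    {p : Fin d → Prop} (h0 : ∀ k, ¬ p k → v k = 0) :
    Submodule.span R (Set.range fun k : {k // p k} => v k) = Submodule.span R (Set.range v) := by
  apply le_antisymm
  · exact Submodule.span_mono (by rintro _ ⟨k, rfl⟩; exact ⟨k, rfl⟩)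
  · rw [Submodule.span_le]
    rintro _ ⟨k, rfl⟩
    by_cases hp : p k
    · exact Submodule.subset_span ⟨⟨k, hp⟩, rfl⟩
    · rw [h0 k hp]; exact Submodule.zero_mem _

theorem latticeDim_span {d : ℕ} {v : Fin d → E d} {p : Fin d → Prop} [DecidablePred p]
    (h0 : ∀ k, ¬ p k → v k = 0) (hli : LinearIndependent ℝ (fun k : {k // p k} => v k)) :
    latticeDim (Submodule.span ℤ (Set.range v)) = ∑ k, if p k then 1 else 0 := by
  have hz : LinearIndependent ℤ (fun k : {k // p k} => v k) :=
    hli.restrict_scalars (smul_left_injective ℤ one_ne_zero)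
  rw [latticeDim, ← span_range_subtype h0, finrank_span_eq_card hz, Fintype.card_subtype]
  simp

open InnerProductSpace in
-- The normalized Gram-Schmidt vectors form an orthonormal basis of the linear span. In it the
-- lattice basis is upper triangular with the Gram-Schmidt norms on the diagonal, and the
-- determinant is the covolume.
theorem latticeVolume_span {d : ℕ} {v : Fin d → E d} {p : Fin d → Prop} [DecidablePred p]
    (h0 : ∀ k, ¬ p k → v k = 0) (hli : LinearIndependent ℝ (fun k : {k // p k} => v k)) :
    latticeVolume (Submodule.span ℤ (Set.range v)) =
      ∏ k, if p k then ‖gramSchmidt ℝ v k‖ else 1 := by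
  set L := Submodule.span ℤ (Set.range v) with hL
  set V := Submodule.span ℝ (L : Set (E d)) with hV
  have hVv : V = Submodule.span ℝ (Set.range v) := by
    apply le_antisymm
    · rw [hV, Submodule.span_le]
      exact Submodule.span_le_restrictScalars ℤ ℝ (Set.range v)
    · exact Submodule.span_mono Submodule.subset_span
  have hmem : ∀ k, v k ∈ V := fun k => hVv ▸ Submodule.subset_span ⟨k, rfl⟩
  have hVi : Submodule.span ℝ (Set.range fun k : {k // p k} => v k) = V := by
    rw [hVv, span_range_subtype h0]
  let w : {k // p k} → V := fun k => ⟨v k, hmem k⟩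
  have hwi : LinearIndependent ℝ w := by
    refine LinearIndependent.of_comp V.subtype ?_
    exact hli
  have hwt : ⊤ ≤ Submodule.span ℝ (Set.range w) := by
    have : Submodule.map V.subtype (Submodule.span ℝ (Set.range w)) = Submodule.map V.subtype ⊤ := by
      rw [Submodule.map_span, ← Set.range_comp, Submodule.map_top, Submodule.range_subtype]
      exact hVi
    exact (Submodule.map_injective_of_injective V.injective_subtype this).ge
  let B := Module.Basis.mk hwi hwt
  have hB : ∀ k, B k = w k := fun k => by simp [B]
  have hcomap : ZLattice.comap ℝ L V.subtype = Submodule.span ℤ (Set.range B) := by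
    have hinj : Function.Injective (V.subtype.restrictScalars ℤ) := V.injective_subtype
    refine Submodule.map_injective_of_injective hinj ?_
    rw [ZLattice.comap, Submodule.map_comap_eq, Submodule.map_span, ← Set.range_comp]
    have e1 : (V.subtype.restrictScalars ℤ) ∘ B = fun k : {k // p k} => v k := by
      funext k
      simp [hB, w]
    rw [e1, span_range_subtype h0, ← hL]
    refine inf_eq_right.2 fun x hx => ?_
    exact ⟨⟨x, Submodule.subset_span hx⟩, rfl⟩
  set g := gramSchmidt ℝ v with hg
  have hg0 : ∀ k : {k // p k}, ‖g k‖ ≠ 0 := fun k => by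
    rw [norm_ne_zero_iff]; exact gramSchmidt_ne_zero_of_indep h0 hli k
  have hgV : ∀ k, g k ∈ V := by
    intro k
    rw [hVv, ← span_gramSchmidt ℝ v]
    exact Submodule.subset_span ⟨k, rfl⟩
  let u : {k // p k} → V := fun k => ⟨‖g k‖⁻¹ • g k, V.smul_mem _ (hgV k)⟩
  have hu : Orthonormal ℝ u := by
    constructor
    · intro k
      rw [Submodule.coe_norm, norm_smul, norm_inv, norm_norm, inv_mul_cancel₀ (hg0 k)]
    · intro k l hkl
      rw [Submodule.coe_inner]
      simp only [u, inner_smul_left, inner_smul_right]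
      rw [gramSchmidt_orthogonal ℝ v (fun h => hkl (Subtype.ext h))]
      simp
  have hut : ⊤ ≤ Submodule.span ℝ (Set.range u) := by
    refine (hu.linearIndependent.span_eq_top_of_card_eq_finrank' ?_).ge
    rw [Module.finrank_eq_card_basis B]
  let b₀ := OrthonormalBasis.mk hu hut
  have hb₀ : ∀ k, b₀ k = u k := fun k => by simp [b₀]
  have hdet : b₀.toBasis.det B = ∏ k : {k // p k}, ‖g k‖ := by
    have hent : ∀ i j, b₀.toBasis.toMatrix B i j = ‖g i‖⁻¹ * inner ℝ (g i) (v j) := by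
      intro i j
      rw [Module.Basis.toMatrix_apply, OrthonormalBasis.coe_toBasis_repr_apply,
        OrthonormalBasis.repr_apply_apply, hb₀, hB, Submodule.coe_inner]
      simp only [u, w, inner_smul_left]
      simp
    rw [Module.Basis.det_apply, Matrix.det_of_isUpperTriangular]
    · refine Finset.prod_congr rfl fun k _ => ?_
      rw [hent, hg, inner_gramSchmidt_self, pow_two, inv_mul_cancel_left₀ (hg0 k)]
    · intro i j hij
      have : inner ℝ (g i) (v j) = 0 := gramSchmidt_inv_triangular ℝ v hij
      rw [hent, this, mul_zero]
  -- The fundamental domain agrees with the parallelepiped up to a null set, and an orthonormal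
  -- basis spans a unit cube.
  have hvol : volume.real (ZSpan.fundamentalDomain b₀.toBasis) = 1 := by
    rw [measureReal_congr (ZSpan.fundamentalDomain_ae_parallelepiped b₀.toBasis volume),
      OrthonormalBasis.coe_toBasis, measureReal_def, b₀.volume_parallelepiped]
    rfl
  have key : ZLattice.covolume (Submodule.span ℤ (Set.range B)) volume = ∏ k : {k // p k}, ‖g k‖ := by
    rw [ZLattice.covolume_eq_measure_fundamentalDomain _ _ (ZSpan.isAddFundamentalDomain B volume),
      ZSpan.measureReal_fundamentalDomain B volume b₀.toBasis, hvol, hdet, mul_one, abs_of_nonneg]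
    exact Finset.prod_nonneg fun _ _ => norm_nonneg _
  rw [latticeVolume, hcomap, key, Finset.prod_ite, Finset.prod_const_one, mul_one]
  exact (Finset.prod_subtype (p := p) (Finset.univ.filter p) (by simp) (fun k => ‖g k‖)).symm

/-- Integer coordinates to lattice vectors. -/
def latHom {d : ℕ} (b : Module.Basis (Fin d) ℝ (E d)) : (Fin d → ℤ) →ₗ[ℤ] E d :=
  Fintype.linearCombination ℤ b

theorem latHom_apply {d : ℕ} (b : Module.Basis (Fin d) ℝ (E d)) (k : Fin d → ℤ) :
    latHom b k = latticeVector b k := by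
  simp [latHom, latticeVector, Fintype.linearCombination_apply]

/-- The shadow monomial for a lattice given in coordinates. -/
def monoOf {d : ℕ} (b : Module.Basis (Fin d) ℝ (E d)) (L : Submodule ℤ (Fin d → ℤ)) : Monomial where
  coeff := latticeVolume (L.map (latHom b)) / latticeVolume (latticeOf b)
    * ballVolume (d - latticeDim (L.map (latHom b)))
  expo := (d : ℤ) - latticeDim (L.map (latHom b))

theorem map_rowSpan {d : ℕ} (b : Module.Basis (Fin d) ℝ (E d)) (M : Fin d → Fin d → ℤ) :
    (rowSpan M).map (latHom b) = Submodule.span ℤ (Set.range fun k => intComb b (M k)) := by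
  rw [rowSpan, Submodule.map_span, ← Set.range_comp]
  exact congrArg (fun f => Submodule.span ℤ (Set.range f)) (funext fun k => latHom_apply b (M k))

/-- The nonzero rows are among the rows of `fillUnits M`, whose determinant is nonzero, and the
basis `b` carries independence of coordinates over to vectors. -/
theorem intComb_indep {d : ℕ} (b : Module.Basis (Fin d) ℝ (E d)) {M : Fin d → Fin d → ℤ}
    (h : IsTri M) : LinearIndependent ℝ (fun k : {k // M k k ≠ 0} => intComb b (M k)) := by
  have h1 : LinearIndependent ℝ (fun k => (fun c => (fillUnits M k c : ℝ))) := by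
    have : ((fillUnits M).map (Int.castRingHom ℝ)).det ≠ 0 := by
      rw [← RingHom.mapMatrix_apply, ← RingHom.map_det]
      simpa using det_fillUnits_ne_zero h
    exact Matrix.linearIndependent_rows_of_det_ne_zero this
  have h2 := (h1.map' b.equivFun.symm.toLinearMap b.equivFun.symm.ker).comp
    (fun k : {k // M k k ≠ 0} => (k : Fin d)) Subtype.val_injective
  have e : (fun k : {k // M k k ≠ 0} => intComb b (M k)) =
      (b.equivFun.symm.toLinearMap ∘ fun k c => (fillUnits M k c : ℝ)) ∘
        fun k : {k // M k k ≠ 0} => (k : Fin d) := by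
    funext k
    simp [Module.Basis.equivFun_symm_apply, intComb, fillUnits, k.2, Int.cast_smul_eq_zsmul]
  rw [e]
  exact h2

theorem intComb_zero_of_not {d : ℕ} (b : Module.Basis (Fin d) ℝ (E d)) {M : Fin d → Fin d → ℤ}
    (h : IsTri M) (k : Fin d) (hk : ¬ M k k ≠ 0) : intComb b (M k) = 0 := by
  rw [(h k).2 (not_not.1 hk)]
  simp [intComb]

theorem latticeVolume_tri {d : ℕ} (b : Module.Basis (Fin d) ℝ (E d)) {M : Fin d → Fin d → ℤ}
    (h : IsTri M) : latticeVolume ((rowSpan M).map (latHom b)) =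
      ∏ k, if M k k = 0 then 1 else
        ‖InnerProductSpace.gramSchmidt ℝ (fun k => intComb b (M k)) k‖ := by
  rw [map_rowSpan, latticeVolume_span (p := fun k => M k k ≠ 0) (intComb_zero_of_not b h)
    (intComb_indep b h)]
  refine Finset.prod_congr rfl fun k _ => ?_
  by_cases hk : M k k = 0 <;> simp [hk]

theorem latticeDim_tri {d : ℕ} (b : Module.Basis (Fin d) ℝ (E d)) {M : Fin d → Fin d → ℤ}
    (h : IsTri M) : latticeDim ((rowSpan M).map (latHom b)) = ∑ k, if M k k = 0 then 0 else 1 := by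
  rw [map_rowSpan, latticeDim_span (p := fun k => M k k ≠ 0) (intComb_zero_of_not b h)
    (intComb_indep b h)]
  refine Finset.sum_congr rfl fun k _ => ?_
  by_cases hk : M k k = 0 <;> simp [hk]

/-- The identity matrix. -/
def idMat (d : ℕ) : Fin d → Fin d → ℤ := fun k c => if k = c then 1 else 0

theorem idMat_tri (d : ℕ) : IsTri (idMat d) := by
  intro k
  refine ⟨fun c hc => by simp [idMat, hc.ne'], fun h => by simp [idMat] at h⟩

/-- This lets the routine `latVol` also compute the volume of the full lattice, the denominator of
all coefficients. -/
theorem map_rowSpan_idMat {d : ℕ} (b : Module.Basis (Fin d) ℝ (E d)) :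
    (rowSpan (idMat d)).map (latHom b) = latticeOf b := by
  rw [map_rowSpan, latticeOf]
  congr 2
  funext k
  simp [intComb, idMat]

theorem latticeDim_le {d : ℕ} (b : Module.Basis (Fin d) ℝ (E d)) {M : Fin d → Fin d → ℤ}
    (h : IsTri M) : latticeDim ((rowSpan M).map (latHom b)) ≤ d := by
  rw [latticeDim_tri b h]
  calc _ ≤ ∑ k : Fin d, 1 := Finset.sum_le_sum fun k _ => by split_ifs <;> simp
    _ = d := by simp

theorem monoOf_bot {d : ℕ} (b : Module.Basis (Fin d) ℝ (E d)) :
    monoOf b ⊥ = ⟨1 / latticeVolume (latticeOf b) * ballVolume d, d⟩ := by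
  have h : IsTri (0 : Fin d → Fin d → ℤ) := fun k => ⟨fun _ _ => rfl, fun _ => rfl⟩
  have e : rowSpan (0 : Fin d → Fin d → ℤ) = ⊥ := by
    rw [rowSpan, Submodule.span_eq_bot]
    rintro _ ⟨k, rfl⟩; rfl
  have h1 := latticeVolume_tri b h
  have h2 := latticeDim_tri b h
  rw [e] at h1 h2
  simp only [monoOf, h1, h2]
  simp

theorem ballVolume_eq (q : ℕ) : ballVolume q = √Real.pi ^ q / Real.Gamma (q / 2 + 1) := by
  rcases Nat.eq_zero_or_pos q with rfl | hq
  -- In dimension 0 the volume is the Dirac measure of the only point; the general formula requires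
  -- a nonempty index set.
  · have : Metric.ball (0 : E 0) 1 = Set.univ := by
      ext x; simp [Subsingleton.elim x 0]
    rw [ballVolume, this, volume_euclideanSpace_eq_dirac]
    simp
  · have : Nonempty (Fin q) := ⟨⟨0, hq⟩⟩
    rw [ballVolume, EuclideanSpace.volume_ball]
    simp only [ENNReal.ofReal_one, one_pow, one_mul, Fintype.card_fin]
    refine ENNReal.toReal_ofReal ?_
    have : 0 < Real.Gamma (q / 2 + 1) := Real.Gamma_pos_of_pos (by positivity)
    positivity

theorem ballVolume_zero : ballVolume 0 = 1 := by
  simp [ballVolume_eq]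

theorem ballVolume_one : ballVolume 1 = 2 := by
  rw [ballVolume_eq, Nat.cast_one, Real.Gamma_add_one (by norm_num), Real.Gamma_one_half_eq]
  have := Real.sqrt_pos.2 Real.pi_pos
  field_simp

/-- With this recursion the machine tabulates the ball volumes from the constant π, without values
of the Gamma function. -/
theorem ballVolume_add_two (q : ℕ) :
    ballVolume (q + 2) = ballVolume q * (2 * Real.pi / ((q + 2 : ℕ) : ℝ)) := by
  rw [ballVolume_eq, ballVolume_eq]
  have e : ((q + 2 : ℕ) : ℝ) / 2 + 1 = (q / 2 + 1 : ℝ) + 1 := by push_cast; ring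
  have h : (q / 2 + 1 : ℝ) ≠ 0 := by positivity
  have h' : 0 < Real.Gamma (q / 2 + 1) := Real.Gamma_pos_of_pos (by positivity)
  rw [e, Real.Gamma_add_one h, pow_add, Real.sq_sqrt Real.pi_pos.le]
  push_cast
  field_simp


/-! ### Cells and their vertices -/

namespace CellComplex

variable {d : ℕ} {K : CellComplex d}

theorem isCompact_cell {σ : Set (E d)} (hσ : σ ∈ K.cells) : IsCompact σ := by
  obtain ⟨h, -⟩ := K.ball σ hσ
  have : CompactSpace σ := h.compactSpace
  exact isCompact_iff_compactSpace.2 this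

theorem isClosed_cell {σ : Set (E d)} (hσ : σ ∈ K.cells) : IsClosed σ := (isCompact_cell hσ).isClosed

theorem isPreconnected_cell {σ : Set (E d)} (hσ : σ ∈ K.cells) : IsPreconnected σ := by
  obtain ⟨h, -⟩ := K.ball σ hσ
  have : PreconnectedSpace (Metric.closedBall (0 : E (K.dim σ)) 1) :=
    isPreconnected_iff_preconnectedSpace.1 (convex_closedBall _ _).isPreconnected
  have : PreconnectedSpace σ := h.surjective.denseRange.preconnectedSpace h.continuous
  exact isPreconnected_iff_preconnectedSpace.2 this

/-- Local finiteness makes arbitrary unions of cells closed. This is what allows arguments with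
disjoint closed covers below. -/
theorem isClosed_sUnion {S : Set (Set (E d))} (hS : S ⊆ K.cells) : IsClosed (⋃₀ S) := by
  rw [Set.sUnion_eq_iUnion]
  have h : LocallyFinite (fun σ : S => (σ : Set (E d))) :=
    K.locallyFinite.comp_injective (g := fun σ : S => (⟨σ, hS σ.2⟩ : K.cells))
      (fun σ τ h => Subtype.ext (by simpa using h))
  exact h.isClosed_iUnion fun σ => isClosed_cell (hS σ.2)

/-- Every cell contains a vertex. -/
theorem exists_vertex {σ : Set (E d)} (hσ : σ ∈ K.cells) : ∃ x ∈ K.vertices, x ∈ σ := by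
  induction hk : K.dim σ using Nat.strong_induction_on generalizing σ with
  | _ k ih =>
    obtain ⟨h, hb⟩ := K.ball σ hσ
    rcases Nat.eq_zero_or_pos (K.dim σ) with h0 | h0
    · have hs : Subsingleton (E (K.dim σ)) := by rw [h0]; infer_instance
      let y : Metric.closedBall (0 : E (K.dim σ)) 1 := ⟨0, by simp⟩
      have hx : σ = {(h y : E d)} := by
        refine Set.eq_singleton_iff_unique_mem.2 ⟨(h y).2, fun z hz => ?_⟩
        obtain ⟨w, hw⟩ := h.surjective ⟨z, hz⟩
        have : w = y := Subtype.ext (Subsingleton.elim _ _)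
        rw [← this, hw]
      exact ⟨h y, ⟨hx ▸ hσ, hx ▸ h0⟩, (h y).2⟩
    -- In positive dimension the boundary sphere is nonempty, so the cell has a proper face, which
    -- contains a vertex by induction.
    · have : Nontrivial (E (K.dim σ)) := by
        have : Nonempty (Fin (K.dim σ)) := ⟨⟨0, h0⟩⟩
        infer_instance
      obtain ⟨y, hy⟩ := exists_norm_eq (E (K.dim σ)) zero_le_one
      have hmem : (h ⟨y, by simp [hy]⟩ : E d) ∈ ⋃₀ {ρ | IsFace K.cells K.dim ρ σ} := by
        rw [← hb]; exact ⟨⟨y, by simp [hy]⟩, hy, rfl⟩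
      obtain ⟨ρ, hρ, -⟩ := hmem
      obtain ⟨x, hx, hxρ⟩ := ih _ (hk ▸ hρ.2.1) hρ.1 rfl
      exact ⟨x, hx, hρ.2.2 hxρ⟩

/-- Different intersecting cells have a common face, and any face has a vertex. Thus contact of
cells is always detected at vertices. -/
theorem exists_common_vertex {σ τ : Set (E d)} (hσ : σ ∈ K.cells) (hτ : τ ∈ K.cells) {x : E d}
    (h1 : x ∈ σ) (h2 : x ∈ τ) : ∃ v ∈ K.vertices, v ∈ σ ∧ v ∈ τ := by
  by_cases h : σ = τ
  · obtain ⟨v, hv, hvσ⟩ := exists_vertex hσ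
    exact ⟨v, hv, hvσ, h ▸ hvσ⟩
  · have hx : x ∈ σ ∩ τ := ⟨h1, h2⟩
    rw [K.inter σ hσ τ hτ h] at hx
    obtain ⟨ρ, ⟨hρ, hρσ, hρτ⟩, -⟩ := hx
    obtain ⟨v, hv, hvρ⟩ := exists_vertex hρ
    refine ⟨v, hv, ?_, ?_⟩
    · rcases hρσ with rfl | h
      exacts [hvρ, h.2.2 hvρ]
    · rcases hρτ with rfl | h
      exacts [hvρ, h.2.2 hvρ]

/-- A vertex in a cell is the cell or a face of it. -/
theorem vertex_eq_or_isFace {σ : Set (E d)} (hσ : σ ∈ K.cells) {x : E d} (hx : x ∈ K.vertices)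
    (hxσ : x ∈ σ) : {x} = σ ∨ IsFace K.cells K.dim {x} σ := by
  by_cases h : σ = {x}
  · exact Or.inl h.symm
  · have hx' : x ∈ σ ∩ {x} := ⟨hxσ, rfl⟩
    rw [K.inter σ hσ {x} hx.1 h] at hx'
    obtain ⟨ρ, ⟨-, hρσ, hρx⟩, -⟩ := hx'
    rcases hρx with rfl | h'
    · exact hρσ
    · have := h'.2.1
      rw [hx.2] at this
      omega

/-- A function on the vertices that is constant on every cell is constant on connected unions. -/
theorem eq_of_preconnected {α : Type*} {S : Set (Set (E d))} (hS : S ⊆ K.cells) {c : E d → α}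
    (hc : ∀ σ ∈ S, ∀ x ∈ K.vertices, ∀ y ∈ K.vertices, x ∈ σ → y ∈ σ → c x = c y)
    {Z : Set (E d)} (hZ : IsPreconnected Z) (hZS : Z ⊆ ⋃₀ S) {σ τ : Set (E d)} (hσ : σ ∈ S)
    (hτ : τ ∈ S) (hσZ : (Z ∩ σ).Nonempty) (hτZ : (Z ∩ τ).Nonempty) {v w : E d}
    (hv : v ∈ K.vertices) (hvσ : v ∈ σ) (hw : w ∈ K.vertices) (hwτ : w ∈ τ) : c v = c w := by
  by_contra hne
  -- Otherwise the cells with a vertex of value `c v` and the remaining ones give two closed sets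
  -- that cover `Z` and both meet it. They intersect by connectedness, and a common vertex of two
  -- intersecting cells gives a contradiction.
  let A := ⋃₀ {ρ | ρ ∈ S ∧ ∃ x ∈ K.vertices, x ∈ ρ ∧ c x = c v}
  let B := ⋃₀ {ρ | ρ ∈ S ∧ ¬ ∃ x ∈ K.vertices, x ∈ ρ ∧ c x = c v}
  have hA : IsClosed A := isClosed_sUnion fun ρ h => hS h.1
  have hB : IsClosed B := isClosed_sUnion fun ρ h => hS h.1
  have hAB : Z ⊆ A ∪ B := by
    intro z hz
    obtain ⟨ρ, hρ, hzρ⟩ := hZS hz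
    by_cases h : ∃ x ∈ K.vertices, x ∈ ρ ∧ c x = c v
    · exact Or.inl ⟨ρ, ⟨hρ, h⟩, hzρ⟩
    · exact Or.inr ⟨ρ, ⟨hρ, h⟩, hzρ⟩
  have h1 : (Z ∩ A).Nonempty := hσZ.mono fun z hz => ⟨hz.1, σ, ⟨hσ, v, hv, hvσ, rfl⟩, hz.2⟩
  have h2 : (Z ∩ B).Nonempty := hτZ.mono fun z hz => ⟨hz.1, τ, ⟨hτ, by
    rintro ⟨x, hx, hxτ, hxv⟩
    exact hne (hxv.symm.trans (hc τ hτ x hx w hw hxτ hwτ))⟩, hz.2⟩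
  obtain ⟨z, -, ⟨ρ, ⟨hρ, x, hx, hxρ, hxv⟩, hzρ⟩, ρ', ⟨hρ', hno⟩, hzρ'⟩ :=
    (isPreconnected_closed_iff.1 hZ) A B hA hB hAB h1 h2
  obtain ⟨u, hu, huρ, huρ'⟩ := exists_common_vertex (hS hρ) (hS hρ') hzρ hzρ'
  exact hno ⟨u, hu, huρ', (hc ρ hρ u hu x hx huρ hxρ).trans hxv⟩

/-- A function on the vertices that is constant on the edges is constant on all cells. -/
theorem eq_of_edges {α : Type*} {S : Set (Set (E d))} (hS : S ⊆ K.cells)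
    (hface : ∀ σ ∈ S, ∀ ρ, IsFace K.cells K.dim ρ σ → ρ ∈ S) {c : E d → α}
    (hc : ∀ σ ∈ S, σ ∈ K.edges → ∀ x ∈ K.vertices, ∀ y ∈ K.vertices, x ∈ σ → y ∈ σ → c x = c y)
    {σ : Set (E d)} (hσ : σ ∈ S) {x y : E d} (hx : x ∈ K.vertices) (hy : y ∈ K.vertices)
    (hxσ : x ∈ σ) (hyσ : y ∈ σ) : c x = c y := by
  induction hk : K.dim σ using Nat.strong_induction_on generalizing σ x y with
  | _ k ih =>
    rcases vertex_eq_or_isFace (hS hσ) hx hxσ with h | hxf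
    · rw [← h] at hyσ
      rw [Set.mem_singleton_iff.1 hyσ]
    rcases vertex_eq_or_isFace (hS hσ) hy hyσ with h | hyf
    · rw [← h] at hxσ
      rw [Set.mem_singleton_iff.1 hxσ]
    -- From dimension 2 on, the boundary is a connected union of cells of lower dimension, and the
    -- induction hypothesis propagates along it. In dimension 1 the boundary is disconnected, and
    -- the assumption on edges is used.
    rcases Nat.lt_or_ge 1 (K.dim σ) with h1 | h1
    · obtain ⟨h, hb⟩ := K.ball σ (hS hσ)
      have hrank : 1 < Module.rank ℝ (E (K.dim σ)) := by
        rw [← Module.finrank_eq_rank, finrank_euclideanSpace_fin]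
        exact_mod_cast h1
      have hZ : IsPreconnected (⋃₀ {ρ | IsFace K.cells K.dim ρ σ}) := by
        have hs := isPreconnected_sphere hrank (0 : E (K.dim σ)) 1
        have hs' : IsPreconnected {y : Metric.closedBall (0 : E (K.dim σ)) 1 | ‖(y : E (K.dim σ))‖ = 1} := by
          rw [← Topology.IsInducing.subtypeVal.isPreconnected_image]
          have e : Subtype.val '' {y : Metric.closedBall (0 : E (K.dim σ)) 1 | ‖(y : E (K.dim σ))‖ = 1}
              = Metric.sphere (0 : E (K.dim σ)) 1 := by
            apply Set.Subset.antisymm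
            · rintro _ ⟨z, hz, rfl⟩
              exact mem_sphere_zero_iff_norm.2 hz
            · intro y hy
              exact ⟨⟨y, Metric.sphere_subset_closedBall hy⟩, mem_sphere_zero_iff_norm.1 hy, rfl⟩
          rw [e]
          exact hs
        rw [← hb]
        exact hs'.image (fun y => (h y : E d))
          (continuous_subtype_val.comp h.continuous).continuousOn
      refine eq_of_preconnected (S := {ρ | IsFace K.cells K.dim ρ σ}) (fun ρ h => h.1) ?_ hZ
        subset_rfl hxf hyf ⟨x, ⟨_, hxf, rfl⟩, rfl⟩ ⟨y, ⟨_, hyf, rfl⟩, rfl⟩ hx rfl hy rfl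
      intro ρ hρ v hv w hw hvρ hwρ
      exact ih _ (hk ▸ hρ.2.1) (hface σ hσ ρ hρ) hv hw hvρ hwρ rfl
    · have h0 := hxf.2.1
      exact hc σ hσ ⟨hS hσ, by omega⟩ x hx y hy hxσ hyσ

/-- The cells of a sublevel set. -/
def lowCells (K : CellComplex d) (f : Set (E d) → ℝ) (t : ℝ) : Set (Set (E d)) :=
  {σ | σ ∈ K.cells ∧ f σ ≤ t}

theorem lowCells_face {f : Set (E d) → ℝ} (hf : K.IsFilter f) {t : ℝ} {σ : Set (E d)}
    (hσ : σ ∈ K.lowCells f t) {ρ : Set (E d)} (h : IsFace K.cells K.dim ρ σ) :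
    ρ ∈ K.lowCells f t := ⟨h.1, (hf ρ h.1 σ hσ.1 h).trans hσ.2⟩

theorem vertex_le {f : Set (E d) → ℝ} (hf : K.IsFilter f) {σ : Set (E d)}
    (hσ : σ ∈ K.cells) {x : E d} (hx : x ∈ K.vertices) (hxσ : x ∈ σ) : f {x} ≤ f σ := by
  rcases vertex_eq_or_isFace hσ hx hxσ with h | h
  · rw [h]
  · exact hf _ h.1 _ hσ h

end CellComplex


/-! ### Components of sublevel sets -/

section
variable {d : ℕ} (b : Module.Basis (Fin d) ℝ (E d))

theorem latticeVector_add (k l : Fin d → ℤ) :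
    latticeVector b (k + l) = latticeVector b k + latticeVector b l := by
  simp only [← latHom_apply, map_add]

theorem latticeVector_sub (k l : Fin d → ℤ) :
    latticeVector b (k - l) = latticeVector b k - latticeVector b l := by
  simp only [← latHom_apply, map_sub]

theorem latticeVector_zero : latticeVector b 0 = 0 := by
  simp only [← latHom_apply, map_zero]

theorem latticeVector_mem (k : Fin d → ℤ) : latticeVector b k ∈ latticeOf b :=
  Submodule.sum_mem _ fun i _ => Submodule.smul_mem _ _ (Submodule.subset_span ⟨i, rfl⟩)

theorem mem_latticeOf {u : E d} : u ∈ latticeOf b ↔ ∃ k, u = latticeVector b k := by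
  rw [latticeOf, Submodule.mem_span_range_iff_exists_fun]
  exact exists_congr fun k => eq_comm

theorem latticeVector_injective : Function.Injective (latticeVector b) := by
  intro k l h
  have h0 : ∑ i, ((k i - l i : ℤ) : ℝ) • b i = 0 := by
    have := sub_eq_zero.2 h
    rw [← latticeVector_sub] at this
    simpa only [latticeVector, Int.cast_smul_eq_zsmul, Pi.sub_apply] using this
  funext i
  have := Fintype.linearIndependent_iff.1 b.linearIndependent _ h0 i
  have : k i - l i = 0 := by exact_mod_cast this
  omega

end

theorem translate_singleton {d : ℕ} (u x : E d) : translate u {x} = {u + x} := by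
  simp [translate]

theorem mem_translate {d : ℕ} {u x : E d} {σ : Set (E d)} : x ∈ translate u σ ↔ x - u ∈ σ := by
  constructor
  · rintro ⟨y, hy, rfl⟩; simpa using hy
  · exact fun h => ⟨x - u, h, by simp⟩

namespace QuotientGraph

variable {d n m : ℕ} {K : CellComplex d} {b : Module.Basis (Fin d) ℝ (E d)}
  {f : Set (E d) → ℝ} (hK : K.IsPeriodic (latticeOf b)) (hf : K.IsPeriodicFilter (latticeOf b) f)
  (G : QuotientGraph K b n m)

/-- The quotient graph without its geometry. -/
def graph : ShiftGraph n m d := ⟨G.src, G.tgt, G.shift⟩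

/-- The vertices of the complex, in coordinates. -/
def node (p : Fin n × (Fin d → ℤ)) : E d := latticeVector b p.2 + G.vertex p.1

variable (f)

/-- The values of the vertices. -/
def vb (i : Fin n) : ℝ := f {G.vertex i}

/-- The values of the edges. -/
def ev (j : Fin m) : ℝ := f (G.edge j)

variable {f}

theorem node_zero (i : Fin n) : G.node (i, 0) = G.vertex i := by
  simp [node, latticeVector_zero]

theorem node_add (i : Fin n) (k l : Fin d → ℤ) :
    G.node (i, k + l) = latticeVector b l + G.node (i, k) := by
  simp only [node, latticeVector_add]; abel

include hK in
theorem translate_vertex {u x : E d} (hu : u ∈ latticeOf b) (hx : x ∈ K.vertices) :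
    u + x ∈ K.vertices := by
  obtain ⟨h1, h2⟩ := hK _ hx.1 u hu
  rw [translate_singleton] at h1 h2
  exact ⟨h1, h2.trans hx.2⟩

include hK in
theorem node_mem (p : Fin n × (Fin d → ℤ)) : G.node p ∈ K.vertices :=
  translate_vertex hK (latticeVector_mem b _) (G.vertex_mem _)

theorem exists_node {x : E d} (hx : x ∈ K.vertices) : ∃ p, x = G.node p := by
  obtain ⟨i, ⟨u, hu, rfl⟩, -⟩ := G.vertex_unique x hx
  obtain ⟨k, rfl⟩ := (mem_latticeOf b).1 hu
  exact ⟨(i, k), rfl⟩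

include hK in
theorem node_injective : Function.Injective G.node := by
  rintro ⟨i, k⟩ ⟨j, l⟩ h
  obtain ⟨_, -, hu⟩ := G.vertex_unique _ (G.node_mem hK (i, k))
  have h1 := hu i ⟨_, latticeVector_mem b k, rfl⟩
  have h2 := hu j ⟨_, latticeVector_mem b l, h⟩
  obtain rfl : i = j := h1.trans h2.symm
  have : k = l := latticeVector_injective b (add_right_cancel (b := G.vertex i) h)
  rw [this]

include hf in
theorem f_node (p : Fin n × (Fin d → ℤ)) : f {G.node p} = G.vb f p.1 := by
  have := hf.2 _ (G.vertex_mem p.1).1 _ (latticeVector_mem b p.2)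
  rwa [translate_singleton] at this

include hK hf in
theorem translate_lowCells {t : ℝ} {σ : Set (E d)} (hσ : σ ∈ K.lowCells f t) {u : E d}
    (hu : u ∈ latticeOf b) : translate u σ ∈ K.lowCells f t :=
  ⟨(hK σ hσ.1 u hu).1, (hf.2 σ hσ.1 u hu).le.trans hσ.2⟩

include hf in
theorem vb_le {σ : Set (E d)} (hK : K.IsPeriodic (latticeOf b)) (hσ : σ ∈ K.cells)
    {p : Fin n × (Fin d → ℤ)} (hp : G.node p ∈ σ) : G.vb f p.1 ≤ f σ := by
  rw [← G.f_node hf]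
  exact CellComplex.vertex_le hf.1 hσ (G.node_mem hK p) hp

include hf in
theorem node_lowCells (hK : K.IsPeriodic (latticeOf b)) {p : Fin n × (Fin d → ℤ)} {t : ℝ}
    (hp : G.vb f p.1 ≤ t) : {G.node p} ∈ K.lowCells f t :=
  ⟨(G.node_mem hK p).1, (G.f_node hf p).le.trans hp⟩

theorem mem_edge_iff (hK : K.IsPeriodic (latticeOf b)) (j : Fin m) (p : Fin n × (Fin d → ℤ)) :
    G.node p ∈ G.edge j ↔ p = (G.src j, G.srcCell j) ∨ p = (G.tgt j, G.tgtCell j) := by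
  have h : G.node p ∈ {x | x ∈ K.vertices ∧ x ∈ G.edge j} ↔ G.node p ∈ G.edge j :=
    ⟨fun h => h.2, fun h => ⟨G.node_mem hK p, h⟩⟩
  have h1 : latticeVector b (G.srcCell j) + G.vertex (G.src j) = G.node (G.src j, G.srcCell j) := rfl
  have h2 : latticeVector b (G.tgtCell j) + G.vertex (G.tgt j) = G.node (G.tgt j, G.tgtCell j) := rfl
  rw [← h, G.endpoints, h1, h2, Set.mem_insert_iff, Set.mem_singleton_iff,
    (G.node_injective hK).eq_iff, (G.node_injective hK).eq_iff]

variable (f)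

/-- The nodes that are connected with a point by edges of value at most `t`. -/
def nodeClass (t : ℝ) (x : E d) : Set (Fin n × (Fin d → ℤ)) :=
  {q | ∃ p, x = G.node p ∧ G.graph.Conn (lowEdges (G.ev f) t) p q}

variable {f}

include hK in
theorem nodeClass_node (t : ℝ) (p : Fin n × (Fin d → ℤ)) :
    G.nodeClass f t (G.node p) = {q | G.graph.Conn (lowEdges (G.ev f) t) p q} := by
  ext q
  constructor
  · rintro ⟨p', h, hq⟩
    rwa [G.node_injective hK h]
  · exact fun h => ⟨p, rfl, h⟩

include hK in
-- Connectivity becomes equality of values of a function on points, which is the form required by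
-- `eq_of_edges` and `eq_of_preconnected`.
theorem nodeClass_eq_iff {t : ℝ} {p q : Fin n × (Fin d → ℤ)} :
    G.nodeClass f t (G.node p) = G.nodeClass f t (G.node q) ↔
      G.graph.Conn (lowEdges (G.ev f) t) p q := by
  rw [G.nodeClass_node hK, G.nodeClass_node hK]
  constructor
  · intro h
    have : q ∈ {q | G.graph.Conn (lowEdges (G.ev f) t) p q} := by
      rw [h]; exact .refl _
    exact this
  · intro h
    ext r
    exact ⟨fun h' => h.symm.trans h', fun h' => h.trans h'⟩

include hK hf in
theorem conn_of_mem_edge {t : ℝ} {σ : Set (E d)} (hσ : σ ∈ K.lowCells f t) (he : σ ∈ K.edges)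
    {p q : Fin n × (Fin d → ℤ)} (hp : G.node p ∈ σ) (hq : G.node q ∈ σ) :
    G.graph.Conn (lowEdges (G.ev f) t) p q := by
  obtain ⟨j, ⟨u, hu, rfl⟩, -⟩ := G.edge_unique σ he
  obtain ⟨k, rfl⟩ := (mem_latticeOf b).1 hu
  have hj : j ∈ lowEdges (G.ev f) t :=
    (hf.2 _ (G.edge_mem j).1 _ (latticeVector_mem b k)).ge.trans hσ.2
  have key : ∀ p, G.node p ∈ translate (latticeVector b k) (G.edge j) →
      G.graph.Conn (lowEdges (G.ev f) t) (G.src j, G.srcCell j + k) p := by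
    rintro ⟨i, l⟩ h
    have e : G.node (i, l) - latticeVector b k = G.node (i, l - k) := by
      rw [sub_eq_add_neg l k, node_add, ← zero_sub, latticeVector_sub, latticeVector_zero]; abel
    rw [mem_translate, e, G.mem_edge_iff hK, Prod.mk.injEq, Prod.mk.injEq] at h
    rcases h with ⟨rfl, h⟩ | ⟨rfl, h⟩
    · rw [← h, sub_add_cancel]; exact .refl _
    · have := ShiftGraph.Conn.edge (Γ := G.graph) hj (G.srcCell j + k)
      have e2 : G.srcCell j + k + G.graph.sh j = l := by
        rw [sub_eq_iff_eq_add] at h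
        rw [h]
        funext c
        simp only [graph, shift, Pi.add_apply]
        ring
      rwa [e2] at this
  exact (key p hp).symm.trans (key q hq)

include hK hf in
theorem nodeClass_const {t : ℝ} {σ : Set (E d)} (hσ : σ ∈ K.lowCells f t) {x y : E d}
    (hx : x ∈ K.vertices) (hy : y ∈ K.vertices) (hxσ : x ∈ σ) (hyσ : y ∈ σ) :
    G.nodeClass f t x = G.nodeClass f t y := by
  refine CellComplex.eq_of_edges (S := K.lowCells f t) (fun _ h => h.1)
    (fun σ hσ ρ h => CellComplex.lowCells_face hf.1 hσ h) ?_ hσ hx hy hxσ hyσ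
  intro σ hσ he x hx y hy hxσ hyσ
  obtain ⟨p, rfl⟩ := G.exists_node hx
  obtain ⟨q, rfl⟩ := G.exists_node hy
  exact (G.nodeClass_eq_iff hK).2 (G.conn_of_mem_edge hK hf hσ he hxσ hyσ)

include hK hf in
theorem conn_of_mem {t : ℝ} {σ : Set (E d)} (hσ : σ ∈ K.lowCells f t)
    {p q : Fin n × (Fin d → ℤ)} (hp : G.node p ∈ σ) (hq : G.node q ∈ σ) :
    G.graph.Conn (lowEdges (G.ev f) t) p q :=
  (G.nodeClass_eq_iff hK).1 (G.nodeClass_const hK hf hσ (G.node_mem hK p) (G.node_mem hK q) hp hq)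

variable (f)

/-- The union of the cells of value at most `t` that are connected with a node. -/
def comp (t : ℝ) (p : Fin n × (Fin d → ℤ)) : Set (E d) :=
  ⋃₀ {σ | σ ∈ K.lowCells f t ∧ ∃ q, G.graph.Conn (lowEdges (G.ev f) t) p q ∧ G.node q ∈ σ}

variable {f}

theorem comp_subset (t : ℝ) (p : Fin n × (Fin d → ℤ)) : G.comp f t p ⊆ K.sublevel f t :=
  Set.sUnion_subset_sUnion fun _ h => h.1

include hf in
theorem node_mem_comp (hK : K.IsPeriodic (latticeOf b)) {t : ℝ} {p : Fin n × (Fin d → ℤ)}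
    (hp : G.vb f p.1 ≤ t) : G.node p ∈ G.comp f t p :=
  ⟨_, ⟨G.node_lowCells hf hK hp, p, .refl _, rfl⟩, rfl⟩

include hf in
theorem connectedComponentIn_eq_of_conn (hK : K.IsPeriodic (latticeOf b)) {t : ℝ}
    {p q : Fin n × (Fin d → ℤ)} (h : G.graph.Conn (lowEdges (G.ev f) t) p q) :
    connectedComponentIn (K.sublevel f t) (G.node p) =
      connectedComponentIn (K.sublevel f t) (G.node q) := by
  refine ShiftGraph.conn_le (S := fun p q => connectedComponentIn (K.sublevel f t) (G.node p) =
      connectedComponentIn (K.sublevel f t) (G.node q)) ⟨fun _ => rfl, fun h => h.symm,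
    fun h h' => h.trans h'⟩ (fun j hj k => ?_) h
  set σ := translate (latticeVector b (k - G.srcCell j)) (G.edge j) with hσ
  have hmem := latticeVector_mem b (k - G.srcCell j)
  have hσl : σ ∈ K.lowCells f t := translate_lowCells hK hf ⟨(G.edge_mem j).1, hj⟩ hmem
  have h1 : G.node (G.src j, k) ∈ σ := by
    have : G.node (G.src j, G.srcCell j) ∈ G.edge j := (G.mem_edge_iff hK j _).2 (Or.inl rfl)
    refine ⟨_, this, ?_⟩
    simp only [← node_add]
    rw [add_sub_cancel]
  have h2 : G.node (G.tgt j, k + G.shift j) ∈ σ := by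
    have : G.node (G.tgt j, G.tgtCell j) ∈ G.edge j := (G.mem_edge_iff hK j _).2 (Or.inr rfl)
    refine ⟨_, this, ?_⟩
    simp only [← node_add]
    congr 2
    funext c
    simp only [shift, Pi.add_apply, Pi.sub_apply]
    ring
  have hsub : σ ⊆ K.sublevel f t := Set.subset_sUnion_of_mem hσl
  exact connectedComponentIn_eq
    ((CellComplex.isPreconnected_cell hσl.1).subset_connectedComponentIn h1 hsub h2)

include hf in
-- The component is no larger because `nodeClass` is constant on connected unions of cells, and no
-- smaller because walks in the graph run along edges in the sublevel set and cells are connected.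
theorem connectedComponentIn_node (hK : K.IsPeriodic (latticeOf b)) {t : ℝ}
    {p : Fin n × (Fin d → ℤ)} (hp : G.vb f p.1 ≤ t) :
    connectedComponentIn (K.sublevel f t) (G.node p) = G.comp f t p := by
  have hpX : G.node p ∈ K.sublevel f t := G.comp_subset t p (G.node_mem_comp hf hK hp)
  apply Set.Subset.antisymm
  · intro x hx
    obtain ⟨σ, hσ, hxσ⟩ := connectedComponentIn_subset _ _ hx
    obtain ⟨v, hv, hvσ⟩ := CellComplex.exists_vertex hσ.1
    obtain ⟨q, rfl⟩ := G.exists_node hv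
    refine ⟨σ, ⟨hσ, q, ?_, hvσ⟩, hxσ⟩
    rw [← G.nodeClass_eq_iff hK]
    exact CellComplex.eq_of_preconnected (S := K.lowCells f t) (fun _ h => h.1)
      (fun σ hσ x hx y hy => G.nodeClass_const hK hf hσ hx hy) isPreconnected_connectedComponentIn
      (connectedComponentIn_subset _ _) (G.node_lowCells hf hK hp) hσ
      ⟨_, mem_connectedComponentIn hpX, rfl⟩ ⟨x, hx, hxσ⟩ (G.node_mem hK p) rfl hv hvσ
  · rintro x ⟨σ, ⟨hσ, q, hpq, hq⟩, hx⟩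
    rw [G.connectedComponentIn_eq_of_conn hf hK hpq]
    exact (CellComplex.isPreconnected_cell hσ.1).subset_connectedComponentIn hq
      (Set.subset_sUnion_of_mem hσ) hx

include hf in
theorem comp_eq_iff (hK : K.IsPeriodic (latticeOf b)) {t : ℝ} {p q : Fin n × (Fin d → ℤ)}
    (hq : G.vb f q.1 ≤ t) :
    G.comp f t p = G.comp f t q ↔ G.graph.Conn (lowEdges (G.ev f) t) p q := by
  constructor
  · intro h
    have hm := G.node_mem_comp hf hK hq
    rw [← h] at hm
    obtain ⟨σ, ⟨hσ, r, hpr, hr⟩, hqσ⟩ := hm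
    exact hpr.trans (G.conn_of_mem hK hf hσ hr hqσ)
  · intro h
    have : ∀ r, G.graph.Conn (lowEdges (G.ev f) t) p r ↔ G.graph.Conn (lowEdges (G.ev f) t) q r :=
      fun r => ⟨fun h' => h.symm.trans h', fun h' => h.trans h'⟩
    simp only [comp, this]

include hf in
theorem translate_comp (hK : K.IsPeriodic (latticeOf b)) (t : ℝ) (i : Fin n) (k l : Fin d → ℤ) :
    translate (latticeVector b l) (G.comp f t (i, k)) = G.comp f t (i, k + l) := by
  have key : ∀ (k l : Fin d → ℤ), translate (latticeVector b l) (G.comp f t (i, k)) ⊆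
      G.comp f t (i, k + l) := by
    rintro k l _ ⟨x, ⟨σ, ⟨hσ, ⟨j, q⟩, hpq, hq⟩, hx⟩, rfl⟩
    refine ⟨translate (latticeVector b l) σ,
      ⟨translate_lowCells hK hf hσ (latticeVector_mem b l), (j, q + l), hpq.shift l, ?_⟩, x, hx, rfl⟩
    exact ⟨_, hq, (G.node_add j q l).symm⟩
  refine (key k l).antisymm fun x hx => ?_
  rw [mem_translate]
  have := key (k + l) (-l) ⟨x, hx, rfl⟩
  rw [add_neg_cancel_right, ← zero_sub, latticeVector_sub, latticeVector_zero] at this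
  simpa [sub_eq_add_neg, add_comm] using this

end QuotientGraph


/-! ### Components in the torus -/

theorem proj_eq_iff {d : ℕ} {Λ : Submodule ℤ (E d)} {x y : E d} :
    proj Λ x = proj Λ y ↔ y - x ∈ Λ := by
  rw [proj, proj, QuotientAddGroup.eq, neg_add_eq_sub]
  exact Submodule.mem_toAddSubgroup _

/-- Openness is essential: the product of an open quotient map with the identity of the line is
again a quotient map, so closedness in the torus times the line can be tested upstairs. -/
theorem isOpenQuotientMap_proj {d : ℕ} (Λ : Submodule ℤ (E d)) : IsOpenQuotientMap (proj Λ) :=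
  ⟨QuotientAddGroup.mk_surjective, continuous_quot_mk, QuotientAddGroup.isOpenMap_coe⟩

/-- A closed set of points that is invariant under translations has a closed projection. -/
theorem isClosed_proj_image {d : ℕ} {Λ : Submodule ℤ (E d)} {A : Set (E d)} (hA : IsClosed A)
    (h : ∀ u ∈ Λ, ∀ x ∈ A, u + x ∈ A) : IsClosed (proj Λ '' A) := by
  rw [← (isOpenQuotientMap_proj Λ).isQuotientMap.isClosed_preimage]
  convert hA using 1
  apply Set.Subset.antisymm
  · rintro x ⟨y, hy, hyx⟩
    have := h _ (proj_eq_iff.1 hyx) y hy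
    simpa using this
  · exact Set.subset_preimage_image _ _

namespace QuotientGraph

variable {d n m : ℕ} {K : CellComplex d} {b : Module.Basis (Fin d) ℝ (E d)}
  {f : Set (E d) → ℝ} (hK : K.IsPeriodic (latticeOf b)) (hf : K.IsPeriodicFilter (latticeOf b) f)
  (G : QuotientGraph K b n m)

variable (f)

/-- The cells of value at most `t` that are connected with a vertex of the quotient. -/
def qcells (t : ℝ) (i : Fin n) : Set (Set (E d)) :=
  {σ | σ ∈ K.lowCells f t ∧ ∃ q, G.graph.QConn (lowEdges (G.ev f) t) i q.1 ∧ G.node q ∈ σ}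

/-- The other cells of value at most `t`. -/
def ocells (t : ℝ) (i : Fin n) : Set (Set (E d)) :=
  {σ | σ ∈ K.lowCells f t ∧ ¬ ∃ q, G.graph.QConn (lowEdges (G.ev f) t) i q.1 ∧ G.node q ∈ σ}

/-- A component in the quotient. -/
def tcomp (t : ℝ) (i : Fin n) : Set (Torus (latticeOf b)) :=
  proj (latticeOf b) '' G.comp f t (i, 0)

variable {f}

theorem qcells_sUnion (t : ℝ) (i : Fin n) : ⋃₀ G.qcells f t i = ⋃ k, G.comp f t (i, k) := by
  ext x
  simp only [Set.mem_iUnion]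
  constructor
  · rintro ⟨σ, ⟨hσ, q, ⟨l, hq⟩, hqσ⟩, hx⟩
    exact ⟨q.2 - l, σ, ⟨hσ, q, hq.of_shift (by simp), hqσ⟩, hx⟩
  · rintro ⟨k, σ, ⟨hσ, q, hq, hqσ⟩, hx⟩
    exact ⟨σ, ⟨hσ, q, .of_conn hq, hqσ⟩, hx⟩

include hf in
theorem preimage_tcomp (hK : K.IsPeriodic (latticeOf b)) (t : ℝ) (i : Fin n) :
    proj (latticeOf b) ⁻¹' (G.tcomp f t i) = ⋃₀ G.qcells f t i := by
  rw [qcells_sUnion]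
  ext x
  simp only [Set.mem_iUnion]
  constructor
  · rintro ⟨y, hy, hyx⟩
    obtain ⟨k, hk⟩ := (mem_latticeOf b).1 (proj_eq_iff.1 hyx)
    refine ⟨0 + k, ?_⟩
    rw [← G.translate_comp hf hK]
    exact ⟨y, hy, by simp [← hk]⟩
  · rintro ⟨k, hx⟩
    rw [← zero_add k, ← G.translate_comp hf hK] at hx
    obtain ⟨y, hy, rfl⟩ := hx
    refine ⟨y, hy, proj_eq_iff.2 ?_⟩
    simpa using latticeVector_mem b k

theorem add_mem_sUnion_of_translate {S : Set (Set (E d))} {Λ : Submodule ℤ (E d)}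
    (h : ∀ σ ∈ S, ∀ u ∈ Λ, translate u σ ∈ S) : ∀ u ∈ Λ, ∀ x ∈ ⋃₀ S, u + x ∈ ⋃₀ S := by
  rintro u hu x ⟨σ, hσ, hx⟩
  exact ⟨_, h σ hσ u hu, x, hx, rfl⟩

theorem node_mem_translate_iff (k : Fin d → ℤ) (q : Fin n × (Fin d → ℤ)) (σ : Set (E d)) :
    G.node q ∈ translate (latticeVector b k) σ ↔ G.node (q.1, q.2 - k) ∈ σ := by
  have e : G.node q - latticeVector b k = G.node (q.1, q.2 - k) := by
    simp only [node, latticeVector_sub]; abel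
  rw [mem_translate, e]

include hf in
theorem translate_qcells (hK : K.IsPeriodic (latticeOf b)) (t : ℝ) (i : Fin n) :
    ∀ σ ∈ G.qcells f t i, ∀ u ∈ latticeOf b, translate u σ ∈ G.qcells f t i := by
  rintro σ ⟨hσ, q, hq, hqσ⟩ u hu
  refine ⟨translate_lowCells hK hf hσ hu, ?_⟩
  obtain ⟨k, rfl⟩ := (mem_latticeOf b).1 hu
  exact ⟨(q.1, q.2 + k), hq, by rw [node_mem_translate_iff]; simpa using hqσ⟩

include hf in
theorem translate_ocells (hK : K.IsPeriodic (latticeOf b)) (t : ℝ) (i : Fin n) :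
    ∀ σ ∈ G.ocells f t i, ∀ u ∈ latticeOf b, translate u σ ∈ G.ocells f t i := by
  rintro σ ⟨hσ, hq⟩ u hu
  refine ⟨translate_lowCells hK hf hσ hu, ?_⟩
  obtain ⟨k, rfl⟩ := (mem_latticeOf b).1 hu
  rintro ⟨q, hq', hqσ⟩
  rw [node_mem_translate_iff] at hqσ
  exact hq ⟨(q.1, q.2 - k), hq', hqσ⟩

include hf in
theorem mem_tcomp_iff (hK : K.IsPeriodic (latticeOf b)) {t : ℝ} {i j : Fin n}
    (hj : G.vb f j ≤ t) :
    proj (latticeOf b) (G.vertex j) ∈ G.tcomp f t i ↔ G.graph.QConn (lowEdges (G.ev f) t) i j := by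
  have e : proj (latticeOf b) (G.vertex j) ∈ G.tcomp f t i ↔ G.vertex j ∈ ⋃₀ G.qcells f t i := by
    rw [← G.preimage_tcomp hf hK]; rfl
  rw [e, ← node_zero]
  constructor
  · rintro ⟨σ, ⟨hσ, q, hq, hqσ⟩, hσj⟩
    exact hq.trans (.of_conn (G.conn_of_mem hK hf hσ hqσ hσj))
  · intro h
    exact ⟨_, ⟨G.node_lowCells hf hK (p := (j, 0)) hj, _, h, rfl⟩, rfl⟩

include hf in
-- The cells in `qcells` and those in `ocells` are both invariant under the lattice, so they project
-- to closed sets. These are disjoint, because a common point would give a common vertex, and they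
-- cover the sublevel set. The component stays in the first one, which is also the image of a
-- connected set.
theorem connectedComponentIn_quotient (hK : K.IsPeriodic (latticeOf b)) {t : ℝ} {i : Fin n}
    (hi : G.vb f i ≤ t) :
    connectedComponentIn (quotientSublevel (latticeOf b) K f t) (proj (latticeOf b) (G.vertex i)) =
      G.tcomp f t i := by
  have hmem : proj (latticeOf b) (G.vertex i) ∈ G.tcomp f t i :=
    (G.mem_tcomp_iff hf hK hi).2 (.refl i)
  apply Set.Subset.antisymm
  · have hA : IsClosed (proj (latticeOf b) '' ⋃₀ G.qcells f t i) :=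
      isClosed_proj_image (CellComplex.isClosed_sUnion fun _ h => h.1.1)
        (add_mem_sUnion_of_translate (G.translate_qcells hf hK t i))
    have hB : IsClosed (proj (latticeOf b) '' ⋃₀ G.ocells f t i) :=
      isClosed_proj_image (CellComplex.isClosed_sUnion fun _ h => h.1.1)
        (add_mem_sUnion_of_translate (G.translate_ocells hf hK t i))
    have hAt : proj (latticeOf b) '' ⋃₀ G.qcells f t i = G.tcomp f t i := by
      rw [← G.preimage_tcomp hf hK,
        Set.image_preimage_eq _ (isOpenQuotientMap_proj (latticeOf b)).surjective]
    have hdisj : Disjoint (proj (latticeOf b) '' ⋃₀ G.qcells f t i)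
        (proj (latticeOf b) '' ⋃₀ G.ocells f t i) := by
      rw [Set.disjoint_left]
      rintro _ hx ⟨z, ⟨τ, ⟨hτ, hno⟩, hzτ⟩, rfl⟩
      rw [hAt] at hx
      have hz : z ∈ proj (latticeOf b) ⁻¹' (G.tcomp f t i) := hx
      rw [G.preimage_tcomp hf hK] at hz
      obtain ⟨σ, ⟨hσ, q, hq, hqσ⟩, hzσ⟩ := hz
      obtain ⟨v, hv, hvσ, hvτ⟩ := CellComplex.exists_common_vertex hσ.1 hτ.1 hzσ hzτ
      obtain ⟨r, rfl⟩ := G.exists_node hv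
      exact hno ⟨r, hq.trans (.of_conn (G.conn_of_mem hK hf hσ hqσ hvσ)), hvτ⟩
    have hcov : connectedComponentIn (quotientSublevel (latticeOf b) K f t)
        (proj (latticeOf b) (G.vertex i)) ⊆
        proj (latticeOf b) '' ⋃₀ G.qcells f t i ∪ proj (latticeOf b) '' ⋃₀ G.ocells f t i := by
      refine (connectedComponentIn_subset _ _).trans ?_
      rw [quotientSublevel, ← Set.image_union]
      refine Set.image_mono ?_
      rintro x ⟨σ, hσ, hx⟩
      by_cases h : ∃ q, G.graph.QConn (lowEdges (G.ev f) t) i q.1 ∧ G.node q ∈ σ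
      · exact Or.inl ⟨σ, ⟨hσ, h⟩, hx⟩
      · exact Or.inr ⟨σ, ⟨hσ, h⟩, hx⟩
    rw [← hAt]
    rcases isPreconnected_iff_subset_of_disjoint_closed.1 isPreconnected_connectedComponentIn
      _ _ hA hB hcov (by rw [hdisj.inter_eq, Set.inter_empty]) with h | h
    · exact h
    · exfalso
      have hx : proj (latticeOf b) (G.vertex i) ∈ quotientSublevel (latticeOf b) K f t :=
        Set.image_mono (G.comp_subset t _) hmem
      exact Set.disjoint_left.1 hdisj (hAt ▸ hmem) (h (mem_connectedComponentIn hx))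
  · refine IsPreconnected.subset_connectedComponentIn ?_ hmem (Set.image_mono (G.comp_subset t _))
    refine IsPreconnected.image ?_ _ (isOpenQuotientMap_proj _).continuous.continuousOn
    rw [← G.connectedComponentIn_node hf hK (p := (i, 0)) hi]
    exact isPreconnected_connectedComponentIn

include hf in
theorem tcomp_eq_iff (hK : K.IsPeriodic (latticeOf b)) {t : ℝ} {i j : Fin n}
    (hi : G.vb f i ≤ t) (hj : G.vb f j ≤ t) :
    G.tcomp f t i = G.tcomp f t j ↔ G.graph.QConn (lowEdges (G.ev f) t) i j := by
  rw [← G.mem_tcomp_iff hf hK hj]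
  constructor
  · intro h
    rw [h, G.mem_tcomp_iff hf hK hj]; exact .refl _
  · intro h
    rw [← G.connectedComponentIn_quotient hf hK hi] at h
    rw [← G.connectedComponentIn_quotient hf hK hi, ← G.connectedComponentIn_quotient hf hK hj]
    exact connectedComponentIn_eq h

include hf in
theorem exists_tcomp (hK : K.IsPeriodic (latticeOf b)) {t : ℝ} {x : Torus (latticeOf b)}
    (hx : x ∈ quotientSublevel (latticeOf b) K f t) :
    ∃ j, G.vb f j ≤ t ∧ x ∈ G.tcomp f t j ∧
      connectedComponentIn (quotientSublevel (latticeOf b) K f t) x = G.tcomp f t j := by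
  obtain ⟨y, ⟨σ, hσ, hy⟩, rfl⟩ := hx
  obtain ⟨v, hv, hvσ⟩ := CellComplex.exists_vertex hσ.1
  obtain ⟨q, rfl⟩ := G.exists_node hv
  have hq : G.vb f q.1 ≤ t := (G.vb_le hf hK hσ.1 hvσ).trans hσ.2
  have hm : y ∈ proj (latticeOf b) ⁻¹' (G.tcomp f t q.1) := by
    rw [G.preimage_tcomp hf hK]
    exact ⟨σ, ⟨hσ, q, .refl _, hvσ⟩, hy⟩
  refine ⟨q.1, hq, hm, ?_⟩
  have h := hm
  rw [Set.mem_preimage, ← G.connectedComponentIn_quotient hf hK hq] at h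
  rw [← G.connectedComponentIn_quotient hf hK hq]
  exact (connectedComponentIn_eq h).symm

include hf in
-- A shadow is a component within the preimage of the torus component only. It agrees with the
-- component in the whole sublevel set because the preimage is a union of such components.
theorem shadows_tcomp (hK : K.IsPeriodic (latticeOf b)) {t : ℝ} {i : Fin n} (hi : G.vb f i ≤ t) :
    shadows (latticeOf b) (G.tcomp f t i) = Set.range fun k => G.comp f t (i, k) := by
  have hpre := (G.preimage_tcomp hf hK t i).trans (G.qcells_sUnion t i)
  have key : ∀ k, ∀ y ∈ G.comp f t (i, k),
      connectedComponentIn (⋃ k, G.comp f t (i, k)) y = G.comp f t (i, k) := by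
    intro k y hy
    have h1 : connectedComponentIn (K.sublevel f t) y = G.comp f t (i, k) := by
      rw [← G.connectedComponentIn_node hf hK (p := (i, k)) hi] at hy ⊢
      exact (connectedComponentIn_eq hy).symm
    apply Set.Subset.antisymm
    · rw [← h1]
      exact connectedComponentIn_mono _ (Set.iUnion_subset fun k => G.comp_subset t _)
    · refine IsPreconnected.subset_connectedComponentIn ?_ hy (Set.subset_iUnion (fun k => G.comp f t (i, k)) k)
      rw [← h1]
      exact isPreconnected_connectedComponentIn
  rw [shadows, hpre]
  ext c
  constructor
  · rintro ⟨y, hy, rfl⟩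
    obtain ⟨k, hk⟩ := Set.mem_iUnion.1 hy
    exact ⟨k, (key k y hk).symm⟩
  · rintro ⟨k, rfl⟩
    have hm := G.node_mem_comp hf hK (p := (i, k)) hi
    exact ⟨_, Set.mem_iUnion.2 ⟨k, hm⟩, (key k _ hm).symm⟩

include hf in
-- Translation by `l` fixes the component of `(i, k)` exactly if `(i, k)` and `(i, k + l)` are
-- connected. By periodicity this does not depend on `k`, so one shadow decides for all.
theorem periodicityLattice_tcomp (hK : K.IsPeriodic (latticeOf b)) {t : ℝ} {i : Fin n}
    (hi : G.vb f i ≤ t) : periodicityLattice (latticeOf b) (G.tcomp f t i) =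
      (G.graph.cyc (lowEdges (G.ev f) t) i).map (latHom b) := by
  ext u
  have e : u ∈ periodicityLattice (latticeOf b) (G.tcomp f t i) ↔
      u ∈ latticeOf b ∧ ∀ c ∈ shadows (latticeOf b) (G.tcomp f t i), translate u c = c := Iff.rfl
  rw [e, G.shadows_tcomp hf hK hi, Submodule.mem_map]
  have hcyc : ∀ k l : Fin d → ℤ, translate (latticeVector b l) (G.comp f t (i, k)) =
      G.comp f t (i, k) ↔ l ∈ G.graph.cyc (lowEdges (G.ev f) t) i := by
    intro k l
    rw [G.translate_comp hf hK, eq_comm, G.comp_eq_iff hf hK (q := (i, k + l)) hi,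
      ← ShiftGraph.mem_cyc', add_sub_cancel_left]
  constructor
  · rintro ⟨hu, h⟩
    obtain ⟨l, rfl⟩ := (mem_latticeOf b).1 hu
    exact ⟨l, (hcyc 0 l).1 (h _ ⟨0, rfl⟩), latHom_apply b l⟩
  · rintro ⟨l, hl, rfl⟩
    rw [latHom_apply]
    refine ⟨latticeVector_mem b l, ?_⟩
    rintro _ ⟨k, rfl⟩
    exact (hcyc k l).2 hl

include hf in
theorem shadowMonomial_tcomp (hK : K.IsPeriodic (latticeOf b)) {t : ℝ} {i : Fin n}
    (hi : G.vb f i ≤ t) : shadowMonomial (latticeOf b) (G.tcomp f t i) =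
      monoOf b (G.graph.cyc (lowEdges (G.ev f) t) i) := by
  rw [shadowMonomial, G.periodicityLattice_tcomp hf hK hi, monoOf]

/-- The heights at which two vertices of the quotient are connected form a closed ray. -/
theorem isClosed_qconn (i j : Fin n) : IsClosed {t | G.graph.QConn (lowEdges (G.ev f) t) i j} := by
  rw [← isOpen_compl_iff, isOpen_iff_mem_nhds]
  intro t ht
  -- There are finitely many edges, so slightly above `t` no further edge enters.
  have h : ∀ᶠ t' in nhds t, ∀ e, t < G.ev f e → t' < G.ev f e := by
    rw [Filter.eventually_all]
    intro e
    by_cases he : t < G.ev f e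
    · filter_upwards [Iio_mem_nhds he] with t' h' _ using h'
    · exact Filter.Eventually.of_forall fun _ h => absurd h he
  filter_upwards [h] with t' h' hc
  refine ht (ShiftGraph.QConn.mono (fun e he => ?_) hc)
  by_contra hne
  exact absurd (h' e (not_le.1 hne)) (not_lt.2 he)

include hf in
/-- A beam sweeps out a closed set. -/
theorem isClosed_sweep (hK : K.IsPeriodic (latticeOf b)) (i : Fin n) {F : Set ℝ} (hF : IsClosed F) :
    IsClosed {p : Torus (latticeOf b) × ℝ | p.2 ∈ F ∧ p.1 ∈ G.tcomp f p.2 i} := by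
  have hq : IsOpenQuotientMap (Prod.map (proj (latticeOf b)) (id : ℝ → ℝ)) :=
    (isOpenQuotientMap_proj _).prodMap .id
  rw [← hq.isQuotientMap.isClosed_preimage]
  -- Upstairs the set is a union over the cells of products: the cell times the heights at which it
  -- is present and connected with `i`. Each product is closed, and the union is locally finite
  -- since the cells are.
  have e : Prod.map (proj (latticeOf b)) (id : ℝ → ℝ) ⁻¹'
      {p : Torus (latticeOf b) × ℝ | p.2 ∈ F ∧ p.1 ∈ G.tcomp f p.2 i} =
      (Prod.snd ⁻¹' F) ∩ ⋃ σ : K.cells, (σ : Set (E d)) ×ˢ ({t | f σ ≤ t} ∩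
        ⋃ j, ⋃ (_ : ∃ k, G.node (j, k) ∈ (σ : Set (E d))),
          {t | G.graph.QConn (lowEdges (G.ev f) t) i j}) := by
    ext ⟨x, t⟩
    have e1 : proj (latticeOf b) x ∈ G.tcomp f t i ↔ x ∈ ⋃₀ G.qcells f t i := by
      rw [← G.preimage_tcomp hf hK]; rfl
    simp only [Set.mem_preimage, Prod.map_apply, id, Set.mem_ofPred_eq, e1, Set.mem_inter_iff,
      Set.mem_iUnion, Set.mem_prod]
    refine and_congr_right fun _ => ?_
    constructor
    · rintro ⟨σ, ⟨hσ, q, hq, hqσ⟩, hx⟩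
      exact ⟨⟨σ, hσ.1⟩, hx, hσ.2, q.1, ⟨q.2, hqσ⟩, hq⟩
    · rintro ⟨σ, hx, hσ, j, ⟨k, hk⟩, hj⟩
      exact ⟨σ, ⟨⟨σ.2, hσ⟩, (j, k), hj, hk⟩, hx⟩
  rw [e]
  refine (hF.preimage continuous_snd).inter (LocallyFinite.isClosed_iUnion ?_ fun σ => ?_)
  · exact (K.locallyFinite.preimage_continuous continuous_fst).subset fun σ p hp => hp.1
  · refine (CellComplex.isClosed_cell σ.2).prod (isClosed_Ici.inter ?_)
    exact isClosed_iUnion_of_finite fun j => isClosed_iUnion_of_finite fun _ => G.isClosed_qconn i j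

end QuotientGraph


/-! ### The homeomorphism -/

theorem BeamTree.isClosed_beam {n : ℕ} (T : BeamTree n) (i : Fin n) : IsClosed (T.beam i) := by
  have : T.beam i = Set.Ici (T.birth i) ∩ ⋂ j, ⋂ h, ⋂ (_ : T.ending i = some (j, h)), Set.Iic h := by
    ext s
    simp [BeamTree.beam]
  rw [this]
  exact isClosed_Ici.inter (isClosed_iInter fun _ => isClosed_iInter fun _ => isClosed_iInter
    fun _ => isClosed_Iic)

namespace QuotientGraph

variable {d n m : ℕ} {K : CellComplex d} {b : Module.Basis (Fin d) ℝ (E d)}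
  {f : Set (E d) → ℝ} (hK : K.IsPeriodic (latticeOf b)) (hf : K.IsPeriodicFilter (latticeOf b) f)
  (G : QuotientGraph K b n m) {T : BeamTree n}

include hf in
theorem proj_vertex_mem (hK : K.IsPeriodic (latticeOf b)) {t : ℝ} {i : Fin n}
    (hi : G.vb f i ≤ t) :
    proj (latticeOf b) (G.vertex i) ∈ quotientSublevel (latticeOf b) K f t :=
  Set.image_mono (G.comp_subset t _) ((G.mem_tcomp_iff hf hK hi).2 (.refl i))

theorem vb_le_of_point (hb : T.birth = G.vb f) (p : T.Points) : G.vb f p.1 ≤ p.2 :=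
  hb ▸ p.2.2.1

/-- The point of the merge tree for a point on a beam. -/
def beamPoint (hb : T.birth = G.vb f) (p : T.Points) :
    PeriodicMergeTree (latticeOf b) K f :=
  Quotient.mk (sublevelSetoid _) ⟨(proj (latticeOf b) (G.vertex p.1), (p.2 : ℝ)),
    G.proj_vertex_mem hf hK (G.vb_le_of_point hb p)⟩

theorem beamPoint_eq_mk {hb : T.birth = G.vb f} {p : T.Points}
    {x : SublevelSpace (quotientSublevel (latticeOf b) K f)} :
    Quotient.mk (sublevelSetoid _) x = G.beamPoint hK hf hb p ↔
      x.1.2 = p.2 ∧ x.1.1 ∈ G.tcomp f p.2 p.1 := by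
  have hp := G.vb_le_of_point hb p
  rw [beamPoint, Quotient.eq]
  constructor
  · rintro ⟨h1, h2⟩
    refine ⟨h1, ?_⟩
    simp only at h1 h2
    rw [G.connectedComponentIn_quotient hf hK hp] at h2
    rw [← h2]
    exact mem_connectedComponentIn x.2
  · rintro ⟨h1, h2⟩
    refine ⟨h1, ?_⟩
    simp only
    rw [← G.connectedComponentIn_quotient hf hK hp] at h2
    rw [h1]
    exact (connectedComponentIn_eq h2).symm

theorem beamPoint_eq_iff {hb : T.birth = G.vb f} {p q : T.Points} :
    G.beamPoint hK hf hb p = G.beamPoint hK hf hb q ↔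
      (p.2 : ℝ) = q.2 ∧ G.graph.QConn (lowEdges (G.ev f) q.2) q.1 p.1 := by
  refine (G.beamPoint_eq_mk hK hf (hb := hb) (p := q)).trans (and_congr_right fun h => ?_)
  simp only at h
  have hp : G.vb f p.1 ≤ q.2 := (G.vb_le_of_point hb p).trans h.le
  exact G.mem_tcomp_iff hf hK hp

theorem component_beamPoint {hb : T.birth = G.vb f} (p : T.Points) :
    (G.beamPoint hK hf hb p).component = G.tcomp f p.2 p.1 :=
  G.connectedComponentIn_quotient hf hK (G.vb_le_of_point hb p)

/-- The end of a beam is glued to a point on a beam of larger `r`. As `r` is bounded, following the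
gluings at a fixed height stops at a point that is not an end. Such representatives are unique by
`GoodAt.uniq`, which gives injectivity of `treeMap`. -/
theorem exists_aliveAt (hT : TreeSpec G.graph (G.vb f) (G.ev f) (monoOf b) T) (p : T.Points) :
    ∃ q : T.Points, (Quot.mk T.Attach p : T.Space) = Quot.mk _ q ∧ T.AliveAt q.1 q.2 := by
  obtain ⟨r, hr⟩ := hT.dead
  set N := Finset.univ.sup r
  induction hk : N - r p.1 using Nat.strong_induction_on generalizing p with
  | _ k ih =>
    by_cases h : T.AliveAt p.1 p.2
    · exact ⟨p, rfl, h⟩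
    · unfold BeamTree.AliveAt at h
      push Not at h
      obtain ⟨j, h, hj, hle⟩ := h
      have e : (p.2 : ℝ) = h := le_antisymm (p.2.2.2 j h hj) hle
      obtain ⟨h1, h2, -, h4, h5⟩ := hr _ _ _ hj
      let q : T.Points := ⟨j, ⟨h, by rw [hT.birth]; exact h1.trans h2, h5⟩⟩
      have hat : T.Attach p q := ⟨by rw [hj, e], e.symm⟩
      have hN : r j ≤ N := Finset.le_sup (Finset.mem_univ j)
      obtain ⟨q', hq', ha⟩ := ih (N - r j) (by omega) q rfl
      exact ⟨q', (Quot.sound hat).trans hq', ha⟩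

/-- The map from the beams to the merge tree. -/
def treeMap (hT : TreeSpec G.graph (G.vb f) (G.ev f) (monoOf b) T) :
    T.Space → PeriodicMergeTree (latticeOf b) K f :=
  Quot.lift (G.beamPoint hK hf hT.birth) (by
    intro p q ⟨h1, h2⟩
    rw [beamPoint_eq_iff]
    obtain ⟨r, hr⟩ := hT.dead
    refine ⟨h2.symm, ?_⟩
    rw [h2]
    exact (hr _ _ _ h1).2.2.1.symm)

theorem treeMap_continuous (hT : TreeSpec G.graph (G.vb f) (G.ev f) (monoOf b) T) :
    Continuous (G.treeMap hK hf hT) := by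
  refine continuous_coinduced_dom.2 (continuous_sigma fun i => ?_)
  have h : Continuous fun s : T.beam i => (⟨(proj (latticeOf b) (G.vertex i), (s : ℝ)),
      G.proj_vertex_mem hf hK (G.vb_le_of_point hT.birth ⟨i, s⟩)⟩ :
      SublevelSpace (quotientSublevel (latticeOf b) K f)) :=
    Continuous.subtype_mk (continuous_const.prodMk continuous_subtype_val) _
  have h' : Continuous (Quotient.mk (sublevelSetoid (quotientSublevel (latticeOf b) K f))) :=
    continuous_quot_mk
  exact h'.comp h

theorem treeMap_injective (hT : TreeSpec G.graph (G.vb f) (G.ev f) (monoOf b) T) :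
    Function.Injective (G.treeMap hK hf hT) := by
  rintro ⟨p⟩ ⟨q⟩ h
  obtain ⟨p', hp, hp'⟩ := G.exists_aliveAt hT p
  obtain ⟨q', hq, hq'⟩ := G.exists_aliveAt hT q
  change G.treeMap hK hf hT (Quot.mk _ p) = G.treeMap hK hf hT (Quot.mk _ q) at h
  change (Quot.mk _ p : T.Space) = Quot.mk _ q
  rw [hp, hq] at h ⊢
  obtain ⟨h1, h2⟩ := (G.beamPoint_eq_iff hK hf (hb := hT.birth)).1 h
  obtain ⟨i, s, hs⟩ := p'
  obtain ⟨j, t, ht⟩ := q'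
  obtain rfl : s = t := h1
  obtain rfl := (hT.good s).uniq _ _ hq' hp' h2
  rfl

theorem treeMap_surjective (hT : TreeSpec G.graph (G.vb f) (G.ev f) (monoOf b) T) :
    Function.Surjective (G.treeMap hK hf hT) := by
  rintro ⟨⟨⟨x, t⟩, hx⟩⟩
  obtain ⟨j, hj, hxj, -⟩ := G.exists_tcomp hf hK hx
  obtain ⟨k, h1, h2, h3⟩ := (hT.good t).ex j hj
  refine ⟨Quot.mk _ ⟨k, ⟨t, by rw [hT.birth]; exact h2, fun j h hj => (h3 j h hj).le⟩⟩, ?_⟩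
  refine Eq.symm ((G.beamPoint_eq_mk hK hf (hb := hT.birth)).2 ⟨rfl, ?_⟩)
  simp only
  rwa [← (G.tcomp_eq_iff hf hK hj h2).2 h1]

/-- The preimage of the image in the sublevel space is a finite union, over the beams, of the sets
swept out by closed sets of heights. -/
theorem treeMap_isClosedMap (hT : TreeSpec G.graph (G.vb f) (G.ev f) (monoOf b) T) :
    IsClosedMap (G.treeMap hK hf hT) := by
  intro F hF
  let Fi : Fin n → Set ℝ := fun i =>
    Subtype.val '' {s : T.beam i | (Quot.mk T.Attach ⟨i, s⟩ : T.Space) ∈ F}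
  have hFi : ∀ i, IsClosed (Fi i) := by
    intro i
    refine (T.isClosed_beam i).isClosedEmbedding_subtypeVal.isClosedMap _ ?_
    exact hF.preimage (continuous_quot_mk.comp continuous_sigmaMk)
  have hq : Topology.IsQuotientMap
      (Quotient.mk (sublevelSetoid (quotientSublevel (latticeOf b) K f))) := isQuotientMap_quotient_mk'
  have e : Quotient.mk (sublevelSetoid (quotientSublevel (latticeOf b) K f)) ⁻¹'
      (G.treeMap hK hf hT '' F) = Subtype.val ⁻¹'
        ⋃ i, {p : Torus (latticeOf b) × ℝ | p.2 ∈ Fi i ∧ p.1 ∈ G.tcomp f p.2 i} := by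
    ext x
    simp only [Set.mem_preimage, Set.mem_iUnion]
    constructor
    · rintro ⟨⟨p⟩, hp, hpx⟩
      obtain ⟨h1, h2⟩ := (G.beamPoint_eq_mk hK hf (hb := hT.birth)).1 hpx.symm
      refine ⟨p.1, ⟨p.2, hp, h1.symm⟩, ?_⟩
      rw [h1]; exact h2
    · rintro ⟨i, ⟨s, hs, hsx⟩, hx⟩
      refine ⟨Quot.mk _ ⟨i, s⟩, hs, Eq.symm ((G.beamPoint_eq_mk hK hf (hb := hT.birth)).2
        ⟨hsx.symm, ?_⟩)⟩
      simp only
      rw [hsx]; exact hx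
  have hcl : IsClosed (Quotient.mk (sublevelSetoid (quotientSublevel (latticeOf b) K f)) ⁻¹'
      (G.treeMap hK hf hT '' F)) := by
    rw [e]
    exact (isClosed_iUnion_of_finite fun i => G.isClosed_sweep hf hK i (hFi i)).preimage
      continuous_subtype_val
  exact hq.isClosed_preimage.1 hcl

include hK hf in
/-- A decomposition with the right combinatorial properties represents the merge tree. -/
theorem represents (hT : TreeSpec G.graph (G.vb f) (G.ev f) (monoOf b) T) : Represents T f G := by
  refine ⟨fun i => congrFun hT.birth i, ?_, fun i => ⟨hT.pos i, ?_, hT.start_mono i⟩, ?_⟩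
  · intro i j h hij
    obtain ⟨r, hr⟩ := hT.dead
    rw [hT.birth]
    exact (hr i j h hij).1
  · rw [hT.start_zero, hT.birth]
  · let Φ := Equiv.ofBijective (G.treeMap hK hf hT)
      ⟨G.treeMap_injective hK hf hT, G.treeMap_surjective hK hf hT⟩
    refine ⟨Φ.toHomeomorphOfContinuousClosed (G.treeMap_continuous hK hf hT)
      (G.treeMap_isClosedMap hK hf hT), fun p => ?_⟩
    have hp := G.vb_le_of_point hT.birth p
    change (G.beamPoint hK hf hT.birth p).height = p.2 ∧
      proj (latticeOf b) (G.vertex p.1) ∈ (G.beamPoint hK hf hT.birth p).component ∧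
      ((∀ j h, T.ending p.1 = some (j, h) → (p.2 : ℝ) < h) →
        T.HasMonomial p.1 p.2 (shadowMonomial (latticeOf b) (G.beamPoint hK hf hT.birth p).component))
    rw [component_beamPoint, G.shadowMonomial_tcomp hf hK hp]
    exact ⟨rfl, (G.mem_tcomp_iff hf hK hp).2 (.refl _), fun h => (hT.good p.2).mono _ hp h⟩

end QuotientGraph


/-! ### The state of the main loop -/

/-- The input in the store. -/
structure HasInput {d n m : ℕ} (s : Store) (u : Fin d → E d) (Γ : ShiftGraph n m d) (vb : Fin n → ℝ)
    (ev : Fin m → ℝ) : Prop where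
  dim : s.int 0 0 = d
  card_vert : s.int 0 1 = n
  card_edge : s.int 0 2 = m
  src : ∀ e : Fin m, s.int 1 (e : ℕ) = (Γ.src e : ℕ)
  tgt : ∀ e : Fin m, s.int 2 (e : ℕ) = (Γ.tgt e : ℕ)
  sh : ∀ (e : Fin m) k, s.int 3 (vecIdx d e k) = Γ.sh e k
  vert : ∀ i : Fin n, s.real 0 (i : ℕ) = vb i
  edge : ∀ e : Fin m, s.real 1 (e : ℕ) = ev e
  basis : ∀ l c : Fin d, s.real 2 (vecIdx d l c) = u l c

theorem HasInput.of_frame {d n m : ℕ} {s s' : Store} {u : Fin d → E d} {Γ : ShiftGraph n m d}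
    {vb : Fin n → ℝ} {ev : Fin m → ℝ} {p : Program} (h : HasInput s u Γ vb ev) (hf : Frame p s s')
    (h0 : p.wI 0 = false) (h1 : p.wI 1 = false) (h2 : p.wI 2 = false) (h3 : p.wI 3 = false)
    (g0 : p.wR 0 = false) (g1 : p.wR 1 = false) (g2 : p.wR 2 = false) :
    HasInput s' u Γ vb ev where
  dim := by rw [hf.int 0 h0]; exact h.dim
  card_vert := by rw [hf.int 0 h0]; exact h.card_vert
  card_edge := by rw [hf.int 0 h0]; exact h.card_edge
  src := by rw [hf.int 1 h1]; exact h.src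
  tgt := by rw [hf.int 2 h2]; exact h.tgt
  sh := by rw [hf.int 3 h3]; exact h.sh
  vert := by rw [hf.real 0 g0]; exact h.vert
  edge := by rw [hf.real 1 g1]; exact h.edge
  basis := by rw [hf.real 2 g2]; exact h.basis

/-- Sizes of the components: potentials differ by at most `D` for every edge of a spanning tree. -/
structure Sizes {n d : ℕ} (D N : ℕ) (root : Fin n → Fin n) (phi : Fin n → Fin d → ℤ)
    (rk c : Fin n → ℕ) : Prop where
  sum : ∑ r, c r ≤ N
  diff : ∀ x y, root x = root y → ∀ k, |phi x k - phi y k| ≤ D * c (root x)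
  rank : ∀ x, 2 ^ rk (root x) ≤ c (root x) + 1

section
variable {n d D N : ℕ} {root : Fin n → Fin n} {phi : Fin n → Fin d → ℤ} {rk c : Fin n → ℕ}

theorem Sizes.le (h : Sizes D N root phi rk c) (r : Fin n) : c r ≤ N :=
  (Finset.single_le_sum (fun _ _ => Nat.zero_le _) (Finset.mem_univ r)).trans h.sum

theorem Sizes.succ (h : Sizes D N root phi rk c) : Sizes D (N + 1) root phi rk c :=
  ⟨h.sum.trans (Nat.le_succ _), h.diff, h.rank⟩

/-- `c` counts the edges that have merged something into a component, that is, the edges of a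
spanning tree. A path in this tree changes the potential by at most `D` per edge, and `c + 1` is the
number of vertices, which is at least two to the rank. The counter of the absorbed root is reset to
zero, so the total grows only by one. -/
theorem Sizes.merge (h : Sizes D N root phi rk c) {a b : Fin n} (hab : root a ≠ root b)
    (hrk : rk (root b) ≤ rk (root a)) {w : Fin d → ℤ} (hw : ∀ k, |w k| ≤ D) :
    Sizes D (N + 1) (fun x => if root x = root b then root a else root x)
      (fun x => if root x = root b then phi x + (phi a + w - phi b) else phi x)
      (Function.update rk (root a) (if rk (root a) ≤ rk (root b) then rk (root a) + 1 else rk (root a)))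
      (fun r => if r = root a then c (root a) + c (root b) + 1 else if r = root b then 0 else c r) := by
  refine ⟨?_, ?_, ?_⟩
  · have e : ∀ r, (if r = root a then c (root a) + c (root b) + 1 else if r = root b then 0 else c r)
        + (if r = root b then c (root b) else 0) =
        c r + (if r = root a then c (root b) + 1 else 0) := by
      intro r
      by_cases h1 : r = root a
      · simp [h1, hab]; ring
      · by_cases h2 : r = root b
        · subst h2; simp [h1]
        · simp [h1, h2]
    have := Finset.sum_congr rfl fun r (_ : r ∈ Finset.univ) => e r
    rw [Finset.sum_add_distrib, Finset.sum_add_distrib, Finset.sum_ite_eq', Finset.sum_ite_eq'] at this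
    simp only [Finset.mem_univ, if_true] at this
    have := h.sum
    omega
  · have cross : ∀ x y, root x = root b → root y = root a → ∀ k,
        |(phi x + (phi a + w - phi b)) k - phi y k| ≤ D * ((c (root a) + c (root b) + 1 : ℕ) : ℤ) := by
      intro x y hx hy k
      have h1 := h.diff x b hx k
      have h2 := h.diff a y hy.symm k
      rw [hx] at h1
      have e : (phi x + (phi a + w - phi b)) k - phi y k =
        (phi x k - phi b k) + (phi a k - phi y k) + w k := by
        simp only [Pi.add_apply, Pi.sub_apply]; ring
      rw [e]
      refine (abs_add_le _ _).trans ?_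
      have := abs_add_le (phi x k - phi b k) (phi a k - phi y k)
      have := hw k
      push_cast
      linarith
    have hle : ∀ r, (c r : ℤ) ≤
        ((if r = root a then c (root a) + c (root b) + 1 else if r = root b then c (root b) else c r : ℕ) : ℤ) := by
      intro r
      norm_cast
      split_ifs with h1 h2
      · subst h1; omega
      · subst h2; omega
      · omega
    intro x y hxy k
    by_cases hx : root x = root b <;> by_cases hy : root y = root b
    · simp only [hx, hy, if_true]
      have h1 := h.diff x y (hx.trans hy.symm) k
      rw [hx] at h1
      simp only [Pi.add_apply]
      rw [add_sub_add_right_eq_sub]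
      refine h1.trans (mul_le_mul_of_nonneg_left ?_ (by positivity))
      push_cast; linarith [Int.natCast_nonneg (c (root a))]
    · simp only [hx, hy, if_true, if_false] at hxy ⊢
      exact cross x y hx hxy.symm k
    · simp only [hx, hy, if_true, if_false] at hxy ⊢
      rw [hxy, if_pos rfl, abs_sub_comm]
      exact cross y x hy hxy k
    · simp only [hx, hy, if_false] at hxy ⊢
      refine (h.diff x y hxy k).trans (mul_le_mul_of_nonneg_left ?_ (by positivity))
      have := hle (root x)
      simpa [hx] using this
  · intro x
    have key : 2 ^ (if rk (root a) ≤ rk (root b) then rk (root a) + 1 else rk (root a)) ≤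
        c (root a) + c (root b) + 1 + 1 := by
      have h1 := h.rank a
      have h2 := h.rank b
      split_ifs with hr
      · have : rk (root a) = rk (root b) := le_antisymm hr hrk
        rw [← this] at h2
        rw [pow_succ]; omega
      · omega
    by_cases hx : root x = root b
    · simpa [hx] using key
    · by_cases hxa : root x = root a
      · simpa [hx, hxa, hab] using key
      · simpa [hx, hxa] using h.rank x

end

/-- The output only depends on some of the arrays. -/
theorem outputTree_of_frame {n : ℕ} {s s' : Store} {p : Program} (hf : Frame p s s')
    (h4 : p.wI 4 = false) (h5 : p.wI 5 = false) (h6 : p.wI 6 = false) (h7 : p.wI 7 = false)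
    (g3 : p.wR 3 = false) (g4 : p.wR 4 = false) (g5 : p.wR 5 = false) (g6 : p.wR 6 = false) :
    outputTree n s' = outputTree n s := by
  simp only [outputTree, hf.int 4 h4, hf.int 5 h5, hf.int 6 h6, hf.int 7 h7, hf.real 3 g3,
    hf.real 4 g4, hf.real 5 g5, hf.real 6 g6]

theorem outputTree_ending {n : ℕ} {s : Store} {i j : Fin n} (h : s.int 4 (i : ℕ) = (j : ℕ)) :
    (outputTree n s).ending i = some (j, s.real 4 (i : ℕ)) := by
  have hj := j.2
  simp only [outputTree, h]
  rw [dif_pos ⟨by omega, by omega⟩]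
  simp

open Prog

theorem mergeBeams_spec {n m : ℕ} {s : Store} {vb : Fin n → ℝ} {ev : Fin m → ℝ} {ra rb ea eb : Fin n}
    {e : Fin m} (ha : s.int 23 0 = (ra : ℕ)) (hb : s.int 24 0 = (rb : ℕ)) (he : s.int 21 0 = (e : ℕ))
    (hea : s.int 14 (ra : ℕ) = (ea : ℕ)) (heb : s.int 14 (rb : ℕ) = (eb : ℕ))
    (hvert : ∀ i : Fin n, s.real 0 (i : ℕ) = vb i) (hedge : ∀ e : Fin m, s.real 1 (e : ℕ) = ev e) :
    WP mergeBeams 60 (fun s' => ∃ dead surv : Fin n, vb surv ≤ vb dead ∧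
      (dead = ea ∧ surv = eb ∨ dead = eb ∧ surv = ea) ∧
      (outputTree n s').ending = Function.update (outputTree n s).ending dead (some (surv, ev e)) ∧
      ∀ j : Fin n, s'.int 14 (j : ℕ) = if j = ra then ((surv : ℕ) : ℤ) else s.int 14 (j : ℕ)) s := by
  apply WP.time
  · refine WP.seq' (T' := 22) (P := fun s' => ∃ dead surv : Fin n, vb surv ≤ vb dead ∧
      (dead = ea ∧ surv = eb ∨ dead = eb ∧ surv = ea) ∧ s'.int 36 0 = (dead : ℕ) ∧
      s'.int 37 0 = (surv : ℕ)) (WP.branch (T := 12) (T' := 12) ?_ ?_) ?_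
    · intro hc
      simp only [BExp.eval_rle, RExp.eval_get, IExp.eval_get, IExp.eval_lit, ha, hb, hea, heb, hvert] at hc
      apply WP.time
      · apply WP.seq
        apply WP.setInt
        apply WP.setInt
        exact ⟨eb, ea, hc, .inr ⟨rfl, rfl⟩, by simp [hb, heb], by simp [ha, hea]⟩
      · simp
    · intro hc
      simp only [BExp.eval_rle, RExp.eval_get, IExp.eval_get, IExp.eval_lit, ha, hb, hea, heb, hvert] at hc
      apply WP.time
      · apply WP.seq
        apply WP.setInt
        apply WP.setInt
        exact ⟨ea, eb, (not_le.1 hc).le, .inl ⟨rfl, rfl⟩, by simp [ha, hea], by simp [hb, heb]⟩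
      · simp
    · rintro s' hf ⟨dead, surv, h1, h2, h3, h4⟩
      apply WP.time
      · apply WP.seq
        apply WP.setInt
        apply WP.seq
        apply WP.setReal
        apply WP.setInt
        have e1 : s'.int 21 0 = (e : ℕ) := by rw [hf.int 21 rfl, he]
        have e2 : s'.int 23 0 = (ra : ℕ) := by rw [hf.int 23 rfl, ha]
        have e3 : s'.real 1 (e : ℕ) = ev e := by rw [hf.real 1 rfl, hedge]
        refine ⟨dead, surv, h1, h2, ?_, ?_⟩
        · funext i
          by_cases hi : i = dead
          · subst hi
            rw [Function.update_self, outputTree_ending (j := surv)]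
            · simp [h3, e1, e3]
            · simp [h3, h4]
          · rw [Function.update_of_ne hi]
            have hi' : (i : ℕ) ≠ dead := fun h => hi (Fin.ext h)
            simp [outputTree, h3, hi', hf.int 4 rfl, hf.real 4 rfl]
        · intro j
          have : (((j : ℕ) : ℤ) = (ra : ℕ)) ↔ j = ra := by
            rw [Nat.cast_inj, Fin.ext_iff]
          simp [e2, h4, this, hf.int 14 rfl]
      · simp
  · simp

/-- The state of the union-find structure, the lattices, and the beams after the edges in `P`. -/
structure CoreInv {n m d : ℕ} (Γ : ShiftGraph n m d) (vb : Fin n → ℝ) (ev : Fin m → ℝ) (D B : ℕ)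
    (s : Store) (P : Set (Fin m)) (N : ℕ) (par : Fin n → Fin n) (rk : Fin n → ℕ)
    (pot : Fin n → Fin d → ℤ) (root : Fin n → Fin n) (phi : Fin n → Fin d → ℤ) (c : Fin n → ℕ)
    (el : Fin n → Fin n) (dt : Fin n → ℕ) : Prop where
  forest : Forest par rk pot root phi
  par_eq : ∀ x : Fin n, s.int 10 (x : ℕ) = (par x : ℕ)
  rk_eq : ∀ x : Fin n, s.int 11 (x : ℕ) = rk x
  pot_eq : ∀ (x : Fin n) k, s.int 12 (vecIdx d x k) = pot x k
  sem : Γ.Sem P root phi (fun r => rowSpan (s.mat d r))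
  tri : ∀ r : Fin n, IsTri (s.mat d r)
  gen : ∀ r : Fin n, BoundedGen B (rowSpan (s.mat d r))
  sizes : Sizes D N root phi rk c
  el_eq : ∀ x, s.int 14 (root x : ℕ) = (el (root x) : ℕ)
  cur : CurInv Γ vb ev P N (outputTree n s) root el dt

theorem CurInv.congr {n m d : ℕ} {Γ : ShiftGraph n m d} {vb : Fin n → ℝ} {ev : Fin m → ℝ}
    {P : Set (Fin m)} {N : ℕ} {T T' : BeamTree n} {root el : Fin n → Fin n} {dt : Fin n → ℕ}
    (h : CurInv Γ vb ev P N T root el dt) (hT : T'.ending = T.ending) :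
    CurInv Γ vb ev P N T' root el dt :=
  ⟨by simpa [hT] using h.el_alive, h.el_root, h.el_birth, by simpa [hT] using h.alive_el,
    by simpa [hT] using h.dead⟩

/-! ### The update of components and beams for one edge. -/

namespace Prog

/-- Update the components and the beams for the edge `V 21`; `V 23` becomes the root. -/
def process : Program :=
  locate ;; .branch (.ieq (ivar 23) (ivar 24)) insertVec
    (swapRoots ;; mergeBeams ;; link ;; sumLat)

end Prog

/-- The changes when an edge is processed: only one component changes, and a beam may end. -/
structure Processed {n m : ℕ} (d : ℕ) (ev : Fin m → ℝ) (s s' : Store) (e : Fin m) (ra : Fin n)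
    (root root' : Fin n → Fin n) : Prop where
  root_eq : s'.int 23 0 = (ra : ℕ)
  ending : ∀ i : Fin n, (outputTree n s').ending i = (outputTree n s).ending i ∨
    ((outputTree n s).ending i = none ∧ ∃ j, (outputTree n s').ending i = some (j, ev e))
  other : ∀ i, root' i ≠ ra → s'.mat d (root' i) = s.mat d (root i)

section
variable {n m d : ℕ} {Γ : ShiftGraph n m d} {vb : Fin n → ℝ} {ev : Fin m → ℝ} {D B : ℕ} {s : Store}
  {P : Set (Fin m)} {N ℓ : ℕ} {par : Fin n → Fin n} {rk : Fin n → ℕ} {pot : Fin n → Fin d → ℤ}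
  {root : Fin n → Fin n} {phi : Fin n → Fin d → ℤ} {c : Fin n → ℕ} {el : Fin n → Fin n}
  {dt : Fin n → ℕ} {u : Fin d → E d}

theorem mat_of_frame {s s' : Store} {p : Program} (hf : Frame p s s') (h : p.wI 13 = false) (R : ℕ) :
    s'.mat d R = s.mat d R := by
  funext k c
  simp only [Store.mat, hf.int 13 h]

/-- The direction of the edge is left open by `Extends`, so both outcomes of `swapRoots` are
covered. Generators of both lattices are kept as they are, hence merging does not increase the bound
`B` on their entries. -/
theorem processMerge_spec (h : CoreInv Γ vb ev D B s P N par rk pot root phi c el dt)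
    (hin : HasInput s u Γ vb ev) {e : Fin m} (he : s.int 21 0 = (e : ℕ)) {a b : Fin n}
    {w : Fin d → ℤ} (hE : ShiftGraph.Extends Γ P (insert e P) a b w)
    (ha : s.int 23 0 = (root a : ℕ)) (hb : s.int 24 0 = (root b : ℕ))
    (hw : s.vec 27 d = phi a + w - phi b) (hwD : ∀ k, |w k| ≤ D) (hab : root a ≠ root b)
    (hrk : rk (root b) ≤ rk (root a)) (hsort : ∀ p ∈ P, ev p ≤ ev e) (hva : vb a ≤ ev e)
    (hvb : vb b ≤ ev e) (hB : 1 ≤ B) (hpos : 0 < d) (hl : pivotBound d B < 2 ^ ℓ) :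
    WP (mergeBeams ;; link ;; sumLat) (700 * d * d * d * (ℓ + 1)) (fun s' =>
      ∃ par' rk' pot' root' phi' c' el' dt',
        CoreInv Γ vb ev D B s' (insert e P) (N + 1) par' rk' pot' root' phi' c' el' dt' ∧
        root' a = root a ∧ root' b = root a ∧
        Processed d ev s s' e (root a) root root') s := by
  have hra : root (root a) = root a := h.forest.root_root a
  have hrb : root (root b) = root b := h.forest.root_root b
  apply WP.time
  · apply WP.seq' (mergeBeams_spec (vb := vb) (ev := ev) ha hb he (h.el_eq a) (h.el_eq b) hin.vert
      hin.edge)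
    rintro s₁ hf₁ ⟨dead, surv, hbirth, hds, hend, hel⟩
    apply WP.seq' (link_spec (d := d) (a := root a) (b := root b) (par := par) (rk := rk) (pot := pot)
      (w := phi a + w - phi b) ?_ ?_ ?_ ?_ ?_ ?_ ?_)
    rotate_left 2
    · rw [hf₁.int 0 rfl]; exact hin.dim
    · rw [hf₁.int 23 rfl, ha]
    · rw [hf₁.int 24 rfl, hb]
    · rw [← hw]; funext k; simp only [Store.vec, hf₁.int 27 rfl]
    · rw [hf₁.int 10 rfl]; exact h.par_eq
    · rw [hf₁.int 11 rfl]; exact h.rk_eq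
    · rw [hf₁.int 12 rfl]; exact h.pot_eq
    rintro s₂ hf₂ ⟨hpar, hrk', hpot⟩
    have hm : ∀ R, s₂.mat d R = s.mat d R := fun R => by
      rw [mat_of_frame hf₂ rfl, mat_of_frame hf₁ rfl]
    refine (sumLat_spec (d := d) (a := root a) (b := root b) (ℓ := ℓ) ?_ ?_ ?_ ?_ ?_ hpos ?_).mono
      le_rfl ?_
    · rw [hf₂.int 0 rfl, hf₁.int 0 rfl]; exact hin.dim
    · rw [hf₂.int 23 rfl, hf₁.int 23 rfl, ha]
    · rw [hf₂.int 24 rfl, hf₁.int 24 rfl, hb]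
    · exact fun h => hab (Fin.ext h)
    · rw [hm]; exact h.tri _
    · intro r hr M hM hspan k
      rw [hm, hm] at hspan
      have := pivot_sum_le_pivotBound hM hB hpos hr (h.tri _) (h.gen _) (h.gen _) hspan k
      exact this.trans_lt (by exact_mod_cast hl)
    rintro s₃ hf₃ ⟨htri, hspan, hoth⟩
    rw [hm, hm] at hspan
    have hmat : ∀ r : Fin n, r ≠ root a → s₃.mat d r = s.mat d r := fun r hr => by
      rw [hoth r (fun h => hr (Fin.ext h)), hm]
    have hT : (outputTree n s₃).ending = Function.update (outputTree n s).ending dead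
        (some (surv, ev e)) := by
      rw [outputTree_of_frame hf₃ rfl rfl rfl rfl rfl rfl rfl rfl,
        outputTree_of_frame hf₂ rfl rfl rfl rfl rfl rfl rfl rfl, hend]
    have hsem := h.sem.merge hE hab
    have hL : (fun r : Fin n => rowSpan (s₃.mat d r)) = Function.update (fun r : Fin n => rowSpan (s.mat d r))
        (root a) (rowSpan (s.mat d (root a)) ⊔ rowSpan (s.mat d (root b))) := by
      funext r
      by_cases hr : r = root a
      · subst hr; simpa using hspan
      · rw [Function.update_of_ne hr, hmat r hr]
    rw [← hL] at hsem
    have hea := h.cur.el_root a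
    have heb := h.cur.el_root b
    have hq : Γ.QConn (insert e P) dead surv := by
      rw [hsem.qconn]
      rcases hds with ⟨rfl, rfl⟩ | ⟨rfl, rfl⟩ <;> simp [hea, heb, hab]
    have hvdead : vb dead ≤ ev e := by
      rcases hds with ⟨rfl, rfl⟩ | ⟨rfl, rfl⟩
      · exact (h.cur.el_birth a).trans hva
      · exact (h.cur.el_birth b).trans hvb
    have hcur := h.cur.merge hra hrb hab hsort hbirth hvdead hds hq hT
    refine ⟨_, _, _, _, _, _, _, _, ⟨h.forest.union (h.forest.par_root a) (h.forest.par_root b) hab hrk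
      (phi a + w - phi b), ?_, ?_, ?_, hsem, ?_, ?_, h.sizes.merge hab hrk hwD, ?_, hcur⟩, ?_, ?_, ?_⟩
    · rw [hf₃.int 10 rfl]; exact hpar
    · rw [hf₃.int 11 rfl]; exact hrk'
    · rw [hf₃.int 12 rfl]; exact hpot
    · intro r
      by_cases hr : r = root a
      · subst hr; exact htri
      · rw [hmat r hr]; exact h.tri r
    · intro r
      by_cases hr : r = root a
      · subst hr; rw [hspan]; exact (h.gen _).sup (h.gen _)
      · rw [hmat r hr]; exact h.gen r
    · intro x
      rw [hf₃.int 14 rfl, hf₂.int 14 rfl, hel]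
      by_cases hx : root x = root b
      · simp [hx]
      · by_cases hxa : root x = root a
        · simp [hxa, hab]
        · simp [hx, hxa, h.el_eq]
    · simp [hab]
    · simp
    · refine ⟨?_, fun i => ?_, fun i hi => ?_⟩
      · rw [hf₃.int 23 rfl, hf₂.int 23 rfl, hf₁.int 23 rfl, ha]
      · rw [hT]
        by_cases hi : i = dead
        · subst hi
          right
          rw [Function.update_self]
          refine ⟨?_, _, rfl⟩
          rcases hds with ⟨rfl, rfl⟩ | ⟨rfl, rfl⟩
          · exact h.cur.el_alive a
          · exact h.cur.el_alive b
        · left; rw [Function.update_of_ne hi]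
      · by_cases hx : root i = root b
        · simp [hx] at hi
        · simp only [hx, if_false] at hi ⊢
          exact hmat _ hi
  · nlinarith [Nat.mul_le_mul hpos hpos, Nat.mul_le_mul (Nat.mul_le_mul hpos hpos) hpos,
      Nat.zero_le (d * d * d * ℓ), Nat.mul_le_mul_left d (Nat.mul_le_mul hpos hpos)]

end


open Prog

section
variable {n m d : ℕ} {Γ : ShiftGraph n m d} {vb : Fin n → ℝ} {ev : Fin m → ℝ} {D B : ℕ} {s : Store}
  {P : Set (Fin m)} {N ℓ : ℕ} {par : Fin n → Fin n} {rk : Fin n → ℕ} {pot : Fin n → Fin d → ℤ}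
  {root : Fin n → Fin n} {phi : Fin n → Fin d → ℤ} {c : Fin n → ℕ} {el : Fin n → Fin n}
  {dt : Fin n → ℕ} {u : Fin d → E d}

theorem processCycle_spec (h : CoreInv Γ vb ev D B s P N par rk pot root phi c el dt)
    (hin : HasInput s u Γ vb ev) {e : Fin m}
    (ha : s.int 23 0 = (root (Γ.src e) : ℕ)) (hw : s.vec 27 d = loopVec Γ phi e)
    (hD : ∀ k, |Γ.sh e k| ≤ D) (hab : root (Γ.src e) = root (Γ.tgt e)) (hN : D * (N + 1) ≤ B)
    (hB : 1 ≤ B) (hpos : 0 < d) (hl : pivotBound d B < 2 ^ ℓ) :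
    WP insertVec (400 * d * d * (ℓ + 1)) (fun s' =>
        CoreInv Γ vb ev D B s' (insert e P) (N + 1) par rk pot root phi c el dt ∧
        Processed d ev s s' e (root (Γ.src e)) root root) s := by
  refine (insertVec_spec (d := d) (R := root (Γ.src e)) (ℓ := ℓ) hin.dim ha (h.tri _) ?_ hpos).mono
    le_rfl ?_
  · intro k
    exact (pivot_le_pivotBound (h.tri _) hB hpos (h.gen _) k).trans_lt (by exact_mod_cast hl)
  rintro s' hf ⟨htri, hspan, hoth⟩
  have hmat : ∀ r : Fin n, r ≠ root (Γ.src e) → s'.mat d r = s.mat d r := fun r hr =>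
    hoth r (fun h => hr (Fin.ext h))
  have hT : outputTree n s' = outputTree n s :=
    outputTree_of_frame hf rfl rfl rfl rfl rfl rfl rfl rfl
  rw [hw] at hspan
  have hsem := h.sem.cycle (ShiftGraph.Extends.insert e) hab
  have hL : (fun r : Fin n => rowSpan (s'.mat d r)) =
      Function.update (fun r : Fin n => rowSpan (s.mat d r)) (root (Γ.src e))
        (rowSpan (s.mat d (root (Γ.src e))) ⊔
          Submodule.span ℤ {phi (Γ.src e) + Γ.sh e - phi (Γ.tgt e)}) := by
    funext r
    by_cases hr : r = root (Γ.src e)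
    · subst hr; rw [Function.update_self]; exact hspan
    · rw [Function.update_of_ne hr, hmat r hr]
  rw [← hL] at hsem
  -- The cycle closes a tree path of at most `N` edges by one more edge, hence `D * (N + 1)`.
  have hbound : ∀ k, |loopVec Γ phi e k| ≤ B := by
    intro k
    have h1 := h.sizes.diff _ _ hab k
    have h2 := h.sizes.le (root (Γ.src e))
    have e1 : loopVec Γ phi e k = (phi (Γ.src e) k - phi (Γ.tgt e) k) + Γ.sh e k := by
      simp only [loopVec, Pi.add_apply, Pi.sub_apply]; ring
    rw [e1]
    refine (abs_add_le _ _).trans ?_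
    have h3 := hD k
    have h4 : D * c (root (Γ.src e)) + D ≤ B :=
      (by nlinarith [Nat.mul_le_mul_left D h2] : _ ≤ D * (N + 1)).trans hN
    have h5 : ((D * c (root (Γ.src e)) + D : ℕ) : ℤ) ≤ B := by exact_mod_cast h4
    push_cast at h5
    linarith
  refine ⟨⟨h.forest, ?_, ?_, ?_, hsem, ?_, ?_, h.sizes.succ, ?_, h.cur.cycle (by rw [hT])⟩,
    ⟨?_, fun i => .inl (by rw [hT]), fun i hi => hmat _ hi⟩⟩
  · rw [hf.int 10 rfl]; exact h.par_eq
  · rw [hf.int 11 rfl]; exact h.rk_eq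
  · rw [hf.int 12 rfl]; exact h.pot_eq
  · intro r
    by_cases hr : r = root (Γ.src e)
    · subst hr; exact htri
    · rw [hmat r hr]; exact h.tri r
  · intro r
    by_cases hr : r = root (Γ.src e)
    · subst hr; rw [hspan]; exact (h.gen _).sup (boundedGen_span_singleton hbound)
    · rw [hmat r hr]; exact h.gen r
  · rw [hf.int 14 rfl]; exact h.el_eq
  · rw [hf.int 23 rfl, ha]

theorem CoreInv.of_frame {s' : Store} {p : Program}
    (h : CoreInv Γ vb ev D B s P N par rk pot root phi c el dt) (hf : Frame p s s')
    (h4 : p.wI 4 = false) (h5 : p.wI 5 = false) (h6 : p.wI 6 = false) (h7 : p.wI 7 = false)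
    (h10 : p.wI 10 = false) (h11 : p.wI 11 = false) (h12 : p.wI 12 = false) (h13 : p.wI 13 = false)
    (h14 : p.wI 14 = false)
    (g3 : p.wR 3 = false) (g4 : p.wR 4 = false) (g5 : p.wR 5 = false) (g6 : p.wR 6 = false) :
    CoreInv Γ vb ev D B s' P N par rk pot root phi c el dt where
  forest := h.forest
  par_eq := by rw [hf.int 10 h10]; exact h.par_eq
  rk_eq := by rw [hf.int 11 h11]; exact h.rk_eq
  pot_eq := by rw [hf.int 12 h12]; exact h.pot_eq
  sem := by simpa only [mat_of_frame hf h13] using h.sem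
  tri := by simpa only [mat_of_frame hf h13] using h.tri
  gen := by simpa only [mat_of_frame hf h13] using h.gen
  sizes := h.sizes
  el_eq := by rw [hf.int 14 h14]; exact h.el_eq
  cur := by rw [outputTree_of_frame hf h4 h5 h6 h7 g3 g4 g5 g6]; exact h.cur

theorem Processed.of_eq {s' s₀ : Store} {e : Fin m} {ra : Fin n} {root' : Fin n → Fin n}
    (h : Processed d ev s s' e ra root root') (hT : outputTree n s = outputTree n s₀)
    (hm : ∀ R, s.mat d R = s₀.mat d R) : Processed d ev s₀ s' e ra root root' :=
  ⟨h.root_eq, hT ▸ h.ending, fun i hi => (h.other i hi).trans (hm _)⟩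

theorem process_spec (h : CoreInv Γ vb ev D B s P N par rk pot root phi c el dt)
    (hin : HasInput s u Γ vb ev) {e : Fin m} (he : s.int 21 0 = (e : ℕ))
    (hD : ∀ e k, |Γ.sh e k| ≤ D) (hsort : ∀ p ∈ P, ev p ≤ ev e)
    (hsrc : vb (Γ.src e) ≤ ev e) (htgt : vb (Γ.tgt e) ≤ ev e) (hN : N < m) (hDB : D * m ≤ B)
    (hB : 1 ≤ B) (hpos : 0 < d) (hl : pivotBound d B < 2 ^ ℓ) (hm : 2 * m ≤ 2 ^ ℓ) :
    WP process (1800 * d * d * d * (ℓ + 1)) (fun s' =>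
      ∃ par' rk' pot' root' phi' c' el' dt' ra,
        CoreInv Γ vb ev D B s' (insert e P) (N + 1) par' rk' pot' root' phi' c' el' dt' ∧
        root' (Γ.src e) = ra ∧ Processed d ev s s' e ra root root') s := by
  -- Two to the rank is at most the size `c + 1`, which is at most `m` because `N < m`.
  have hrk : ∀ x, rk (root x) ≤ ℓ := by
    intro x
    have h1 := h.sizes.rank x
    have h2 := h.sizes.le (root x)
    exact (Nat.pow_le_pow_iff_right (by norm_num : 1 < 2)).1 (by omega)
  have hN' : D * (N + 1) ≤ B := (Nat.mul_le_mul_left D hN).trans hDB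
  apply WP.time
  · apply WP.seq' (locate_spec (Γ := Γ) (ℓ := ℓ) h.forest hin.dim h.par_eq h.pot_eq hrk hin.src
      hin.tgt hin.sh he hpos)
    rintro s₁ hf₁ ⟨ha, hb, hw⟩
    have h₁ := h.of_frame hf₁ rfl rfl rfl rfl rfl rfl rfl rfl rfl rfl rfl rfl rfl
    have hin₁ := hin.of_frame hf₁ rfl rfl rfl rfl rfl rfl rfl
    have he₁ : s₁.int 21 0 = (e : ℕ) := by rw [hf₁.int 21 rfl, he]
    have hT₁ : outputTree n s₁ = outputTree n s :=
      outputTree_of_frame hf₁ rfl rfl rfl rfl rfl rfl rfl rfl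
    have hm₁ := mat_of_frame (d := d) hf₁ rfl
    refine WP.branch (T := 400 * d * d * (ℓ + 1)) (T' := 50 * d + 50 + 700 * d * d * d * (ℓ + 1))
      (fun hc => ?_) (fun hc => ?_)
    · have hab : root (Γ.src e) = root (Γ.tgt e) := by
        simp only [BExp.ieq, BExp.eval_and, BExp.eval_ile, IExp.eval_get, IExp.eval_lit, ha, hb] at hc
        exact Fin.ext (by omega)
      refine (processCycle_spec h₁ hin₁ ha hw (hD e) hab hN' hB hpos hl).mono le_rfl ?_
      rintro s' - ⟨h', hp⟩
      exact ⟨_, _, _, _, _, _, _, _, _, h', rfl, hp.of_eq hT₁ hm₁⟩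
    · have hab : root (Γ.src e) ≠ root (Γ.tgt e) := by
        intro hab
        apply hc
        simp only [BExp.ieq, BExp.eval_and, BExp.eval_ile, IExp.eval_get, IExp.eval_lit, ha, hb, hab]
        omega
      apply WP.seq' (swapRoots_spec (d := d) hin₁.dim ha hb hw)
      intro s₂ hf₂ hcase
      have h₂ := h₁.of_frame hf₂ rfl rfl rfl rfl rfl rfl rfl rfl rfl rfl rfl rfl rfl
      have hin₂ := hin₁.of_frame hf₂ rfl rfl rfl rfl rfl rfl rfl
      have he₂ : s₂.int 21 0 = (e : ℕ) := by rw [hf₂.int 21 rfl, he₁]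
      have hT₂ : outputTree n s₂ = outputTree n s := by
        rw [outputTree_of_frame hf₂ rfl rfl rfl rfl rfl rfl rfl rfl, hT₁]
      have hm₂ : ∀ R, s₂.mat d R = s.mat d R := fun R => by
        rw [mat_of_frame (d := d) hf₂ rfl, hm₁]
      have hrk₁ := h₁.rk_eq
      rcases hcase with ⟨a1, b1, w1, r1⟩ | ⟨a1, b1, w1, r1⟩
      · refine (processMerge_spec h₂ hin₂ he₂ (ShiftGraph.Extends.insert e) a1 b1 w1 (hD e) hab ?_
          hsort hsrc htgt hB hpos hl).mono le_rfl ?_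
        · rw [hrk₁, hrk₁] at r1; exact_mod_cast r1
        · rintro s' - ⟨_, _, _, root', _, _, _, _, h', e1, -, hp⟩
          exact ⟨_, _, _, _, _, _, _, _, _, h', e1, hp.of_eq hT₂ hm₂⟩
      · refine (processMerge_spec h₂ hin₂ he₂ (ShiftGraph.Extends.insert e).symm a1 b1 ?_ ?_ hab.symm ?_
          hsort htgt hsrc hB hpos hl).mono le_rfl ?_
        · rw [w1, loopVec]; abel
        · intro k; rw [Pi.neg_apply, abs_neg]; exact hD e k
        · rw [hrk₁, hrk₁] at r1; exact_mod_cast r1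
        · rintro s' - ⟨_, _, _, root', _, _, _, _, h', -, e1, hp⟩
          exact ⟨_, _, _, _, _, _, _, _, _, h', e1, hp.of_eq hT₂ hm₂⟩
  · simp only [BExp.ieq, BExp.cost_and, BExp.cost_ile, IExp.cost_get, IExp.cost_lit]
    have h1 : d ≤ d * d * d := by nlinarith [Nat.mul_le_mul hpos hpos]
    have h2 : d * d ≤ d * d * d := Nat.le_mul_of_pos_right _ hpos
    have h3 := Nat.mul_le_mul_right (ℓ + 1) h1
    have h4 := Nat.mul_le_mul_right (ℓ + 1) h2
    nlinarith [Nat.zero_le (d * d * d * ℓ)]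

end

/-! ### Epochs and the round of the main loop. -/

namespace Prog

/-- Append an epoch to the beam `V 37`. -/
def addEpoch : Program :=
  .iset 32 (.get 5 (ivar 37) + .get 6 (ivar 37)) ;;
  .setReal 5 (ivar 32) (.get 1 (ivar 21)) ;;
  .setReal 6 (ivar 32) (rvar 22 / rvar 11 * .get 10 (D - ivar 33)) ;;
  .setInt 7 (ivar 32) (D - ivar 33) ;;
  .setInt 6 (ivar 37) (.get 6 (ivar 37) + .lit 1)

/-- Process the edge with the smallest value. -/
def event : Program :=
  .iset 21 (.get 15 (.lit 1)) ;; removeEdge ;; process ;; latVol ;;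
  .iset 37 (.get 14 (ivar 23)) ;; addEpoch

end Prog

theorem addEpoch_spec {n m d : ℕ} {s : Store} {surv : Fin n} {e : Fin m} {x : ℝ}
    (h37 : s.int 37 0 = (surv : ℕ)) (h21 : s.int 21 0 = (e : ℕ)) (hd : s.int 0 0 = d)
    (h5 : ∀ i : Fin n, s.int 5 (i : ℕ) = (i : ℕ) * (m + 1)) (hx : s.real 1 (e : ℕ) = x)
    (hep : ∀ i, (outputTree n s).epochs i ≤ m) (hpos : 0 < (outputTree n s).epochs surv) :
    WP addEpoch 60 (fun s' =>
      (outputTree n s').ending = (outputTree n s).ending ∧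
      (outputTree n s').epochs =
        Function.update (outputTree n s).epochs surv ((outputTree n s).epochs surv + 1) ∧
      (∀ i, ∀ k < (outputTree n s).epochs i, (outputTree n s').start i k = (outputTree n s).start i k ∧
        (outputTree n s').mono i k = (outputTree n s).mono i k) ∧
      (outputTree n s').start surv ((outputTree n s).epochs surv) = x ∧
      (outputTree n s').mono surv ((outputTree n s).epochs surv) =
        ⟨s.real 22 0 / s.real 11 0 * s.real 10 (d - s.int 33 0), d - s.int 33 0⟩) s := by
  set E := (outputTree n s).epochs surv with hE
  have h6 : s.int 6 (surv : ℕ) = E := by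
    have : E = (s.int 6 (surv : ℕ)).toNat := rfl
    omega
  -- Each beam owns a block of `m + 1` positions: one for the initial epoch and one for every edge.
  -- The blocks cannot run into each other.
  have hne : ∀ i : Fin n, ∀ k < (outputTree n s).epochs i,
      ((i : ℕ) : ℤ) * (m + 1) + k ≠ ((surv : ℕ) : ℤ) * (m + 1) + E := by
    intro i k hk h
    have h1 := hep i
    have h2 := hep surv
    have h' : (i : ℕ) * (m + 1) + k = surv * (m + 1) + E := by exact_mod_cast h
    obtain ⟨h3, h4⟩ := nat_mul_add_inj (d := m + 1) (by omega) (by omega) h'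
    have : i = surv := Fin.ext h3
    subst this
    omega
  apply WP.time
  · apply WP.seq
    apply WP.setInt
    apply WP.seq
    apply WP.setReal
    apply WP.seq
    apply WP.setReal
    apply WP.seq
    apply WP.setInt
    apply WP.setInt
    have hcast : ∀ i : Fin n, ((i : ℕ) = (surv : ℕ)) ↔ i = surv := fun i => Fin.ext_iff.symm
    refine ⟨rfl, ?_, fun i k hk => ?_, ?_, ?_⟩
    · funext i
      by_cases hi : i = surv
      · subst hi
        simp [outputTree, h37, h6]
      · rw [Function.update_of_ne hi]
        simp [outputTree, h37, hcast, hi]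
    · have := hne i k hk
      simp [outputTree, h37, h5, h6, this]
    · simp [outputTree, h37, h5, h6, h21, hx]
    · simp [outputTree, h37, h5, h6, hd]
  · simp


/-- The invariant of the main loop. -/
structure MainInv {n m d : ℕ} (Γ : ShiftGraph n m d) (vb : Fin n → ℝ) (ev : Fin m → ℝ)
    (b : Module.Basis (Fin d) ℝ (E d)) (D B N : ℕ) (P : Set (Fin m)) (alive : Finset (Fin m))
    (s : Store) : Prop where
  input : HasInput s b Γ vb ev
  core : ∃ par rk pot root phi c el dt, CoreInv Γ vb ev D B s P N par rk pot root phi c el dt ∧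
    EpochInv vb ev (monoOf b) P N (outputTree n s) root (fun r => rowSpan (s.mat d r))
  hist : ∀ t, lowEdges ev t ⊆ P → (∃ e ∈ P, t < ev e) →
    GoodAt Γ vb ev (monoOf b) (outputTree n s) t
  birth : (outputTree n s).birth = vb
  vol : s.real 11 0 = latticeVolume (latticeOf b)
  balls : ∀ q : ℕ, q ≤ d → s.real 10 q = ballVolume q
  position : ∀ i : Fin n, s.int 5 (i : ℕ) = (i : ℕ) * (m + 1)
  tournament : IsTournament (s.real 1) (s.int 15) alive
  mem : ∀ e, e ∈ P ↔ e ∉ alive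
  card : alive.card + N = m
  sorted : ∀ p ∈ P, ∀ e ∈ alive, ev p ≤ ev e

open Prog

section
variable {n m d D B N ℓ : ℕ} {Γ : ShiftGraph n m d} {vb : Fin n → ℝ} {ev : Fin m → ℝ}
    {b : Module.Basis (Fin d) ℝ (E d)} {P : Set (Fin m)} {alive : Finset (Fin m)} {s : Store}

theorem event_spec (h : MainInv Γ vb ev b D B N P alive s) (hD : ∀ e k, |Γ.sh e k| ≤ D)
    (hsrc : ∀ e, vb (Γ.src e) ≤ ev e) (htgt : ∀ e, vb (Γ.tgt e) ≤ ev e) (hN : N < m)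
    (hDB : D * m ≤ B) (hB : 1 ≤ B) (hpos : 0 < d) (hl : pivotBound d B < 2 ^ ℓ)
    (hm : 2 * m ≤ 2 ^ ℓ) :
    WP event (3000 * d * d * d * (ℓ + 1))
      (fun s' => ∃ P' alive', MainInv Γ vb ev b D B (N + 1) P' alive' s') s := by
  obtain ⟨par, rk, pot, root, phi, c, el, dt, hC, hE⟩ := h.core
  have hne : alive.Nonempty := by
    rw [← Finset.card_pos]; have := h.card; omega
  obtain ⟨e, hea, he, hmin⟩ := h.tournament.root hne
  have hsort : ∀ p ∈ P, ev p ≤ ev e := fun p hp => h.sorted p hp e hea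
  -- The rest of the invariant follows from these facts: the history by `hist_step`, the order of
  -- the edges by minimality of `e`, and the tables by the frame.
  suffices H : WP event (3000 * d * d * d * (ℓ + 1)) (fun s' =>
      (∃ par rk pot root phi c el dt,
        CoreInv Γ vb ev D B s' (insert e P) (N + 1) par rk pot root phi c el dt ∧
        EpochInv vb ev (monoOf b) (insert e P) (N + 1) (outputTree n s') root
          (fun r => rowSpan (s'.mat d r))) ∧
      Appends (outputTree n s) (outputTree n s') (ev e) ∧
      IsTournament (s.real 1) (s'.int 15) (alive.erase e)) s by
    refine H.mono le_rfl ?_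
    rintro s' hf ⟨h1, h2, h3⟩
    refine ⟨insert e P, alive.erase e, h.input.of_frame hf rfl rfl rfl rfl rfl rfl rfl, h1,
      hist_step hC.sem hC.cur hE hsort h.hist h2, ?_, ?_, ?_, ?_, ?_, ?_, ?_, ?_⟩
    · rw [← h.birth]
      funext i
      simp only [outputTree, hf.real 3 rfl]
    · rw [hf.real 11 rfl]; exact h.vol
    · rw [hf.real 10 rfl]; exact h.balls
    · rw [hf.int 5 rfl]; exact h.position
    · rw [hf.real 1 rfl]; exact h3
    · intro p
      rw [Set.mem_insert_iff, h.mem, Finset.mem_erase]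
      tauto
    · have := h.card
      have := Finset.card_pos.2 hne
      rw [Finset.card_erase_of_mem hea]
      omega
    · intro p hp q hq
      have hq' := Finset.mem_of_mem_erase hq
      rcases hp with rfl | hp
      · have := hmin q hq'
        rwa [h.input.edge, h.input.edge] at this
      · exact h.sorted p hp q hq'
  apply WP.time
  · apply WP.seq
    apply WP.setInt
    set s₀ := s.setInt 21 ((IExp.lit 0).eval s) ((IExp.get 15 (.lit 1)).eval s) with hs₀
    have hf₀ : Frame (.iset 21 (.get 15 (.lit 1))) s s₀ := (Runs.setInt _ _ _ _).frame
    have he₀ : s₀.int 21 0 = (e : ℕ) := by simp [hs₀, he]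
    apply WP.seq' (removeEdge_spec (m := m) (ℓ := ℓ) (alive := alive) (e := e) ?_ he₀ ?_ hm)
    rotate_left 2
    · rw [hf₀.int 0 rfl]; exact h.input.card_edge
    · rw [hf₀.real 1 rfl, hf₀.int 15 rfl]; exact h.tournament
    intro s₁ hf₁ hT₁
    have hC₁ := (hC.of_frame hf₀ rfl rfl rfl rfl rfl rfl rfl rfl rfl rfl rfl rfl rfl).of_frame hf₁
      rfl rfl rfl rfl rfl rfl rfl rfl rfl rfl rfl rfl rfl
    have hin₁ := (h.input.of_frame hf₀ rfl rfl rfl rfl rfl rfl rfl).of_frame hf₁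
      rfl rfl rfl rfl rfl rfl rfl
    have hO₁ : outputTree n s₁ = outputTree n s := by
      rw [outputTree_of_frame hf₁ rfl rfl rfl rfl rfl rfl rfl rfl,
        outputTree_of_frame hf₀ rfl rfl rfl rfl rfl rfl rfl rfl]
    have hM₁ : ∀ R, s₁.mat d R = s.mat d R := fun R => by
      rw [mat_of_frame hf₁ rfl, mat_of_frame hf₀ rfl]
    apply WP.seq' (process_spec (ℓ := ℓ) hC₁ hin₁ (e := e) ?_ hD hsort (hsrc e) (htgt e) hN hDB hB
      hpos hl hm)
    rotate_left 2
    · rw [hf₁.int 21 rfl, he₀]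
    rintro s₂ hf₂ ⟨par', rk', pot', root', phi', c', el', dt', ra, hC₂, hra, hP⟩
    have hP := hP.of_eq hO₁ hM₁
    have hin₂ := hin₁.of_frame hf₂ rfl rfl rfl rfl rfl rfl rfl
    apply WP.seq' (latVol_spec (d := d) (R := ra) (u := b) hin₂.dim hP.root_eq hin₂.basis hpos)
    rintro s₃ hf₃ ⟨hvol, hrank⟩
    have hC₃ := hC₂.of_frame hf₃ rfl rfl rfl rfl rfl rfl rfl rfl rfl rfl rfl rfl rfl
    apply WP.seq
    apply WP.setInt
    set s₄ := s₃.setInt 37 ((IExp.lit 0).eval s₃) ((IExp.get 14 (ivar 23)).eval s₃) with hs₄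
    have hf₄ : Frame (.iset 37 (.get 14 (ivar 23))) s₃ s₄ := (Runs.setInt _ _ _ _).frame
    have hC₄ := hC₃.of_frame hf₄ rfl rfl rfl rfl rfl rfl rfl rfl rfl rfl rfl rfl rfl
    have hO₄ : outputTree n s₄ = outputTree n s₂ := by
      rw [outputTree_of_frame hf₄ rfl rfl rfl rfl rfl rfl rfl rfl,
        outputTree_of_frame hf₃ rfl rfl rfl rfl rfl rfl rfl rfl]
    have hepo : (outputTree n s₂).epochs = (outputTree n s).epochs := by
      rw [← hO₁]; funext i; simp only [outputTree, hf₂.int 6 rfl]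
    have hstart : (outputTree n s₂).start = (outputTree n s).start := by
      rw [← hO₁]; funext i; simp only [outputTree, hf₂.int 5 rfl, hf₂.real 5 rfl]
    have hmono : (outputTree n s₂).mono = (outputTree n s).mono := by
      rw [← hO₁]; funext i; simp only [outputTree, hf₂.int 5 rfl, hf₂.int 7 rfl, hf₂.real 6 rfl]
    have hel : s₂.int 14 (ra : ℕ) = (el' ra : ℕ) := by
      have := hC₂.el_eq (Γ.src e)
      rwa [hra] at this
    have h37 : s₄.int 37 0 = (el' ra : ℕ) := by
      simp [hs₄, hf₃.int 14 rfl, hf₃.int 23 rfl, hP.root_eq, hel]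
    apply (addEpoch_spec (m := m) (e := e) (x := ev e) h37 (d := d) ?_ ?_ ?_ ?_ ?_ ?_).mono le_rfl
    rotate_left 1
    · rw [hf₄.int 21 rfl, hf₃.int 21 rfl, hf₂.int 21 rfl, hf₁.int 21 rfl, he₀]
    · rw [hf₄.int 0 rfl, hf₃.int 0 rfl]; exact hin₂.dim
    · rw [hf₄.int 5 rfl, hf₃.int 5 rfl, hf₂.int 5 rfl, hf₁.int 5 rfl, hf₀.int 5 rfl]
      exact h.position
    · rw [hf₄.real 1 rfl, hf₃.real 1 rfl]; exact hin₂.edge e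
    · intro i
      rw [hO₄, hepo]
      exact (hE.le i).trans hN
    · rw [hO₄, hepo]
      exact hE.pos _
    rintro s₅ hf₅ ⟨hend, hep, hold, hnew, hmon⟩
    rw [hO₄, hepo] at hep hold hnew hmon
    rw [hstart, hmono] at hold
    rw [hO₄] at hend
    have hA : Appends (outputTree n s) (outputTree n s₅) (ev e) := by
      refine ⟨by rw [hend]; exact hP.ending, fun i => ?_, hold, fun i k h1 h2 => ?_⟩
      · rw [hep]
        by_cases hi : i = el' ra
        · subst hi; simp
        · rw [Function.update_of_ne hi]
      · rw [hep] at h2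
        by_cases hi : i = el' ra
        · subst hi
          rw [Function.update_self] at h2
          rw [show k = (outputTree n s).epochs (el' ra) by omega]
          exact hnew
        · rw [Function.update_of_ne hi] at h2; omega
    have hM₄ : ∀ R, s₄.mat d R = s₂.mat d R := fun R => by
      rw [mat_of_frame hf₄ rfl, mat_of_frame hf₃ rfl]
    have hM₅ : ∀ R, s₅.mat d R = s₂.mat d R := fun R => by rw [mat_of_frame hf₅ rfl, hM₄]
    have hroot : root' (el' ra) = ra := by
      have := hC₂.cur.el_root (Γ.src e)
      rwa [hra] at this
    have htri := hC₂.tri ra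
    refine ⟨⟨par', rk', pot', root', phi', c', el', dt', ?_, ?_⟩, hA, ?_⟩
    · refine ⟨hC₄.forest, ?_, ?_, ?_, ?_, ?_, ?_, hC₄.sizes, ?_,
        hC₂.cur.congr hend⟩
      · rw [hf₅.int 10 rfl]; exact hC₄.par_eq
      · rw [hf₅.int 11 rfl]; exact hC₄.rk_eq
      · rw [hf₅.int 12 rfl]; exact hC₄.pot_eq
      · simp only [hM₅]; exact hC₂.sem
      · simp only [hM₅]; exact hC₂.tri
      · simp only [hM₅]; exact hC₂.gen
      · rw [hf₅.int 14 rfl]; exact hC₄.el_eq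
    · refine hE.step (surv := el' ra) hsort hA ?_ hep ?_ ?_
      · have := hC₂.cur.el_birth (Γ.src e)
        rw [hra] at this
        exact this.trans (hsrc e)
      · rw [hmon, hM₅, hroot]
        have hr : s₄.int 33 0 = (latticeDim ((rowSpan (s₂.mat d ra)).map (latHom b)) : ℕ) := by
          rw [hf₄.int 33 rfl, hrank, latticeDim_tri b htri]
        have hle := latticeDim_le b htri
        rw [hr, ← Nat.cast_sub hle, hf₄.real 10 rfl, hf₃.real 10 rfl, hf₂.real 10 rfl,
          hf₁.real 10 rfl, hf₀.real 10 rfl, h.balls _ (Nat.sub_le _ _), hf₄.real 22 rfl, hvol,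
          ← latticeVolume_tri b htri, hf₄.real 11 rfl, hf₃.real 11 rfl, hf₂.real 11 rfl,
          hf₁.real 11 rfl, hf₀.real 11 rfl, h.vol, monoOf, Nat.cast_sub hle]
      · intro i hi hne'
        rw [hM₅]
        rw [hP.other i]
        -- An unfinished beam is the eldest of its component. Were its component the one just
        -- changed, it would be the survivor.
        intro hir
        have := hC₂.cur.alive_el i (by rw [← hend]; exact hi)
        rw [hir] at this
        exact hne' this.symm
    · rw [hf₅.int 15 rfl, hf₄.int 15 rfl, hf₃.int 15 rfl, hf₂.int 15 rfl]
      rw [hf₀.real 1 rfl] at hT₁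
      exact hT₁
  · simp only [IExp.cost_lit, IExp.cost_get]
    have h1 : 1 ≤ d * d * d := Nat.mul_pos (Nat.mul_pos hpos hpos) hpos
    have h2 := Nat.mul_le_mul_right (ℓ + 1) h1
    nlinarith [Nat.zero_le (d * d * d * ℓ)]

end


/-! ### Initialization -/

namespace Prog

/-- Compute the volumes of the unit balls up to dimension `d`. -/
def ballTable : Program :=
  .setReal 10 (.lit 0) (.ofInt (.lit 1)) ;; .setReal 10 (.lit 1) (.ofInt (.lit 2)) ;;
  .forN 20 (D + .lit 1) (.branch (.ile (.lit 2) (ivar 20))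
    (.setReal 10 (ivar 20)
      (.get 10 (ivar 20 - .lit 2) * (.ofInt (.lit 2) * .pi / .ofInt (ivar 20)))) .skip)

/-- Store the identity matrix in the slot behind the matrices of the vertices. -/
def identity : Program :=
  .iset 23 (.get 0 (.lit 1)) ;;
  .forN 20 D (.setInt 13 ((ivar 23 * D + ivar 20) * D + ivar 20) (.lit 1))

/-- Start a beam and a singleton component for every vertex. -/
def singletons : Program :=
  .forN 20 (.get 0 (.lit 1))
    (.setInt 4 (ivar 20) (.lit (-1)) ;;
    .setInt 5 (ivar 20) (ivar 20 * (mE + .lit 1)) ;;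
    .setInt 6 (ivar 20) (.lit 1) ;;
    .setInt 7 (.get 5 (ivar 20)) D ;;
    .setReal 3 (ivar 20) (.get 0 (ivar 20)) ;;
    .setReal 5 (.get 5 (ivar 20)) (.get 0 (ivar 20)) ;;
    .setReal 6 (.get 5 (ivar 20)) (.ofInt (.lit 1) / rvar 11 * .get 10 D) ;;
    .setInt 10 (ivar 20) (ivar 20) ;;
    .setInt 14 (ivar 20) (ivar 20))

/-- The algorithm. -/
def main : Program :=
  ballTable ;; identity ;; latVol ;; .rset 11 (rvar 22) ;; singletons ;; buildTournament ;;
  .forN 20 mE event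

end Prog

open Prog

theorem ballTable_spec {d : ℕ} {s : Store} (hd : s.int 0 0 = d) (hpos : 0 < d) :
    WP ballTable (200 * d) (fun s' => ∀ q : ℕ, q ≤ d → s'.real 10 q = ballVolume q) s := by
  apply WP.time
  · apply WP.seq
    apply WP.setReal
    apply WP.seq
    apply WP.setReal
    refine WP.forN (fun i s' => ∀ q : ℕ, q < 2 ∨ q < i → s'.real 10 q = ballVolume q) (d + 1) 30
      ?_ rfl ?_ ?_ ?_
    · intro q hq
      have : q = 0 ∨ q = 1 := by omega
      rcases this with rfl | rfl <;> simp [ballVolume_zero, ballVolume_one]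
    · intro s' hf
      simp [hf.int 0 rfl, hd]
    · intro i hi s' hf hi' h
      apply WP.time
      · refine WP.branch (T := 20) (T' := 1) (fun hc => ?_) (fun hc => ?_)
        · refine WP.time (.setReal ?_) (by simp)
          simp only [BExp.eval_ile, IExp.eval_lit, IExp.eval_get, hi'] at hc
          obtain ⟨j, rfl⟩ : ∃ j, i = j + 2 := ⟨i - 2, by omega⟩
          intro q hq
          have e : (((j + 2 : ℕ) : ℤ) - 2) = (j : ℕ) := by push_cast; ring
          by_cases hqj : q = j + 2
          · subst hqj
            have := h j (by omega)
            simp only [IExp.eval_lit, IExp.eval_get, hi', Store.setInt_real,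
              Store.setReal_real_same, if_true, RExp.eval_hmul, RExp.eval_hdiv, RExp.eval_get,
              IExp.eval_hsub, e, RExp.eval_ofInt, RExp.eval_pi, this, ballVolume_add_two]
            push_cast; rfl
          · have := h q (by omega)
            have hne : ((q : ℤ)) ≠ ((j + 2 : ℕ) : ℤ) := by exact_mod_cast hqj
            simp only [IExp.eval_lit, IExp.eval_get, hi', Store.setInt_real,
              Store.setReal_real_same, if_neg hne, this]
        · refine WP.skip ?_
          simp only [BExp.eval_ile, IExp.eval_lit, IExp.eval_get, hi'] at hc
          intro q hq
          exact h q (by omega)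
      · simp
    · intro s' hf h q hq
      exact h q (by omega)
  · simp; omega

theorem identity_spec {n d : ℕ} {s : Store} (hd : s.int 0 0 = d) (hn : s.int 0 1 = n)
    (h13 : ∀ z, s.int 13 z = 0) (hpos : 0 < d) :
    WP identity (100 * d) (fun s' => s'.int 23 0 = n ∧ s'.mat d n = idMat d ∧
      ∀ r, r ≠ n → s'.mat d r = 0) s := by
  apply WP.time
  · apply WP.seq
    apply WP.setInt
    refine WP.forN (fun i s' => ∀ (R : ℕ) (k c : Fin d), s'.int 13 (matIdx d R k c) =
      if R = n ∧ k = c ∧ (k : ℕ) < i then 1 else 0) d 30 ?_ rfl ?_ ?_ ?_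
    · intro R k c
      simp [h13]
    · intro s' hf
      simp [hf.int 0 rfl, hd]
    · intro i hi s' hf hi' h
      refine WP.time (.setInt ?_) (by simp)
      intro R k c
      have h0 := hf.int 0 rfl
      have h23 := hf.int 23 rfl
      have hm : ((n : ℤ) * d + (i : ℕ)) * d + (i : ℕ) = matIdx d n ⟨i, hi⟩ ⟨i, hi⟩ := rfl
      have := h R k c
      simp only [IExp.eval_hadd, IExp.eval_hmul, IExp.eval_get, IExp.eval_lit, hi', h0, h23, ne_eq,
        Nat.reduceEqDiff, not_false_eq_true, Store.setInt_int_ne, Store.setInt_int_same, hd, hn,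
        OfNat.zero_ne_ofNat, if_true, hm, matIdx_inj, this]
      by_cases h1 : R = n ∧ k = ⟨i, hi⟩ ∧ c = ⟨i, hi⟩
      · obtain ⟨rfl, rfl, rfl⟩ := h1
        simp
      · rw [if_neg h1]
        congr 1
        rw [eq_iff_iff]
        refine ⟨fun ⟨a, b, c⟩ => ⟨a, b, by omega⟩, fun ⟨a, b, c⟩ => ⟨a, b, ?_⟩⟩
        by_contra hc
        have : k = ⟨i, hi⟩ := Fin.ext (by simp; omega)
        exact h1 ⟨a, this, b ▸ this⟩
    · intro s' hf h
      refine ⟨?_, ?_, ?_⟩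
      · simp [hf.int 23 rfl, hn]
      · funext k c
        simp only [Store.mat, h, idMat]
        simp
      · intro r hr
        funext k c
        simp [Store.mat, h, hr]
  · simp; omega

theorem singletons_spec {n m d : ℕ} {s : Store} {vb : Fin n → ℝ} (hd : s.int 0 0 = d)
    (hn : s.int 0 1 = n) (hm : s.int 0 2 = m) (hvb : ∀ i : Fin n, s.real 0 (i : ℕ) = vb i) :
    WP singletons (300 * n + 20) (fun s' => ∀ j : Fin n, s'.int 4 (j : ℕ) = -1 ∧
      s'.int 5 (j : ℕ) = (j : ℕ) * (m + 1) ∧ s'.int 6 (j : ℕ) = 1 ∧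
      s'.int 7 ((j : ℕ) * (m + 1)) = d ∧ s'.real 3 (j : ℕ) = vb j ∧
      s'.real 5 ((j : ℕ) * (m + 1)) = vb j ∧
      s'.real 6 ((j : ℕ) * (m + 1)) = 1 / s.real 11 0 * s.real 10 d ∧
      s'.int 10 (j : ℕ) = (j : ℕ) ∧ s'.int 14 (j : ℕ) = (j : ℕ)) s := by
  apply WP.time
  · refine WP.forN (fun i s' => ∀ j : Fin n, (j : ℕ) < i → s'.int 4 (j : ℕ) = -1 ∧
      s'.int 5 (j : ℕ) = (j : ℕ) * (m + 1) ∧ s'.int 6 (j : ℕ) = 1 ∧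
      s'.int 7 ((j : ℕ) * (m + 1)) = d ∧ s'.real 3 (j : ℕ) = vb j ∧
      s'.real 5 ((j : ℕ) * (m + 1)) = vb j ∧
      s'.real 6 ((j : ℕ) * (m + 1)) = 1 / s.real 11 0 * s.real 10 d ∧
      s'.int 10 (j : ℕ) = (j : ℕ) ∧ s'.int 14 (j : ℕ) = (j : ℕ)) n 200 (by simp) rfl ?_ ?_ ?_
    · intro s' hf
      simp [hf.int 0 rfl, hn]
    · intro i hi s' hf hi' h
      apply WP.time
      · iterate 8 apply WP.seq; first | apply WP.setInt | apply WP.setReal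
        apply WP.setInt
        intro j hj
        have h0 := hf.int 0 rfl
        have hr0 := hf.real 0 rfl
        have h11 := hf.real 11 rfl
        have h10 := hf.real 10 rfl
        have hpos : ((m : ℤ) + 1) ≠ 0 := by omega
        by_cases hji : (j : ℕ) = i
        · subst hji
          simp [hi', h0, hr0, h11, h10, hd, hm, hvb]
        · have := h j (by omega)
          have hc : (((j : ℕ) : ℤ) = (i : ℕ)) ↔ False := by
            rw [Nat.cast_inj]; simpa using hji
          simpa [hi', h0, hr0, h11, h10, hd, hm, hpos, hji, hc] using this
      · simp
    · intro s' hf h j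
      exact h j j.2
  · simp; omega


open Prog

theorem MainInv.of_frame {n m d D B N : ℕ} {Γ : ShiftGraph n m d} {vb : Fin n → ℝ} {ev : Fin m → ℝ}
    {b : Module.Basis (Fin d) ℝ (E d)} {P : Set (Fin m)} {alive : Finset (Fin m)} {s s' : Store}
    {z : ℤ} (h : MainInv Γ vb ev b D B N P alive s) (hf : Frame (.iset 20 (.lit z)) s s') :
    MainInv Γ vb ev b D B N P alive s' := by
  have hT : outputTree n s' = outputTree n s :=
    outputTree_of_frame hf rfl rfl rfl rfl rfl rfl rfl rfl
  refine ⟨h.input.of_frame hf rfl rfl rfl rfl rfl rfl rfl, ?_, ?_, ?_, ?_, ?_, ?_, ?_, h.mem, h.card,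
    h.sorted⟩
  · obtain ⟨par, rk, pot, root, phi, c, el, dt, hC, hE⟩ := h.core
    refine ⟨par, rk, pot, root, phi, c, el, dt,
      hC.of_frame hf rfl rfl rfl rfl rfl rfl rfl rfl rfl rfl rfl rfl rfl, ?_⟩
    simpa only [hT, mat_of_frame hf rfl] using hE
  · rw [hT]; exact h.hist
  · rw [hT]; exact h.birth
  · rw [hf.real 11 rfl]; exact h.vol
  · rw [hf.real 10 rfl]; exact h.balls
  · rw [hf.int 5 rfl]; exact h.position
  · rw [hf.real 1 rfl, hf.int 15 rfl]; exact h.tournament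

theorem MainInv.setInt {n m d D B N : ℕ} {Γ : ShiftGraph n m d} {vb : Fin n → ℝ} {ev : Fin m → ℝ}
    {b : Module.Basis (Fin d) ℝ (E d)} {P : Set (Fin m)} {alive : Finset (Fin m)} {s : Store}
    (h : MainInv Γ vb ev b D B N P alive s) (z : ℤ) :
    MainInv Γ vb ev b D B N P alive (s.setInt 20 0 z) :=
  h.of_frame (Runs.setInt 20 (.lit 0) (.lit z) s).frame

theorem MainInv.treeSpec {n m d D B : ℕ} {Γ : ShiftGraph n m d} {vb : Fin n → ℝ} {ev : Fin m → ℝ}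
    {b : Module.Basis (Fin d) ℝ (E d)} {P : Set (Fin m)} {alive : Finset (Fin m)} {s : Store}
    (h : MainInv Γ vb ev b D B m P alive s) : TreeSpec Γ vb ev (monoOf b) (outputTree n s) := by
  have ha : alive = ∅ := by
    rw [← Finset.card_eq_zero]; have := h.card; omega
  have hP : P = Set.univ := by
    ext e; simp [h.mem, ha]
  subst hP
  obtain ⟨par, rk, pot, root, phi, c, el, dt, hC, hE⟩ := h.core
  exact treeSpec_of_inv h.birth hC.sem hC.cur hE h.hist

/-- The number `ℓ` bounds three quantities at once: the logarithm of the pivots, the depth of the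
tournament, and the height of the union-find trees. -/
theorem main_spec {n m d D B ℓ : ℕ} {Γ : ShiftGraph n m d} {vb : Fin n → ℝ} {ev : Fin m → ℝ}
    {b : Module.Basis (Fin d) ℝ (E d)} {s : Store} (hin : HasInput s b Γ vb ev)
    (h11 : ∀ z, s.int 11 z = 0) (h12 : ∀ z, s.int 12 z = 0) (h13 : ∀ z, s.int 13 z = 0)
    (hD : ∀ e k, |Γ.sh e k| ≤ D)
    (hsrc : ∀ e, vb (Γ.src e) ≤ ev e) (htgt : ∀ e, vb (Γ.tgt e) ≤ ev e) (hmpos : 0 < m)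
    (hDB : D * m ≤ B) (hB : 1 ≤ B) (hpos : 0 < d) (hl : pivotBound d B < 2 ^ ℓ)
    (hm : 2 * m ≤ 2 ^ ℓ) :
    WP Prog.main (300 * n + 6000 * m * (d * d * d * (ℓ + 1)))
      (fun s' => TreeSpec Γ vb ev (monoOf b) (outputTree n s')) s := by
  apply WP.time
  · apply WP.seq' (ballTable_spec hin.dim hpos)
    intro s₁ hf₁ hball
    have hin₁ := hin.of_frame hf₁ rfl rfl rfl rfl rfl rfl rfl
    apply WP.seq' (identity_spec hin₁.dim hin₁.card_vert (by rw [hf₁.int 13 rfl]; exact h13) hpos)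
    rintro s₂ hf₂ ⟨h23, hid, hmat⟩
    have hin₂ := hin₁.of_frame hf₂ rfl rfl rfl rfl rfl rfl rfl
    apply WP.seq' (latVol_spec (u := b) hin₂.dim h23 hin₂.basis hpos)
    rintro s₃ hf₃ ⟨hvol, -⟩
    have hin₃ := hin₂.of_frame hf₃ rfl rfl rfl rfl rfl rfl rfl
    rw [hid, ← latticeVolume_tri b (idMat_tri d), map_rowSpan_idMat] at hvol
    apply WP.seq
    apply WP.setReal
    set s₄ := s₃.setReal 11 ((IExp.lit 0).eval s₃) ((rvar 22).eval s₃) with hs₄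
    have hf₄ : Frame (.rset 11 (rvar 22)) s₃ s₄ := (Runs.setReal _ _ _ _).frame
    have hv₄ : s₄.real 11 0 = latticeVolume (latticeOf b) := by simp [hs₄, hvol]
    have hb₄ : ∀ q : ℕ, q ≤ d → s₄.real 10 q = ballVolume q := by
      rw [hf₄.real 10 rfl, hf₃.real 10 rfl, hf₂.real 10 rfl]; exact hball
    have hin₄ := hin₃.of_frame hf₄ rfl rfl rfl rfl rfl rfl rfl
    apply WP.seq' (singletons_spec hin₄.dim hin₄.card_vert hin₄.card_edge hin₄.vert)
    intro s₅ hf₅ hsing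
    have hin₅ := hin₄.of_frame hf₅ rfl rfl rfl rfl rfl rfl rfl
    apply WP.seq' (buildTournament_spec hin₅.card_edge hmpos)
    intro s₆ hf₆ htour
    have hin₆ := hin₅.of_frame hf₆ rfl rfl rfl rfl rfl rfl rfl
    have hmat₆ : ∀ r : Fin n, s₆.mat d r = 0 := fun r => by
      rw [mat_of_frame hf₆ rfl, mat_of_frame hf₅ rfl, mat_of_frame hf₄ rfl, mat_of_frame hf₃ rfl,
        hmat r r.2.ne]
    have hspan : rowSpan (0 : Fin d → Fin d → ℤ) = ⊥ := by
      rw [rowSpan, Submodule.span_eq_bot]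
      rintro _ ⟨k, rfl⟩; rfl
    have hO : outputTree n s₆ = outputTree n s₅ :=
      outputTree_of_frame hf₆ rfl rfl rfl rfl rfl rfl rfl rfl
    have hend : ∀ i, (outputTree n s₅).ending i = none := fun i => by
      simp [outputTree, (hsing i).1]
    have hepo : ∀ i, (outputTree n s₅).epochs i = 1 := fun i => by
      simp [outputTree, (hsing i).2.2.1]
    have hstart : ∀ i, (outputTree n s₅).start i 0 = vb i := fun i => by
      obtain ⟨-, h5, -, -, -, h, -⟩ := hsing i
      simp [outputTree, h5, h]
    -- Memory that is initially zero already encodes rank zero, zero potentials and trivial lattices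
    -- at all vertices. This keeps the initialization linear in `n`, without a factor depending on
    -- `d`.
    have h0 : MainInv Γ vb ev b D B 0 ∅ Finset.univ s₆ := by
      refine ⟨hin₆, ⟨id, 0, 0, id, 0, 0, id, 0, ⟨Forest.discrete, ?_, ?_, ?_, ?_, ?_, ?_, ?_, ?_, ?_⟩,
        ?_⟩, ?_, ?_, ?_, ?_, ?_, ?_, ?_, ?_, ?_⟩
      · intro x
        rw [hf₆.int 10 rfl]; exact (hsing x).2.2.2.2.2.2.2.1
      · intro x
        rw [hf₆.int 11 rfl, hf₅.int 11 rfl, hf₄.int 11 rfl, hf₃.int 11 rfl, hf₂.int 11 rfl,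
          hf₁.int 11 rfl, h11]; rfl
      · intro x k
        rw [hf₆.int 12 rfl, hf₅.int 12 rfl, hf₄.int 12 rfl, hf₃.int 12 rfl, hf₂.int 12 rfl,
          hf₁.int 12 rfl, h12]; rfl
      · have : (fun r : Fin n => rowSpan (s₆.mat d r)) = ⊥ := by
          funext r; rw [hmat₆, hspan]; rfl
        rw [this]
        exact ShiftGraph.sem_empty
      · intro r
        rw [hmat₆]
        exact fun k => ⟨fun _ _ => rfl, fun _ => rfl⟩
      · intro r
        rw [hmat₆, hspan]
        exact boundedGen_bot B
      · exact ⟨by simp, by simp, by simp⟩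
      · intro x
        rw [hf₆.int 14 rfl]; exact (hsing x).2.2.2.2.2.2.2.2
      · rw [hO]
        exact ⟨fun x => hend _, fun x => rfl, fun x => le_rfl, fun i _ => rfl,
          fun i j h hi => by rw [hend] at hi; cases hi⟩
      · rw [hO]
        refine ⟨fun i => by rw [hepo]; norm_num, fun i => by rw [hepo], hstart,
          fun i k l hkl hl => ?_, fun i k hk => .inl ?_, fun i _ => ?_⟩
        · rw [hepo] at hl
          rw [show k = l by omega]
        · rw [hepo] at hk
          rw [show k = 0 by omega, hstart]
        · rw [hepo, hmat₆, hspan, monoOf_bot]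
          obtain ⟨-, h5, -, h7, -, -, h6, -⟩ := hsing i
          simp [outputTree, h5, h7, h6, hv₄, hb₄ d le_rfl]
      · rintro t - ⟨e, he, -⟩
        exact absurd he (Set.notMem_empty e)
      · rw [hO]
        funext i
        exact (hsing i).2.2.2.2.1
      · rw [hf₆.real 11 rfl, hf₅.real 11 rfl]; exact hv₄
      · rw [hf₆.real 10 rfl, hf₅.real 10 rfl]; exact hb₄
      · intro i
        rw [hf₆.int 5 rfl]; exact (hsing i).2.1
      · rw [hf₆.real 1 rfl]; exact htour
      · simp
      · simp
      · intro p hp; exact absurd hp (Set.notMem_empty p)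
    refine WP.forN (fun i s' => ∃ P alive, MainInv Γ vb ev b D B i P alive s') m
      (3000 * d * d * d * (ℓ + 1)) ⟨_, _, h0.setInt 0⟩ rfl ?_ ?_ ?_
    · intro s' hf
      simp [hf.int 0 rfl, hin₆.card_edge]
    · rintro i hi s' hf - ⟨P, alive, h⟩
      refine (event_spec h hD hsrc htgt hi hDB hB hpos hl hm).mono le_rfl ?_
      rintro s'' - ⟨P', alive', h'⟩
      exact ⟨P', alive', h'.setInt _⟩
    · rintro s' hf ⟨P, alive, h⟩
      exact h.treeSpec
  · simp only [IExp.cost_lit, RExp.cost_get, IExp.cost_get]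
    have h1 : d ≤ d * d * d := by nlinarith [Nat.mul_le_mul hpos hpos]
    set X := d * d * d * (ℓ + 1) with hX
    have e : 3000 * d * d * d * (ℓ + 1) = 3000 * X := by rw [hX]; ring
    have h2 : d * d * d ≤ X := Nat.le_mul_of_pos_right _ (Nat.succ_pos ℓ)
    have h3 : 1 ≤ X := hpos.trans_le (h1.trans h2)
    have h4 : X ≤ m * X := Nat.le_mul_of_pos_left _ hmpos
    have h5 : m ≤ m * X := Nat.le_mul_of_pos_right _ h3
    have e2 : 800 * d * d * d = 800 * (d * d * d) := by ring
    have e3 : m * (3000 * X + (1 + 1) + 12) = 3000 * (m * X) + 14 * m := by ring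
    have e4 : 6000 * m * X = 6000 * (m * X) := by ring
    rw [e, e2, e3, e4]
    omega

/-! ### The input -/

theorem arrayOf_natCast {α : Type*} [Zero α] {n : ℕ} (v : Fin n → α) (i : Fin n) :
    arrayOf v (i : ℕ) = v i := by
  simp [arrayOf]

theorem matrixArray_vecIdx {α : Type*} [Zero α] {r c : ℕ} (v : Fin r → Fin c → α) (i : Fin r)
    (k : Fin c) : matrixArray v (vecIdx c i k) = v i k := by
  have h : vecIdx c i k = ((finProdFinEquiv (i, k) : Fin (r * c)) : ℕ) := by
    simp [vecIdx, finProdFinEquiv]; ring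
  have e := finProdFinEquiv.symm_apply_apply (i, k)
  rw [finProdFinEquiv_symm_apply, Prod.mk.injEq] at e
  rw [matrixArray, h, arrayOf_natCast, e.1, e.2]

theorem hasInput_inputStore {d n m : ℕ} {K : CellComplex d} {b : Module.Basis (Fin d) ℝ (E d)}
    (f : Set (E d) → ℝ) (G : QuotientGraph K b n m) :
    HasInput (inputStore f G) b G.graph (G.vb f) (G.ev f) where
  dim := by simp [inputStore, arrayOf]
  card_vert := by simp [inputStore, arrayOf]
  card_edge := by simp [inputStore, arrayOf]
  src e := arrayOf_natCast (fun j : Fin m => ((G.src j : ℕ) : ℤ)) e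
  tgt e := arrayOf_natCast (fun j : Fin m => ((G.tgt j : ℕ) : ℤ)) e
  sh e k := matrixArray_vecIdx G.shift e k
  vert i := arrayOf_natCast (fun i : Fin n => f {G.vertex i}) i
  edge e := arrayOf_natCast (fun j : Fin m => f (G.edge j)) e
  basis l c := matrixArray_vecIdx (fun i k : Fin d => b i k) l c


/-! ### The time bound -/

/-- With `log d! ≤ d log d` the logarithm is at most `4 d² log d + 2 d² log y`, while `log (√d * y)`
is `log d / 2 + log y`. This explains the factor √d in the time bound; the constant 10 is generous.
-/
theorem log_pivotBound_le {d y : ℕ} (hd : 0 < d) (hy : 0 < y) :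
    Real.log (pivotBound d y) ≤ 10 * d ^ 2 * Real.log (√d * y) := by
  have hd' : (1 : ℝ) ≤ d := by exact_mod_cast hd
  have hy' : (1 : ℝ) ≤ y := by exact_mod_cast hy
  have hld := Real.log_nonneg hd'
  have hly := Real.log_nonneg hy'
  have hd0 : (d : ℝ) ≠ 0 := by positivity
  have hy0 : (y : ℝ) ≠ 0 := by positivity
  have hf0 : (d.factorial : ℝ) ≠ 0 := by positivity
  have hx : Real.log (√d * y) = Real.log d / 2 + Real.log y := by
    rw [Real.log_mul (by positivity) hy0, Real.log_sqrt (by positivity)]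
  have hf : Real.log d.factorial ≤ d * Real.log d := by
    rw [← Real.log_pow]
    exact Real.log_le_log (by positivity) (by exact_mod_cast Nat.factorial_le_pow d)
  have e : Real.log (pivotBound d y) = Real.log d.factorial + d * (Real.log d +
      2 * (Real.log d.factorial + d * Real.log y)) := by
    unfold pivotBound
    push_cast
    rw [Real.log_mul hf0 (by positivity), Real.log_pow, Real.log_mul hd0 (by positivity),
      Real.log_pow, Real.log_mul hf0 (by positivity), Real.log_pow]
    push_cast; ring
  rw [e, hx]
  have h1 : (d : ℝ) * Real.log d ≤ d ^ 2 * Real.log d :=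
    mul_le_mul_of_nonneg_right (by nlinarith) hld
  have h2 : (d : ℝ) * Real.log d.factorial ≤ d * (d * Real.log d) :=
    mul_le_mul_of_nonneg_left hf (by positivity)
  have h3 : 0 ≤ (d : ℝ) ^ 2 * Real.log d := by positivity
  have h4 : 0 ≤ (d : ℝ) ^ 2 * Real.log y := by positivity
  nlinarith

/-- The exponent is taken for the product of the two numbers to be bounded. The hypothesis makes the
logarithm at least `log 2 / d`, so additive constants are absorbed. The logarithms sum to at most
`14 d² L`, and `14 / log 2 < 21`. -/
theorem exists_word_length {d D m : ℕ} (hd : 0 < d) (hD : 0 < D) (hm : 0 < m)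
    (h : Real.log 2 ≤ d * Real.log (√d * D * m)) :
    ∃ ℓ : ℕ, pivotBound d (D * m) < 2 ^ ℓ ∧ 2 * m ≤ 2 ^ ℓ ∧
      (ℓ + 1 : ℝ) ≤ 21 * d ^ 2 * Real.log (√d * D * m) := by
  set N := pivotBound d (D * m) * (2 * m) with hN
  have hpiv : 0 < pivotBound d (D * m) := by
    have := Nat.mul_pos hD hm
    unfold pivotBound; positivity
  have hlt : N < 2 ^ (Nat.log 2 N + 1) := Nat.lt_pow_succ_log_self (by norm_num) N
  refine ⟨Nat.log 2 N + 1, (Nat.le_mul_of_pos_right _ (by omega)).trans_lt hlt,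
    ((Nat.le_mul_of_pos_left _ hpiv).trans_lt hlt).le, ?_⟩
  have hd' : (1 : ℝ) ≤ d := by exact_mod_cast hd
  have hD' : (1 : ℝ) ≤ D := by exact_mod_cast hD
  have hm' : (1 : ℝ) ≤ m := by exact_mod_cast hm
  have hs : 1 ≤ √(d : ℝ) := by rw [Real.one_le_sqrt]; exact hd'
  set L := Real.log (√d * D * m) with hL
  have hL0 : 0 ≤ L := Real.log_nonneg (by nlinarith [mul_le_mul hs hD' (by norm_num) (by positivity)])
  have h1 : Real.log (pivotBound d (D * m)) ≤ 10 * d ^ 2 * L := by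
    have := log_pivotBound_le hd (Nat.mul_pos hD hm)
    rwa [Nat.cast_mul, ← mul_assoc] at this
  have hml : Real.log m ≤ L := by
    refine Real.log_le_log (by positivity) ?_
    nlinarith [mul_le_mul hs hD' (by norm_num) (by positivity)]
  have h2 : Real.log (2 * m) ≤ d * L + L := by
    rw [Real.log_mul (by norm_num) (by positivity)]; linarith
  have hN0 : N ≠ 0 := by positivity
  have h3 : (Nat.log 2 N : ℝ) * Real.log 2 ≤ 10 * d ^ 2 * L + (d * L + L) := by
    rw [← Real.log_pow]
    refine (Real.log_le_log (by positivity)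
      (by exact_mod_cast Nat.pow_log_le_self 2 hN0 : (2 : ℝ) ^ Nat.log 2 N ≤ N)).trans ?_
    rw [hN, Nat.cast_mul, Real.log_mul (by positivity) (by positivity)]
    push_cast
    linarith
  have h4 : (d : ℝ) * L ≤ d ^ 2 * L := mul_le_mul_of_nonneg_right (by nlinarith) hL0
  have h5 : L ≤ d ^ 2 * L := by nlinarith
  have hlog2 := Real.log_two_gt_d9
  push_cast
  have h6 : ((Nat.log 2 N : ℝ) + 1 + 1) * Real.log 2 ≤ 14 * (d ^ 2 * L) := by linarith
  nlinarith [(by positivity : 0 ≤ (Nat.log 2 N : ℝ) + 1 + 1), (by positivity : 0 ≤ (d : ℝ) ^ 2 * L)]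

theorem time_le {d n m ℓ t : ℕ} {L : ℝ} (hd : 0 < d) (hm : 0 < m)
    (hℓ : (ℓ + 1 : ℝ) ≤ 21 * d ^ 2 * L) (ht : t ≤ 300 * n + 6000 * m * (d * d * d * (ℓ + 1))) :
    (t : ℝ) ≤ 140000 * (n * Real.log n + m * 2 ^ d * d ^ (d + 3) * L) := by
  have hd' : (1 : ℝ) ≤ d := by exact_mod_cast hd
  have hm' : (1 : ℝ) ≤ m := by exact_mod_cast hm
  have hL0 : 0 < L := by
    by_contra h
    push Not at h
    nlinarith
  have ht' : (t : ℝ) ≤ 300 * n + 6000 * m * (d * d * d * (ℓ + 1)) := by exact_mod_cast ht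
  -- The algorithm needs only `d ^ 5` per edge; this inequality passes to the factor `2 ^ d * d ^ (d
  -- + 3)`.
  have h1 : (d : ℝ) * d ≤ 2 ^ d * d ^ d := by
    have h2 : d * d ≤ 2 ^ d * d ^ d :=
      Nat.mul_le_mul Nat.lt_two_pow_self.le (Nat.le_self_pow hd.ne' d)
    exact_mod_cast h2
  set X := (m : ℝ) * 2 ^ d * d ^ (d + 3) * L with hX
  have h3 : (m : ℝ) * (d * d * d * (ℓ + 1)) ≤ 21 * X := by
    calc (m : ℝ) * (d * d * d * (ℓ + 1)) ≤ m * (d * d * d * (21 * d ^ 2 * L)) := by gcongr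
      _ = 21 * (m * d ^ 3 * L) * (d * d) := by ring
      _ ≤ 21 * (m * d ^ 3 * L) * (2 ^ d * d ^ d) := by gcongr
      _ = 21 * X := by rw [hX]; ring
  have h4 : (1 : ℝ) ≤ 21 * X := by
    refine le_trans ?_ h3
    have a : (1 : ℝ) ≤ d * d * d := by nlinarith [mul_le_mul hd' hd' (by norm_num) (by positivity)]
    have b : (1 : ℝ) ≤ (d * d * d) * (ℓ + 1) :=
      one_le_mul_of_one_le_of_one_le a (by simp)
    exact one_le_mul_of_one_le_of_one_le hm' b
  -- For a single vertex `n log n` vanishes, and the linear term is charged to the edges, of which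
  -- there is at least one; otherwise `log n > 1/2`.
  have h5 : (n : ℝ) ≤ 2 * (n * Real.log n) + 21 * X := by
    rcases Nat.lt_or_ge n 2 with h | h
    · have : (n : ℝ) ≤ 1 := by exact_mod_cast Nat.le_of_lt_succ h
      have : 0 ≤ (n : ℝ) * Real.log n := mul_nonneg (by positivity) (Real.log_natCast_nonneg n)
      linarith
    · have h6 : Real.log 2 ≤ Real.log n := Real.log_le_log (by norm_num) (by exact_mod_cast h)
      nlinarith [Real.log_two_gt_d9, (by positivity : (0 : ℝ) ≤ n)]
  have h7 : 0 ≤ (n : ℝ) * Real.log n := mul_nonneg (by positivity) (Real.log_natCast_nonneg n)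
  linarith

theorem QuotientGraph.abs_shift_le {d n m : ℕ} {K : CellComplex d} {b : Module.Basis (Fin d) ℝ (E d)}
    (G : QuotientGraph K b n m) (e : Fin m) (k : Fin d) : |G.shift e k| ≤ G.shiftMagnitude := by
  rw [Int.abs_eq_natAbs, Nat.cast_le]
  exact (Finset.le_sup (f := fun k : Fin d => (G.shift e k).natAbs) (Finset.mem_univ k)).trans
    (Finset.le_sup (f := fun j : Fin m => Finset.univ.sup fun k : Fin d => (G.shift j k).natAbs)
      (Finset.mem_univ e))


end PMT

end

theorem mainTheorem6 :
    ∃ (A : PMT.Program) (C : ℝ),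
      ∀ (d n m : ℕ) (b : Module.Basis (Fin d) ℝ (PMT.E d)) (K : PMT.CellComplex d)
        (f : Set (PMT.E d) → ℝ),
        K.IsPeriodic (PMT.latticeOf b) → K.IsPeriodicFilter (PMT.latticeOf b) f →
        ∀ G : PMT.QuotientGraph K b n m,
          2 ≤ (√(d : ℝ) * G.shiftMagnitude * m) ^ d →
          ∃ (s : PMT.Store) (t : ℕ),
            PMT.Runs A (PMT.inputStore f G) s t ∧
            (t : ℝ) ≤ C * (n * Real.log n +
              m * 2 ^ d * d ^ (d + 3) * Real.log (√(d : ℝ) * G.shiftMagnitude * m)) ∧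
            PMT.Represents (PMT.outputTree n s) f G := by
  refine ⟨PMT.Prog.main, 140000, fun d n m b K f hK hf G h2 => ?_⟩
  -- The numerical assumption rules out degenerate data: in dimension 0 the power would be 1, and
  -- without edges or with all shifts zero it would be 0.
  have hd : 0 < d := by
    rcases Nat.eq_zero_or_pos d with rfl | h
    · norm_num at h2
    · exact h
  have hD : 0 < G.shiftMagnitude := by
    rcases Nat.eq_zero_or_pos G.shiftMagnitude with h | h
    · rw [h] at h2
      norm_num [hd.ne'] at h2
    · exact h
  have hm : 0 < m := by
    rcases Nat.eq_zero_or_pos m with h | h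
    · have : (m : ℝ) = 0 := by exact_mod_cast h
      rw [this] at h2
      norm_num [hd.ne'] at h2
    · exact h
  have hL : Real.log 2 ≤ d * Real.log (√(d : ℝ) * G.shiftMagnitude * m) := by
    rw [← Real.log_pow]
    exact Real.log_le_log (by norm_num) h2
  obtain ⟨ℓ, h3, h4, h5⟩ := PMT.exists_word_length hd hD hm hL
  -- The bound on the generators is chosen as `B = D * m`. Filter monotonicity gives that no edge
  -- has a smaller value than its endpoints.
  obtain ⟨s, t, hr, ht, hT⟩ := PMT.main_spec (PMT.hasInput_inputStore f G) (fun _ => rfl)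
    (fun _ => rfl) (fun _ => rfl) G.abs_shift_le
    (fun e => G.vb_le hf hK (G.edge_mem e).1 ((G.mem_edge_iff hK e _).2 (.inl rfl)))
    (fun e => G.vb_le hf hK (G.edge_mem e).1 ((G.mem_edge_iff hK e _).2 (.inr rfl)))
    hm le_rfl (Nat.mul_pos hD hm) hd h3 h4
  exact ⟨s, t, hr, PMT.time_le hd hm h5 ht, PMT.QuotientGraph.represents hK hf G hT⟩
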